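/- \textbf{Setting.} Let $G$ be the Kagomé lattice: the triangular lattice with a sublattice of index $4$ removed, two sites being joined if they were nearest neighbours. The zero-temperature $q$-state Potts antiferromagnet on $G$ has spins $\sigma_x\in\{1,\dots,q\}$ and a Boltzmann factor $1-\delta_{\sigma_x\sigma_y}$ for each edge $xy$. For a system given by local Boltzmann factors, the kernel $\pi_\Lambda(\cdot\mid\sigma)$ is the normalized product of all factors that involve a site of the finite set $\Lambda$. A probability measure is a Gibbs measure if, for every finite $\Lambda$, its conditional law in $\Lambda$ given the spins outside $\Lambda$ is $\pi_\Lambda$. Put $c_{xy}=\sup\sup_A|\pi_{\{x\}}(A\mid\sigma)-\pi_{\{x\}}(A\mid\sigma')|$, the outer supremum being over all pairs $\sigma,\sigma'$ that differ only at $y$, and let $\alpha=\sup_x\sum_{y\ne x}c_{xy}$ (the Dobrushin constant). Exponential decay of correlations of $\mu$ means that there are $m>0$ and $C$ with $$|\mu(fg)-\mu(f)\mu(g)|\le C\sum_{x,y}\delta_x(f)\,e^{-m\,d(x,y)}\,\delta_y(g)$$ for all continuous $f,g$ of finite total oscillation $\sum_x\delta_x(\cdot)<\infty$, where $\delta_x(f)$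 is the oscillation of $f$ at $x$ and $d$ is the graph distance of $G$. \textbf{Decimation.} Given a family of clusters of sites that are disjoint and not joined by edges, the decimated model lives on the remaining sites. Its factors are, for each cluster, the sum over the cluster's spins of the product of the factors $1-\delta$ over all edges meeting the cluster, and, for each edge between remaining sites, the factor $1-\delta$. The remaining sites adjacent to a given cluster form its plaquette. \textbf{(1) Main result.} For every $q\ge 6$ the zero-temperature Potts antiferromagnet on the Kagomé lattice has exactly one infinite-volume Gibbs measure, and its correlations decay exponentially. \textbf{(2) Cluster decimation.} In coordinates where $(a,b)$ denotes $ae_1+be_2$, with $e_1,e_2$ unit vectors at $60^\circ$, and the Kagomé sites are the points of $\mathbb Z^2$ that do not have both coordinates odd, sum out the triangular faces $\{(4i+2,4j+2),(4i+3,4j+2),(4i+2,4j+3)\}$ and $\{(4i,4j),(4i-1,4j),(4i,4j-1)\}$, $i,j\in\mathbb Z$. They are disjoint and not joined by edges. Each remaining site $x$ has two first neighbours (joined to $x$ by an edge of $G$), one second neighbour (on both plaquettes of $x$), and, among the sites that are not first neighbours and lie on exactly one plaquette with $x$, two fourth neighbours (joined by an edge to the second neighbour) and four third neighbours (not so joined).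 With links between first and second neighbours, the remaining sites form a hexagonal lattice in which every plaquette is a hexagonal face. For $q\ge4$: the law of the remaining spins under any Gibbs measure of the Potts model is a Gibbs measure of the decimated model; all single-site kernels of the decimated model are well defined; $c_{xy}$ takes one value $c_{1n},c_{2n},c_{3n},c_{4n}$ on each type of neighbour pair and vanishes on all other pairs $x\neq y$; and $$\alpha=2c_{1n}+c_{2n}+4c_{3n}+2c_{4n}.$$ For $q=6$ one has $\alpha<1$, and the decimated model has exactly one Gibbs measure, with exponential decay of correlations. \textbf{(3) Single-site decimation.} Sum out the top vertices $(2i,2j+1)$ of the up-pointing triangles, which are pairwise non-adjacent. The remaining sites form a square lattice in which the surviving edges of $G$ are the horizontal links and each plaquette is the set of corners of a unit square. Each remaining site has two nearest neighbours (joined by an edge of $G$) and four next-to-nearest neighbours (not joined, but on a common plaquette). For $q\ge5$: the law of the remaining spins under any Gibbs measure of the Potts model is a Gibbs measure of the decimated model; all single-site kernels of the decimated model are well defined; $c_{xy}$ takes one value $c_{nn}$, $c_{nnn}$ on each of the two types of pairs and vanishes on all other pairs $x\neq y$; $\alpha=2c_{nn}+4c_{nnn}$; and $\alpha<1$ if and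 only if $q\ge7$. For $q\ge7$ the decimated model has exactly one Gibbs measure, with exponential decay of correlations. -/

import Mathlib

open MeasureTheory
open scoped ENNReal

namespace KagomePotts

noncomputable section

/-! ### Finite-state lattice systems given by local weights -/

/-- A lattice system with site set `S` and state space `Fin q`, given by a family of local
Boltzmann factors `weight A = exp (-Φ_A)`, each depending only on the spins in `supp A`.
A factor may vanish, which corresponds to an infinite energy. -/
structure LocalWeights (S : Type) (q : ℕ) where
  Index : Type
  supp : Index → Set S
  weight : Index → (S → Fin q) → ℝ
  weight_nonneg : ∀ A σ, 0 ≤ weight A σ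
  weight_local : ∀ A σ τ, (∀ x ∈ supp A, σ x = τ x) → weight A σ = weight A τ

namespace LocalWeights

variable {S : Type} {q : ℕ}

open Classical in
/-- The configuration equal to `τ` in `Λ` and to `σ` outside `Λ`. -/
def glue (Λ : Finset S) (τ : Λ → Fin q) (σ : S → Fin q) : S → Fin q :=
  fun x => if h : x ∈ Λ then τ ⟨x, h⟩ else σ x

/-- The Boltzmann weight in volume `Λ`: the product of all factors whose support meets `Λ`. -/
def boltzmann (W : LocalWeights S q) (Λ : Finset S) (σ : S → Fin q) : ℝ :=
  ∏ᶠ (A : W.Index) (_ : (W.supp A ∩ (Λ : Set S)).Nonempty), W.weight A σ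

open Classical in
/-- The partition function in volume `Λ` with boundary condition `σ`. -/
def partition (W : LocalWeights S q) (Λ : Finset S) (σ : S → Fin q) : ℝ :=
  ∑ τ : Λ → Fin q, W.boltzmann Λ (glue Λ τ σ)

/-- The specification `π_Λ(τ | σ)`. -/
def kernel (W : LocalWeights S q) (Λ : Finset S) (τ : Λ → Fin q) (σ : S → Fin q) : ℝ :=
  W.boltzmann Λ (glue Λ τ σ) / W.partition Λ σ

/-- The probability `π_{x}(A | σ)` that the spin at `x` lies in `A`, given all other spins. -/
def siteProb (W : LocalWeights S q) (x : S) (A : Finset (Fin q)) (σ : S → Fin q) : ℝ :=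
  ∑ s ∈ A, W.kernel {x} (fun _ => s) σ

/-- Dobrushin's interdependence constant `c_{xy}`: the supremum, over pairs of configurations that
differ only at `y`, of `sup_A |π_{x}(A | σ) - π_{x}(A | σ')|`. -/
def interdep (W : LocalWeights S q) (x y : S) : ℝ≥0∞ :=
  ⨆ (σ : S → Fin q) (σ' : S → Fin q) (_ : ∀ z, z ≠ y → σ z = σ' z) (A : Finset (Fin q)),
    ENNReal.ofReal |W.siteProb x A σ - W.siteProb x A σ'|

/-- The Dobrushin constant `α = sup_x ∑_{y ≠ x} c_{xy}`. -/
def dobrushin (W : LocalWeights S q) : ℝ≥0∞ :=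
  ⨆ x : S, ∑' y : {y : S // y ≠ x}, W.interdep x y

/-- Infinite-volume Gibbs measures: for every finite `Λ` the conditional law of the spins in `Λ`,
given the spins outside `Λ`, is `π_Λ`. -/
def IsGibbs (W : LocalWeights S q) (μ : Measure (S → Fin q)) : Prop :=
  IsProbabilityMeasure μ ∧
    ∀ (Λ : Finset S) (τ : Λ → Fin q),
      μ[Set.indicator {σ : S → Fin q | ∀ x : Λ, σ x = τ x} (fun _ => (1 : ℝ)) |
          MeasurableSpace.comap (fun (σ : S → Fin q) (x : {x : S // x ∉ Λ}) => σ x)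
            MeasurableSpace.pi] =ᵐ[μ] fun σ => W.kernel Λ τ σ

end LocalWeights

/-- The oscillation `δ_x(f)` of a function at the site `x`. -/
def oscillation {S : Type} {q : ℕ} (f : (S → Fin q) → ℝ) (x : S) : ℝ :=
  ⨆ p : {p : (S → Fin q) × (S → Fin q) // ∀ z, z ≠ x → p.1 z = p.2 z}, |f p.1.1 - f p.1.2|

/-- Exponential decay of correlations with respect to a distance `d` on the sites, for continuous
(that is, quasilocal) functions of finite total oscillation. -/
def ExponentialDecay {S : Type} {q : ℕ} (d : S → S → ℕ) (μ : Measure (S → Fin q)) : Prop :=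
  ∃ m C : ℝ, 0 < m ∧ ∀ f g : C(S → Fin q, ℝ),
    Summable (oscillation f) → Summable (oscillation g) →
      |∫ σ, f σ * g σ ∂μ - (∫ σ, f σ ∂μ) * ∫ σ, g σ ∂μ| ≤
        C * ∑' x : S, ∑' y : S, oscillation f x * Real.exp (-m * (d x y : ℝ)) * oscillation g y

/-- There is exactly one infinite-volume Gibbs measure, and its correlations decay
exponentially. -/
def UniqueWithDecay {S : Type} {q : ℕ} (d : S → S → ℕ) (W : LocalWeights S q) : Prop :=
  ∃ μ : Measure (S → Fin q), W.IsGibbs μ ∧ (∀ ν, W.IsGibbs ν → ν = μ) ∧ ExponentialDecay d μ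

/-! ### The zero-temperature Potts antiferromagnet and its decimations -/

section Potts

open Classical in
/-- The factor `1 - δ_{σ_x σ_y}` of an edge `e = {x, y}`. -/
def edgeFactor {S : Type} {q : ℕ} (e : Sym2 S) (σ : S → Fin q) : ℝ :=
  if (e.map σ).IsDiag then 0 else 1

theorem edgeFactor_nonneg {S : Type} {q : ℕ} (e : Sym2 S) (σ : S → Fin q) :
    0 ≤ edgeFactor e σ := by
  unfold edgeFactor
  split_ifs <;> norm_num

theorem edgeFactor_local {S : Type} {q : ℕ} (e : Sym2 S) (σ τ : S → Fin q)
    (h : ∀ x ∈ {x | x ∈ e}, σ x = τ x) : edgeFactor e σ = edgeFactor e τ := by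
  unfold edgeFactor
  rw [Sym2.map_congr (fun x hx => h x hx)]

/-- The `q`-state Potts antiferromagnet on `G` at zero temperature (`J = -∞`): one factor
`1 - δ_{σ_x σ_y}` for each edge `{x, y}`. -/
def potts {V : Type} (G : SimpleGraph V) (q : ℕ) : LocalWeights V q where
  Index := G.edgeSet
  supp e := {x | x ∈ (e : Sym2 V)}
  weight e σ := edgeFactor (e : Sym2 V) σ
  weight_nonneg _ σ := edgeFactor_nonneg _ σ
  weight_local _ σ τ h := edgeFactor_local _ σ τ h

variable {V ι : Type}

/-- The sites that remain when the clusters `K i` are summed out. -/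
abbrev Remaining (K : ι → Set V) : Type := {x : V // ∀ i, x ∉ K i}

/-- The links of `G` between remaining sites. -/
abbrev linkGraph (G : SimpleGraph V) (K : ι → Set V) : SimpleGraph (Remaining K) :=
  G.comap Subtype.val

/-- The remaining site `x` is a neighbour in `G` of some site of the cluster `K i`, that is, `x`
lies on the plaquette surrounding this cluster. -/
def Borders (G : SimpleGraph V) (K : ι → Set V) (i : ι) (x : Remaining K) : Prop :=
  ∃ u ∈ K i, G.Adj u x

/-- The effective weight obtained by summing over the spins of the cluster `K i` the product of the
factors `1 - δ` over all edges of `G` inside the cluster or joining it to a remaining site; it is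
the number of spin assignments of the cluster for which none of these factors vanishes. -/
def clusterWeight (G : SimpleGraph V) {q : ℕ} (K : ι → Set V) (i : ι)
    (t : Remaining K → Fin q) : ℕ :=
  Nat.card {η : K i → Fin q //
    (∀ u v : K i, G.Adj u v → η u ≠ η v) ∧
    (∀ (u : K i) (y : Remaining K), G.Adj u y → η u ≠ t y)}

/-- The decimated model on the remaining sites: one effective weight for each cluster that was
summed out, and the original factor `1 - δ` for each surviving link. (The sum over all decimated
spins factorizes in this way when distinct clusters are disjoint and not joined by an edge.) -/
def decimated (G : SimpleGraph V) (K : ι → Set V) (q : ℕ) : LocalWeights (Remaining K) q where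
  Index := ι ⊕ (linkGraph G K).edgeSet
  supp := Sum.elim (fun i => {x | Borders G K i x})
    (fun e => {x | x ∈ (e : Sym2 (Remaining K))})
  weight := Sum.elim (fun i t => (clusterWeight G K i t : ℝ))
    (fun e t => edgeFactor (e : Sym2 (Remaining K)) t)
  weight_nonneg := by
    rintro (i | e) σ
    · exact Nat.cast_nonneg _
    · exact edgeFactor_nonneg _ σ
  weight_local := by
    rintro (i | e) σ τ h
    · have hc : clusterWeight G K i σ = clusterWeight G K i τ := by
        unfold clusterWeight
        congr 2
        funext η
        congr 1
        refine propext (forall_congr' fun u => forall_congr' fun y => ?_)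
        refine forall_congr' fun ha => ?_
        rw [h y ⟨u, u.2, ha⟩]
      exact congrArg (Nat.cast : ℕ → ℝ) hc
    · exact edgeFactor_local _ σ τ h

/-- Distinct clusters are disjoint and not connected by any edge. -/
def SeparatedClusters (G : SimpleGraph V) (K : ι → Set V) : Prop :=
  ∀ i j, i ≠ j → Disjoint (K i) (K j) ∧ ∀ u ∈ K i, ∀ v ∈ K j, ¬ G.Adj u v

/-- Summing out turns Gibbs measures of the Potts model into Gibbs measures of the decimated
model: the law of the remaining spins is a Gibbs measure for the effective weights. -/
def DecimationMapsGibbs (G : SimpleGraph V) (K : ι → Set V) (q : ℕ) : Prop :=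
  ∀ μ : Measure (V → Fin q), (potts G q).IsGibbs μ →
    (decimated G K q).IsGibbs (μ.map fun σ (x : Remaining K) => σ x)

/-- The number of plaquettes (surroundings of clusters) that contain both `x` and `y`. -/
def sharedPlaquettes (G : SimpleGraph V) (K : ι → Set V) (x y : Remaining K) : ℕ :=
  {i | Borders G K i x ∧ Borders G K i y}.ncard

end Potts

/-! ### The Kagomé lattice -/

/-- The triangular lattice: the point `(a, b)` stands for `a e₁ + b e₂`, where `e₁`, `e₂` are unit
vectors at an angle of 60 degrees. -/
def triangular : SimpleGraph (ℤ × ℤ) where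
  Adj p r := (r.1 - p.1 = 1 ∧ r.2 - p.2 = 0) ∨ (r.1 - p.1 = -1 ∧ r.2 - p.2 = 0) ∨
    (r.1 - p.1 = 0 ∧ r.2 - p.2 = 1) ∨ (r.1 - p.1 = 0 ∧ r.2 - p.2 = -1) ∨
    (r.1 - p.1 = 1 ∧ r.2 - p.2 = -1) ∨ (r.1 - p.1 = -1 ∧ r.2 - p.2 = 1)
  symm := ⟨fun p r h => by omega⟩
  loopless := ⟨fun p h => by omega⟩

/-- The Kagomé lattice is the triangular lattice with the points of a sublattice of index four (the
points with two odd coordinates) removed; these are the centres of its hexagonal faces. -/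
abbrev KagomeSite : Type := {p : ℤ × ℤ // ¬ (Odd p.1 ∧ Odd p.2)}

/-- Nearest-neighbour bonds of the Kagomé lattice. -/
abbrev kagome : SimpleGraph KagomeSite := triangular.comap Subtype.val

/-- The hexagonal lattice is the triangular lattice with the points of a sublattice of index three
(the points `(a, b)` with `3 ∣ a - b`) removed; these are the centres of its hexagonal faces. -/
abbrev HexSite : Type := {p : ℤ × ℤ // ¬ (3 : ℤ) ∣ p.1 - p.2}

/-- Nearest-neighbour bonds of the hexagonal lattice. -/
abbrev hexagonal : SimpleGraph HexSite := triangular.comap Subtype.val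

/-- Single-site decimation: the sites to be summed out are the top vertices `(2i, 2j+1)` of the
up-pointing triangles `(2i, 2j)`, `(2i+1, 2j)`, `(2i, 2j+1)`. -/
def topVertex (i : ℤ × ℤ) : Set KagomeSite :=
  {v | v.1 = (2 * i.1, 2 * i.2 + 1)}

/-- Cluster decimation: the triangular faces to be summed out. For each `(i, j)` there is one
up-pointing and one down-pointing triangle. -/
def triangleCluster : (ℤ × ℤ) ⊕ (ℤ × ℤ) → Set KagomeSite
  | .inl (i, j) => {v | v.1 = (4 * i + 2, 4 * j + 2) ∨ v.1 = (4 * i + 3, 4 * j + 2) ∨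
      v.1 = (4 * i + 2, 4 * j + 3)}
  | .inr (i, j) => {v | v.1 = (4 * i, 4 * j) ∨ v.1 = (4 * i - 1, 4 * j) ∨
      v.1 = (4 * i, 4 * j - 1)}

/-- Distance of two remaining sites, measured in the Kagomé lattice. -/
def remDist {ι : Type} (K : ι → Set KagomeSite) (x y : Remaining K) : ℕ :=
  kagome.dist x y

/-! Types of neighbours for the decimation of single sites. -/

/-- Nearest neighbours: connected by an original link. -/
def SiteNN (x y : Remaining topVertex) : Prop :=
  (linkGraph kagome topVertex).Adj x y

/-- Next-to-nearest neighbours: on a common plaquette, but not connected by an original link. -/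
def SiteNNN (x y : Remaining topVertex) : Prop :=
  x ≠ y ∧ ¬ SiteNN x y ∧ 1 ≤ sharedPlaquettes kagome topVertex x y

/-! Types of neighbours for the decimation of triangles. -/

/-- Nearest neighbours: connected by an original link. -/
def Cluster1 (x y : Remaining triangleCluster) : Prop :=
  (linkGraph kagome triangleCluster).Adj x y

/-- Second neighbours: they lie on both plaquettes of `x`. -/
def Cluster2 (x y : Remaining triangleCluster) : Prop :=
  x ≠ y ∧ sharedPlaquettes kagome triangleCluster x y = 2

/-- Third neighbours: on exactly one plaquette with `x`, not linked to `x`, and not linked to the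
second neighbour of `x`. -/
def Cluster3 (x y : Remaining triangleCluster) : Prop :=
  sharedPlaquettes kagome triangleCluster x y = 1 ∧ ¬ Cluster1 x y ∧
    ¬ ∃ z, Cluster2 x z ∧ Cluster1 z y

/-- Fourth neighbours: on exactly one plaquette with `x`, not linked to `x`, but linked to the
second neighbour of `x`. -/
def Cluster4 (x y : Remaining triangleCluster) : Prop :=
  sharedPlaquettes kagome triangleCluster x y = 1 ∧ ¬ Cluster1 x y ∧
    ∃ z, Cluster2 x z ∧ Cluster1 z y

end

end KagomePotts

open KagomePotts

/-! The engine is Dobrushin's criterion: if the total influence on a spin is below 1, repeated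
resampling by the Gibbs kernels washes out every observable. Let `v y` bound the oscillation of `f`
at `y`. Averaging over a block removes the oscillations inside it and passes part of them on to the
sites that influence the block. If, measured in weights `w`, at most a fraction `β < 1` is passed
on, finitely many updates make the total oscillation arbitrarily small. Gibbs measures are invariant
under these updates, so they all agree. For the decay, an update changes the covariance of `f` and
`g` by at most the product of their total oscillations in the block. This is charged to the decrease
of the potential `∑ v y * H y`, where `H y` is `w y` times the sum of `exp (-m d(y, x)) δ_x(g)` over
`x`; for small `m` the function `H` still satisfies the contraction inequality. The result is
`uniqueWithDecay_of_blocks`.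

The criterion is verified for the decimated models, where the blocks are single sites. The Potts
model then follows directly, with blocks made of a remaining site and the clusters around it
(`Decimable.uniqueWithDecay_potts`). Resampling such a block is a decimated update of the site
combined with a resampling of the clusters, and a large weight on the cluster sites makes a crude
estimate for the latter sufficient. The link between the models is that the Potts kernel of a block,
applied to functions of the remaining spins, is the kernel of the decimated model
(`Decimable.avg_block`).

In the decimated models a site interacts with 6 or 9 neighbours through explicit counting weights,
so `α` is a finite sum of influences. For single-site decimation and `q ≥ 7` the influences are at
most 4/13 (twice) and 9/100 (four times), with sum below 1; for `q = 5, 6` explicit boundary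
conditions give `α ≥ 1`. For `q = 6` triangles are summed out instead. The weight of a site is then
a product of two counts of colourings of a triangle. When a spin in one factor changes, the other
factor matters only through its zero and the fact that its other values vary by a factor of at most
5/4. Seven colours are left, which colour symmetry reduces to 876 cases checked by computation. The
bounds are 0.33 for first, 0.084 for second and 0.042 for third and fourth neighbours, with total
0.996. -/

namespace KagomePotts

noncomputable section

open Filter Topology

/-! ### Configurations with prescribed spins in a finite volume. -/

section Glue

variable {S : Type} {q : ℕ}

open LocalWeights

theorem glue_of_mem {Λ : Finset S} (τ : Λ → Fin q) (σ : S → Fin q) {x : S} (h : x ∈ Λ) :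
    glue Λ τ σ x = τ ⟨x, h⟩ := by
  simp [glue, h]

theorem glue_of_notMem {Λ : Finset S} (τ : Λ → Fin q) (σ : S → Fin q) {x : S} (h : x ∉ Λ) :
    glue Λ τ σ x = σ x := by
  simp [glue, h]

theorem glue_restrict {Λ : Finset S} {σ σ' : S → Fin q} (h : ∀ x ∉ Λ, σ' x = σ x) :
    glue Λ (fun x => σ' x) σ = σ' := by
  funext x
  by_cases hx : x ∈ Λ
  · rw [glue_of_mem _ _ hx]
  · rw [glue_of_notMem _ _ hx, h x hx]

theorem glue_congr {Λ : Finset S} (τ : Λ → Fin q) {σ σ' : S → Fin q} (h : ∀ x ∉ Λ, σ x = σ' x) :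
    glue Λ τ σ = glue Λ τ σ' := by
  funext x
  by_cases hx : x ∈ Λ
  · rw [glue_of_mem _ _ hx, glue_of_mem _ _ hx]
  · rw [glue_of_notMem _ _ hx, glue_of_notMem _ _ hx, h x hx]

theorem continuous_glue {Λ : Finset S} (τ : Λ → Fin q) : Continuous (glue Λ τ) := by
  refine continuous_pi fun x => ?_
  by_cases hx : x ∈ Λ
  · simp only [glue_of_mem _ _ hx]; exact continuous_const
  · simp only [glue_of_notMem _ _ hx]; exact continuous_apply x

theorem continuous_of_dependsOn {β : Type*} [TopologicalSpace β] {f : (S → Fin q) → β}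
    {F : Set S} (hF : F.Finite) (h : DependsOn f F) : Continuous f := by
  lift F to Finset S using hF
  rcases isEmpty_or_nonempty (S → Fin q) with hE | ⟨⟨σ₀⟩⟩
  · exact continuous_of_const fun σ => hE.elim σ
  · have : f = (fun t : F → Fin q => f (glue F t σ₀)) ∘ fun σ x => σ x := by
      funext σ
      refine h fun x hx => ?_
      rw [glue_of_mem _ _ (Finset.mem_coe.1 hx)]
    rw [this]
    exact continuous_of_discreteTopology.comp (continuous_pi fun x => continuous_apply _)

/-- The sum over the spins in `Λ`. -/
def sumOver (Λ : Finset S) [DecidableEq S] (h : (S → Fin q) → ℝ) (σ : S → Fin q) : ℝ :=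
  ∑ τ : Λ → Fin q, h (glue Λ τ σ)

/-- The inner sum overwrites the spins that the outer sum has put in `Λ`. Exchanging these with the
inner spins is an involution `φ` on pairs, after which the summand no longer depends on the second
component. -/
theorem sumOver_sumOver [DecidableEq S] {Λ Λ' : Finset S} (hΛ : Λ ⊆ Λ') (h : (S → Fin q) → ℝ)
    (σ : S → Fin q) :
    sumOver Λ' (sumOver Λ h) σ = (Fintype.card (Λ → Fin q) : ℝ) * sumOver Λ' h σ := by
  have key : ∀ (τ' : Λ' → Fin q) (τ : Λ → Fin q), glue Λ τ (glue Λ' τ' σ) =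
      glue Λ' (fun x => if hx : (x : S) ∈ Λ then τ ⟨x, hx⟩ else τ' x) σ := by
    intro τ' τ
    funext x
    by_cases hx : x ∈ Λ
    · rw [glue_of_mem _ _ hx, glue_of_mem _ _ (hΛ hx)]; simp [hx]
    · rw [glue_of_notMem _ _ hx]
      by_cases hx' : x ∈ Λ'
      · rw [glue_of_mem _ _ hx', glue_of_mem _ _ hx']; simp [hx]
      · rw [glue_of_notMem _ _ hx', glue_of_notMem _ _ hx']
  let φ : ((Λ' → Fin q) × (Λ → Fin q)) → ((Λ' → Fin q) × (Λ → Fin q)) := fun p =>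
    (fun x => if hx : (x : S) ∈ Λ then p.2 ⟨x, hx⟩ else p.1 x, fun x => p.1 ⟨x, hΛ x.2⟩)
  have hφ : Function.Involutive φ := by
    rintro ⟨a, b⟩
    simp only [φ, Prod.mk.injEq]
    constructor
    · funext x
      by_cases hx : (x : S) ∈ Λ <;> simp [hx]
    · funext x
      simp
  have h1 : sumOver Λ' (sumOver Λ h) σ = ∑ p : (Λ' → Fin q) × (Λ → Fin q),
      h (glue Λ' (φ p).1 σ) := by
    rw [Fintype.sum_prod_type]
    simp only [sumOver, key, φ]
  rw [h1, show ∑ p, h (glue Λ' (φ p).1 σ) = ∑ p : (Λ' → Fin q) × (Λ → Fin q), h (glue Λ' p.1 σ) from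
    Equiv.sum_comp (hφ.toPerm φ) (fun p => h (glue Λ' p.1 σ)), Fintype.sum_prod_type]
  simp [sumOver, Finset.mul_sum]

end Glue

/-! ### Specifications of finite-range weights: positivity, consistency, Gibbs measures. -/

namespace LocalWeights

variable {S : Type} {q : ℕ}

/-- Each site lies in the support of finitely many factors and each support is finite. -/
structure IsLocal (W : LocalWeights S q) : Prop where
  finite_index : ∀ x, {A | x ∈ W.supp A}.Finite
  finite_supp : ∀ A, (W.supp A).Finite

/-- The factors that involve a site of `Λ`. -/
def touching (W : LocalWeights S q) (Λ : Finset S) : Set W.Index :=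
  {A | (W.supp A ∩ (Λ : Set S)).Nonempty}

/-- The sites that share a factor with a site of `Λ`. -/
def closureOf (W : LocalWeights S q) (Λ : Finset S) : Set S :=
  ⋃ A ∈ W.touching Λ, W.supp A

theorem mem_touching_singleton {W : LocalWeights S q} {x : S} {A : W.Index} :
    A ∈ W.touching {x} ↔ x ∈ W.supp A := by
  simp [touching]

variable {W : LocalWeights S q}

theorem IsLocal.finite_touching (hW : W.IsLocal) (Λ : Finset S) : (W.touching Λ).Finite := by
  refine (Λ.finite_toSet.biUnion fun x _ => hW.finite_index x).subset ?_
  rintro A ⟨x, hx, hxΛ⟩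
  exact Set.mem_biUnion hxΛ hx

theorem IsLocal.finite_closureOf (hW : W.IsLocal) (Λ : Finset S) : (W.closureOf Λ).Finite :=
  (hW.finite_touching Λ).biUnion fun A _ => hW.finite_supp A

theorem IsLocal.boltzmann_eq (hW : W.IsLocal) (Λ : Finset S) (σ : S → Fin q) :
    W.boltzmann Λ σ = ∏ A ∈ (hW.finite_touching Λ).toFinset, W.weight A σ :=
  finprod_mem_eq_finite_toFinset_prod _ (hW.finite_touching Λ)

theorem IsLocal.boltzmann_nonneg (hW : W.IsLocal) (Λ : Finset S) (σ : S → Fin q) :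
    0 ≤ W.boltzmann Λ σ := by
  rw [hW.boltzmann_eq]
  exact Finset.prod_nonneg fun A _ => W.weight_nonneg A σ

theorem IsLocal.boltzmann_pos_iff (hW : W.IsLocal) {Λ : Finset S} {σ : S → Fin q} :
    0 < W.boltzmann Λ σ ↔ ∀ A ∈ W.touching Λ, 0 < W.weight A σ := by
  constructor
  · intro h A hA
    refine lt_of_le_of_ne (W.weight_nonneg A σ) fun h0 => h.ne' ?_
    rw [hW.boltzmann_eq]
    exact Finset.prod_eq_zero ((hW.finite_touching Λ).mem_toFinset.2 hA) h0.symm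
  · intro h
    rw [hW.boltzmann_eq]
    exact Finset.prod_pos fun A hA => h A ((hW.finite_touching Λ).mem_toFinset.1 hA)

theorem IsLocal.dependsOn_boltzmann (hW : W.IsLocal) (Λ : Finset S) :
    DependsOn (W.boltzmann Λ) (W.closureOf Λ) := by
  intro σ τ h
  rw [hW.boltzmann_eq, hW.boltzmann_eq]
  refine Finset.prod_congr rfl fun A hA => W.weight_local A σ τ fun x hx => h x ?_
  exact Set.mem_biUnion ((hW.finite_touching Λ).mem_toFinset.1 hA) hx

theorem boltzmann_glue_congr (hW : W.IsLocal) {Λ : Finset S} (τ : Λ → Fin q) {σ σ' : S → Fin q}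
    (h : ∀ x ∈ W.closureOf Λ \ Λ, σ x = σ' x) :
    W.boltzmann Λ (glue Λ τ σ) = W.boltzmann Λ (glue Λ τ σ') := by
  refine hW.dependsOn_boltzmann Λ fun x hx => ?_
  by_cases hxΛ : x ∈ Λ
  · rw [glue_of_mem _ _ hxΛ, glue_of_mem _ _ hxΛ]
  · rw [glue_of_notMem _ _ hxΛ, glue_of_notMem _ _ hxΛ, h x ⟨hx, hxΛ⟩]

theorem IsLocal.dependsOn_partition (hW : W.IsLocal) (Λ : Finset S) :
    DependsOn (W.partition Λ) (W.closureOf Λ \ Λ) := by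
  intro σ σ' h
  exact Finset.sum_congr rfl fun τ _ => boltzmann_glue_congr hW τ h

theorem IsLocal.dependsOn_kernel (hW : W.IsLocal) (Λ : Finset S) (τ : Λ → Fin q) :
    DependsOn (W.kernel Λ τ) (W.closureOf Λ \ Λ) := by
  intro σ σ' h
  rw [kernel, kernel, boltzmann_glue_congr hW τ h, hW.dependsOn_partition Λ h]

theorem IsLocal.continuous_kernel (hW : W.IsLocal) (Λ : Finset S) (τ : Λ → Fin q) :
    Continuous (W.kernel Λ τ) :=
  continuous_of_dependsOn ((hW.finite_closureOf Λ).subset Set.sdiff_subset)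
    (hW.dependsOn_kernel Λ τ)

theorem IsLocal.partition_nonneg (hW : W.IsLocal) (Λ : Finset S) (σ : S → Fin q) :
    0 ≤ W.partition Λ σ :=
  Finset.sum_nonneg fun _ _ => hW.boltzmann_nonneg _ _

theorem IsLocal.kernel_nonneg (hW : W.IsLocal) (Λ : Finset S) (τ : Λ → Fin q) (σ : S → Fin q) :
    0 ≤ W.kernel Λ τ σ :=
  div_nonneg (hW.boltzmann_nonneg _ _) (hW.partition_nonneg _ _)

theorem sum_kernel {Λ : Finset S} [DecidableEq S] {σ : S → Fin q} (h : 0 < W.partition Λ σ) :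
    ∑ τ : Λ → Fin q, W.kernel Λ τ σ = 1 := by
  simp only [kernel]
  rw [← Finset.sum_div, div_eq_one_iff_eq h.ne', partition]
  congr!

theorem IsLocal.kernel_le_one (hW : W.IsLocal) (Λ : Finset S) (τ : Λ → Fin q) (σ : S → Fin q) :
    W.kernel Λ τ σ ≤ 1 := by
  classical
  refine div_le_one_of_le₀ ?_ (hW.partition_nonneg _ _)
  rw [partition]
  exact Finset.single_le_sum (f := fun τ => W.boltzmann Λ (glue Λ τ σ))
    (fun _ _ => hW.boltzmann_nonneg _ _) (Finset.mem_univ τ)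

theorem partition_eq_sumOver [DecidableEq S] (W : LocalWeights S q) (Λ : Finset S)
    (σ : S → Fin q) : W.partition Λ σ = sumOver Λ (W.boltzmann Λ) σ := by
  rw [partition, sumOver]; congr!

theorem IsLocal.partition_pos_iff (hW : W.IsLocal) {Λ : Finset S} {σ : S → Fin q} :
    0 < W.partition Λ σ ↔ ∃ σ', (∀ x ∉ Λ, σ' x = σ x) ∧ 0 < W.boltzmann Λ σ' := by
  classical
  rw [partition_eq_sumOver, sumOver]
  constructor
  · intro h
    obtain ⟨τ, -, hτ⟩ := Finset.exists_lt_of_sum_lt (s := Finset.univ) (f := fun _ => (0 : ℝ))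
      (by simpa using h)
    exact ⟨glue Λ τ σ, fun x hx => glue_of_notMem _ _ hx, hτ⟩
  · rintro ⟨σ', h, hpos⟩
    rw [← glue_restrict h] at hpos
    exact lt_of_lt_of_le hpos (Finset.single_le_sum (f := fun τ => W.boltzmann Λ (glue Λ τ σ))
      (fun _ _ => hW.boltzmann_nonneg _ _) (Finset.mem_univ _))

/-- An admissible configuration is built by changing one site at a time. After the change at `x` the
factors containing `x` are positive by the single-site hypothesis, and the other factors do not see
the change. -/
theorem IsLocal.partition_pos (hW : W.IsLocal) (h : ∀ x σ, 0 < W.partition {x} σ)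
    (Λ : Finset S) (σ : S → Fin q) : 0 < W.partition Λ σ := by
  classical
  rw [hW.partition_pos_iff]
  induction Λ using Finset.induction_on with
  | empty =>
    refine ⟨σ, fun _ _ => rfl, hW.boltzmann_pos_iff.2 fun A hA => ?_⟩
    simp [touching] at hA
  | insert x Λ hx ih =>
    obtain ⟨σ', h1, h2⟩ := ih
    obtain ⟨σ'', h3, h4⟩ := hW.partition_pos_iff.1 (h x σ')
    refine ⟨σ'', fun y hy => ?_, hW.boltzmann_pos_iff.2 fun A hA => ?_⟩
    · rw [Finset.mem_insert, not_or] at hy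
      rw [h3 y (by simpa using hy.1), h1 y hy.2]
    · by_cases hxA : x ∈ W.supp A
      · exact hW.boltzmann_pos_iff.1 h4 A (mem_touching_singleton.2 hxA)
      · have hA' : A ∈ W.touching Λ := by
          obtain ⟨y, hy, hy'⟩ := hA
          refine ⟨y, hy, ?_⟩
          rcases Finset.mem_insert.1 (Finset.mem_coe.1 hy') with rfl | h'
          · exact absurd hy hxA
          · exact h'
        have := hW.boltzmann_pos_iff.1 h2 A hA'
        rwa [W.weight_local A σ' σ'' fun y hy => (h3 y ?_).symm] at this
        rintro hy'
        rw [Finset.mem_singleton] at hy'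
        exact hxA (hy' ▸ hy)

open Classical in
/-- The conditional expectation of `f` given the spins outside `Λ`, according to the
specification. -/
def avg (W : LocalWeights S q) (Λ : Finset S) (f : (S → Fin q) → ℝ) (σ : S → Fin q) : ℝ :=
  ∑ τ : Λ → Fin q, W.kernel Λ τ σ * f (glue Λ τ σ)

theorem IsLocal.continuous_avg (hW : W.IsLocal) (Λ : Finset S) {f : (S → Fin q) → ℝ}
    (hf : Continuous f) : Continuous (W.avg Λ f) :=
  continuous_finsetSum _ fun τ _ =>
    (hW.continuous_kernel Λ τ).mul (hf.comp (continuous_glue τ))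

theorem IsLocal.dependsOn_avg (hW : W.IsLocal) (Λ : Finset S) (f : (S → Fin q) → ℝ) :
    DependsOn (W.avg Λ f) (Λ : Set S)ᶜ := by
  intro σ σ' h
  refine Finset.sum_congr rfl fun τ _ => ?_
  rw [hW.dependsOn_kernel Λ τ fun x hx => h x hx.2, glue_congr τ fun x hx => h x hx]

theorem avg_eq_sumOver [DecidableEq S] (W : LocalWeights S q) (Λ : Finset S)
    (f : (S → Fin q) → ℝ) (σ : S → Fin q) :
    W.avg Λ f σ = sumOver Λ (fun σ => W.boltzmann Λ σ * f σ) σ / W.partition Λ σ := by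
  rw [avg, sumOver, Finset.sum_div]
  refine Finset.sum_congr (by congr!) fun τ _ => ?_
  rw [kernel]; ring

theorem sumOver_mul_left [DecidableEq S] {Λ : Finset S} {r h : (S → Fin q) → ℝ}
    (hr : DependsOn r (Λ : Set S)ᶜ) (σ : S → Fin q) :
    sumOver Λ (fun σ => r σ * h σ) σ = r σ * sumOver Λ h σ := by
  rw [sumOver, sumOver, Finset.mul_sum]
  refine Finset.sum_congr rfl fun τ _ => ?_
  rw [hr (x := glue Λ τ σ) (y := σ) fun x hx => glue_of_notMem _ _ hx]

/-- The factors that touch `Λ'` but not `Λ` do not depend on the spins in `Λ`; their product is `r`.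
-/
theorem IsLocal.boltzmann_mul (hW : W.IsLocal) {Λ Λ' : Finset S} (h : Λ ⊆ Λ') :
    ∃ r : (S → Fin q) → ℝ, DependsOn r (Λ : Set S)ᶜ ∧
      ∀ σ, W.boltzmann Λ' σ = r σ * W.boltzmann Λ σ := by
  classical
  refine ⟨fun σ => ∏ A ∈ (hW.finite_touching Λ').toFinset \ (hW.finite_touching Λ).toFinset,
    W.weight A σ, ?_, fun σ => ?_⟩
  · intro σ σ' hσ
    refine Finset.prod_congr rfl fun A hA => W.weight_local A _ _ fun x hx => hσ x fun hxΛ => ?_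
    rw [Finset.mem_sdiff, Set.Finite.mem_toFinset, Set.Finite.mem_toFinset] at hA
    exact hA.2 ⟨x, hx, hxΛ⟩
  · rw [hW.boltzmann_eq, hW.boltzmann_eq, Finset.prod_sdiff]
    intro A
    rw [Set.Finite.mem_toFinset, Set.Finite.mem_toFinset]
    rintro ⟨x, hx, hxΛ⟩
    exact ⟨x, hx, h hxΛ⟩

/-- Consistency of the specification. -/
theorem IsLocal.avg_avg (hW : W.IsLocal) {Λ Λ' : Finset S} (h : Λ ⊆ Λ')
    (hpos : ∀ σ, 0 < W.partition Λ σ) (f : (S → Fin q) → ℝ) (σ : S → Fin q) :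
    W.avg Λ' (W.avg Λ f) σ = W.avg Λ' f σ := by
  classical
  rw [avg_eq_sumOver, avg_eq_sumOver W Λ' f]
  congr 1
  obtain ⟨r, hr, hb⟩ := hW.boltzmann_mul h
  rcases isEmpty_or_nonempty (Λ → Fin q) with hE | hne
  · exact hE.elim fun x => σ x
  -- Multiplying both sides by this cardinality lets `sumOver_sumOver` insert an inner sum over the
  -- spins in `Λ`, in which `r` and the average are constants.
  have hc : (Fintype.card (Λ → Fin q) : ℝ) ≠ 0 := by
    exact_mod_cast Fintype.card_ne_zero
  refine mul_left_cancel₀ hc ?_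
  rw [← sumOver_sumOver h, ← sumOver_sumOver h]
  congr 1
  funext σ
  have e1 : (fun σ => W.boltzmann Λ' σ * W.avg Λ f σ) =
      fun σ => (r σ * W.avg Λ f σ) * W.boltzmann Λ σ := by
    funext σ; rw [hb]; ring
  have e2 : (fun σ => W.boltzmann Λ' σ * f σ) = fun σ => r σ * (W.boltzmann Λ σ * f σ) := by
    funext σ; rw [hb]; ring
  rw [e1, e2, sumOver_mul_left hr, sumOver_mul_left, ← partition_eq_sumOver, avg_eq_sumOver]
  · have := (hpos σ).ne'
    field_simp
  · intro σ σ' hσ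
    change r σ * _ = r σ' * _
    rw [hr hσ, hW.dependsOn_avg Λ f hσ]

/-! ### The equations characterizing Gibbs measures -/

/-- The configurations that agree with `τ` in `Λ`. -/
def cylinderSet (Λ : Finset S) (τ : Λ → Fin q) : Set (S → Fin q) :=
  {σ | ∀ x : Λ, σ x = τ x}

theorem mem_cylinderSet_glue {Λ : Finset S} (τ τ' : Λ → Fin q) (σ : S → Fin q) :
    glue Λ τ' σ ∈ cylinderSet Λ τ ↔ τ' = τ := by
  constructor
  · intro h
    funext x
    rw [← h x, glue_of_mem _ _ x.2]
  · rintro rfl x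
    rw [glue_of_mem _ _ x.2]

theorem measurableSet_cylinderSet [Countable S] (Λ : Finset S) (τ : Λ → Fin q) :
    MeasurableSet (cylinderSet Λ τ) := by
  have : cylinderSet Λ τ = ⋂ x : Λ, (fun σ : S → Fin q => σ x) ⁻¹' {τ x} := by
    ext σ; simp [cylinderSet]
  rw [this]
  exact MeasurableSet.iInter fun x => measurable_pi_apply _ (measurableSet_singleton _)

theorem continuous_indicator_cylinderSet (Λ : Finset S) (τ : Λ → Fin q) :
    Continuous ((cylinderSet Λ τ).indicator fun _ => (1 : ℝ)) := by
  classical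
  refine continuous_of_dependsOn (F := (Λ : Set S)) Λ.finite_toSet fun σ σ' h => ?_
  have : σ ∈ cylinderSet Λ τ ↔ σ' ∈ cylinderSet Λ τ :=
    forall_congr' fun x => by rw [h x x.2]
  simp only [Set.indicator_apply, this]

theorem integrable_of_continuous [Countable S] {μ : Measure (S → Fin q)} [IsFiniteMeasure μ]
    {f : (S → Fin q) → ℝ} (hf : Continuous f) : Integrable f μ :=
  (BoundedContinuousFunction.mkOfCompact ⟨f, hf⟩).integrable μ

/-- The spins outside `Λ`. -/
def outside (Λ : Finset S) (σ : S → Fin q) (x : {x : S // x ∉ Λ}) : Fin q := σ x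

theorem measurable_outside (Λ : Finset S) : Measurable (outside (q := q) Λ) :=
  measurable_pi_lambda _ fun _ => measurable_pi_apply _

open Classical in
/-- The configuration with spins `τ` in `Λ` and `t` outside. -/
def extend {Λ : Finset S} (τ : Λ → Fin q) (t : {x : S // x ∉ Λ} → Fin q) (x : S) : Fin q :=
  if h : x ∈ Λ then τ ⟨x, h⟩ else t ⟨x, h⟩

theorem continuous_extend {Λ : Finset S} (τ : Λ → Fin q) : Continuous (extend τ) := by
  refine continuous_pi fun x => ?_
  by_cases hx : x ∈ Λ
  · simp only [extend, hx, dite_true]; exact continuous_const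
  · simp only [extend, hx, dite_false]; exact continuous_apply _

theorem extend_outside {Λ : Finset S} (τ : Λ → Fin q) (σ : S → Fin q) :
    extend τ (outside Λ σ) = glue Λ τ σ := by
  funext x
  by_cases hx : x ∈ Λ <;> simp [extend, glue, outside, hx]

/-- This factors `F` through the spins outside `Λ`, which is how measurability for the outer
σ-algebra is obtained. -/
theorem eq_extend_outside {β : Type*} {Λ : Finset S} (τ : Λ → Fin q) {F : (S → Fin q) → β}
    (hF : DependsOn F (Λ : Set S)ᶜ) : F = fun σ => F (extend τ (outside Λ σ)) := by
  funext σ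
  rw [extend_outside]
  exact hF fun x hx => (glue_of_notMem _ _ hx).symm

theorem stronglyMeasurable_outside [Countable S] {Λ : Finset S} (τ : Λ → Fin q)
    {F : (S → Fin q) → ℝ} (hc : Continuous F) (hF : DependsOn F (Λ : Set S)ᶜ) :
    StronglyMeasurable[MeasurableSpace.comap (outside Λ) MeasurableSpace.pi] F := by
  rw [eq_extend_outside τ hF]
  refine ((hc.comp (continuous_extend τ)).measurable.comp ?_).stronglyMeasurable
  exact Measurable.of_comap_le le_rfl

/-- Conditional probabilities may be tested against continuous functions of the outer spins only,
because finite Borel measures on the outer configurations are determined by their integrals of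
bounded continuous functions. -/
theorem IsLocal.isGibbs_iff [Countable S] (hW : W.IsLocal) (μ : Measure (S → Fin q))
    [IsProbabilityMeasure μ] :
    W.IsGibbs μ ↔ ∀ (Λ : Finset S) (τ : Λ → Fin q) (F : (S → Fin q) → ℝ), Continuous F →
      DependsOn F (Λ : Set S)ᶜ →
        ∫ σ, (cylinderSet Λ τ).indicator (fun _ => 1) σ * F σ ∂μ =
          ∫ σ, W.kernel Λ τ σ * F σ ∂μ := by
  have hm : ∀ Λ : Finset S, MeasurableSpace.comap (outside (q := q) Λ) MeasurableSpace.pi ≤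
      MeasurableSpace.pi := fun Λ => (measurable_outside Λ).comap_le
  have hdk : ∀ (Λ : Finset S) (τ : Λ → Fin q), DependsOn (W.kernel Λ τ) (Λ : Set S)ᶜ :=
    fun Λ τ => fun σ σ' h => hW.dependsOn_kernel Λ τ fun x hx => h x hx.2
  constructor
  · rintro ⟨-, h⟩ Λ τ F hc hF
    have h1 := condExp_mul_of_stronglyMeasurable_right (μ := μ)
      (f := (cylinderSet Λ τ).indicator (fun _ => (1 : ℝ)))
      (stronglyMeasurable_outside τ hc hF)
      (integrable_of_continuous ((continuous_indicator_cylinderSet Λ τ).mul hc))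
      (integrable_of_continuous (continuous_indicator_cylinderSet Λ τ))
    calc ∫ σ, (cylinderSet Λ τ).indicator (fun _ => 1) σ * F σ ∂μ
        = ∫ σ, (μ[(cylinderSet Λ τ).indicator (fun _ => (1 : ℝ)) * F |
            MeasurableSpace.comap (outside Λ) MeasurableSpace.pi]) σ ∂μ :=
          (integral_condExp (hm Λ)).symm
      _ = ∫ σ, W.kernel Λ τ σ * F σ ∂μ := by
          refine integral_congr_ae (h1.trans ?_)
          filter_upwards [h Λ τ] with σ hσ
          simp only [Pi.mul_apply]
          congr 1
  · intro h
    refine ⟨inferInstance, fun Λ τ => ?_⟩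
    have hk := hW.continuous_kernel Λ τ
    let ρ : (S → Fin q) → ℝ≥0∞ := fun σ => ENNReal.ofReal (W.kernel Λ τ σ)
    have hρ : Measurable ρ := ENNReal.measurable_ofReal.comp hk.measurable
    have : IsFiniteMeasure (μ.withDensity ρ) := by
      refine isFiniteMeasure_withDensity (ne_of_lt ?_)
      calc ∫⁻ σ, ρ σ ∂μ ≤ ∫⁻ _, 1 ∂μ := lintegral_mono fun σ => by
              simpa [ρ] using hW.kernel_le_one Λ τ σ
        _ < ∞ := by simp
    have hcyl := measurableSet_cylinderSet (q := q) Λ τ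
    -- Both measures live on the outer configurations: `μ` restricted to the cylinder, and `μ` with
    -- the kernel as density. Their equality gives the defining identity of the conditional
    -- expectation on every outer event.
    have key : (μ.restrict (cylinderSet Λ τ)).map (outside Λ) =
        (μ.withDensity ρ).map (outside Λ) := by
      refine ext_of_forall_integral_eq_of_IsFiniteMeasure fun g => ?_
      rw [integral_map (measurable_outside Λ).aemeasurable
          g.continuous.measurable.aestronglyMeasurable,
        integral_map (measurable_outside Λ).aemeasurable
          g.continuous.measurable.aestronglyMeasurable,
        integral_withDensity_eq_integral_toReal_smul hρ (by simp [ρ]),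
        ← integral_indicator hcyl]
      have := h Λ τ (fun σ => g (outside Λ σ))
        (g.continuous.comp (continuous_pi fun x => continuous_apply _)) (by
          intro σ σ' hσ
          have : outside Λ σ = outside Λ σ' := funext fun x => hσ x x.2
          simp only [this])
      convert this using 2
      · funext σ
        by_cases hσ : σ ∈ cylinderSet Λ τ <;> simp [hσ]
      · funext σ
        simp [ρ, ENNReal.toReal_ofReal (hW.kernel_nonneg Λ τ σ)]
    have hint : Integrable ((cylinderSet Λ τ).indicator fun _ => (1 : ℝ)) μ :=
      integrable_of_continuous (continuous_indicator_cylinderSet Λ τ)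
    refine (ae_eq_condExp_of_forall_setIntegral_eq (hm Λ) hint
      (fun s _ _ => (integrable_of_continuous hk).integrableOn) ?_ ?_).symm
    · rintro s ⟨B, hB, rfl⟩ -
      have hs := measurable_outside (q := q) Λ hB
      have e : μ (outside Λ ⁻¹' B ∩ cylinderSet Λ τ) = ∫⁻ σ in outside Λ ⁻¹' B, ρ σ ∂μ := by
        have := congrArg (fun ν : Measure _ => ν B) key
        beta_reduce at this
        rwa [Measure.map_apply (measurable_outside Λ) hB,
          Measure.map_apply (measurable_outside Λ) hB, Measure.restrict_apply hs,
          withDensity_apply _ hs] at this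
      rw [integral_eq_lintegral_of_nonneg_ae (.of_forall fun σ => hW.kernel_nonneg Λ τ σ)
        hk.measurable.aestronglyMeasurable, ← e, integral_indicator hcyl,
        Measure.restrict_restrict hcyl, Set.inter_comm]
      simp [Measure.real]
    · exact (stronglyMeasurable_outside τ hk (hdk Λ τ)).aestronglyMeasurable

theorem integral_eq_sum_cylinder [Countable S] (μ : Measure (S → Fin q)) [IsFiniteMeasure μ]
    (Λ : Finset S) [DecidableEq S] {f : (S → Fin q) → ℝ} (hf : Continuous f) :
    ∫ σ, f σ ∂μ = ∑ τ : Λ → Fin q,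
      ∫ σ, (cylinderSet Λ τ).indicator (fun _ => 1) σ * f (glue Λ τ σ) ∂μ := by
  rw [← integral_finsetSum]
  · refine integral_congr_ae (.of_forall fun σ => ?_)
    simp only
    rw [Finset.sum_eq_single (fun x : Λ => σ x)]
    · rw [Set.indicator_of_mem (by intro x; rfl), one_mul, glue_restrict fun _ _ => rfl]
    · intro τ _ hτ
      rw [Set.indicator_of_notMem, zero_mul]
      intro h
      exact hτ (funext fun x => (h x).symm)
    · simp
  · intro τ _
    exact integrable_of_continuous ((continuous_indicator_cylinderSet Λ τ).mul
      (hf.comp (continuous_glue τ)))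

/-- A Gibbs measure is invariant under the kernels of its specification. -/
theorem IsGibbs.integral_avg [Countable S] (hW : W.IsLocal) {μ : Measure (S → Fin q)}
    (hμ : W.IsGibbs μ) (Λ : Finset S) {f : (S → Fin q) → ℝ} (hf : Continuous f) :
    ∫ σ, W.avg Λ f σ ∂μ = ∫ σ, f σ ∂μ := by
  classical
  have := hμ.1
  rw [integral_eq_sum_cylinder μ Λ hf]
  simp only [avg]
  rw [integral_finsetSum]
  · refine Finset.sum_congr (by congr!) fun τ _ => ?_
    refine ((hW.isGibbs_iff μ).1 hμ Λ τ (fun σ => f (glue Λ τ σ))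
      (hf.comp (continuous_glue τ)) fun σ σ' h => ?_).symm
    simp only [glue_congr τ fun x hx => h x hx]
  · intro τ _
    exact integrable_of_continuous ((hW.continuous_kernel Λ τ).mul (hf.comp (continuous_glue τ)))

theorem avg_cylinder (W : LocalWeights S q) {Λ : Finset S} (τ : Λ → Fin q)
    {F : (S → Fin q) → ℝ} (hF : DependsOn F (Λ : Set S)ᶜ) (σ : S → Fin q) :
    W.avg Λ (fun σ => (cylinderSet Λ τ).indicator (fun _ => 1) σ * F σ) σ =
      W.kernel Λ τ σ * F σ := by
  classical
  rw [avg, Finset.sum_eq_single τ]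
  · rw [Set.indicator_of_mem ((mem_cylinderSet_glue _ _ _).2 rfl), one_mul,
      hF (x := glue Λ τ σ) (y := σ) fun x hx => glue_of_notMem _ _ hx]
  · intro τ' _ h
    rw [Set.indicator_of_notMem fun h' => h ((mem_cylinderSet_glue _ _ _).1 h')]
    simp
  · simp

/-- Invariance is applied to a cylinder indicator times a function of the outer spins, whose average
is the kernel times that function. -/
theorem isGibbs_of_integral_avg [Countable S] (hW : W.IsLocal) {μ : Measure (S → Fin q)}
    [IsProbabilityMeasure μ]
    (h : ∀ (Λ : Finset S) (f : (S → Fin q) → ℝ), Continuous f →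
      ∫ σ, W.avg Λ f σ ∂μ = ∫ σ, f σ ∂μ) : W.IsGibbs μ := by
  refine (hW.isGibbs_iff μ).2 fun Λ τ F hc hF => ?_
  have := h Λ _ ((continuous_indicator_cylinderSet Λ τ).mul hc)
  simp only [Pi.mul_def, avg_cylinder W τ hF] at this
  exact this.symm

theorem abs_avg_le (hW : W.IsLocal) {Λ : Finset S} {σ : S → Fin q} (hpos : 0 < W.partition Λ σ)
    {f : (S → Fin q) → ℝ} {M : ℝ} (hM : ∀ τ, |f (glue Λ τ σ)| ≤ M) : |W.avg Λ f σ| ≤ M := by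
  classical
  calc |W.avg Λ f σ| ≤ ∑ τ : Λ → Fin q, |W.kernel Λ τ σ * f (glue Λ τ σ)| :=
        (Finset.abs_sum_le_sum_abs _ _).trans (le_of_eq (by congr!))
    _ ≤ ∑ τ : Λ → Fin q, W.kernel Λ τ σ * M := by
        refine Finset.sum_le_sum fun τ _ => ?_
        rw [abs_mul, abs_of_nonneg (hW.kernel_nonneg Λ τ σ)]
        exact mul_le_mul_of_nonneg_left (hM τ) (hW.kernel_nonneg Λ τ σ)
    _ = M := by rw [← Finset.sum_mul, sum_kernel hpos, one_mul]

/-- The finite-volume Gibbs measure with boundary condition `σ`. -/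
def finiteVolume (W : LocalWeights S q) (Λ : Finset S) [DecidableEq S] (σ : S → Fin q) :
    Measure (S → Fin q) :=
  ∑ τ : Λ → Fin q, ENNReal.ofReal (W.kernel Λ τ σ) • Measure.dirac (glue Λ τ σ)

theorem isProbabilityMeasure_finiteVolume [DecidableEq S] (hW : W.IsLocal) {Λ : Finset S}
    {σ : S → Fin q} (hpos : 0 < W.partition Λ σ) :
    IsProbabilityMeasure (W.finiteVolume Λ σ) := by
  constructor
  simp only [finiteVolume, Measure.finsetSum_apply, Measure.smul_apply, measure_univ,
    smul_eq_mul, mul_one]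
  rw [← ENNReal.ofReal_sum_of_nonneg fun τ _ => hW.kernel_nonneg Λ τ σ, sum_kernel hpos]
  simp

theorem integral_finiteVolume [Countable S] [DecidableEq S] (hW : W.IsLocal) (Λ : Finset S)
    (σ : S → Fin q) {f : (S → Fin q) → ℝ} (hf : Continuous f) :
    ∫ σ', f σ' ∂W.finiteVolume Λ σ = W.avg Λ f σ := by
  rw [finiteVolume, integral_finsetSum_measure, avg]
  · refine Finset.sum_congr (by congr!) fun τ _ => ?_
    rw [integral_smul_measure, integral_dirac, ENNReal.toReal_ofReal (hW.kernel_nonneg Λ τ σ),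
      smul_eq_mul]
  · intro τ _
    exact (integrable_of_continuous hf).smul_measure ENNReal.ofReal_ne_top

/-- Existence of infinite-volume Gibbs measures. -/
theorem IsLocal.exists_isGibbs [Countable S] [NeZero q] (hW : W.IsLocal)
    (hpos : ∀ Λ σ, 0 < W.partition Λ σ) : ∃ μ, W.IsGibbs μ := by
  classical
  let σ₀ : S → Fin q := fun _ => 0
  let ν : Finset S → ProbabilityMeasure (S → Fin q) := fun Λ =>
    ⟨W.finiteVolume Λ σ₀, isProbabilityMeasure_finiteVolume hW (hpos Λ σ₀)⟩
  -- Probability measures on a compact space form a compact space, so the finite-volume measures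
  -- converge along an ultrafilter finer than `atTop`; no subsequence is needed.
  let U : Ultrafilter (Finset S) := Ultrafilter.of atTop
  have hU : (U : Filter (Finset S)) ≤ atTop := Ultrafilter.of_le _
  obtain ⟨μ, -, hμ⟩ := isCompact_univ.ultrafilter_le_nhds (U.map ν) (by simp)
  have hlim : ∀ f : (S → Fin q) → ℝ, Continuous f →
      Tendsto (fun Λ => W.avg Λ f σ₀) U (𝓝 (∫ σ, f σ ∂(μ : Measure (S → Fin q)))) := by
    intro f hf
    have := (ProbabilityMeasure.tendsto_iff_forall_integral_tendsto
      (F := (U : Filter (Finset S))) (μs := ν)).1 hμ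
      (BoundedContinuousFunction.mkOfCompact ⟨f, hf⟩)
    refine this.congr fun Λ => ?_
    exact integral_finiteVolume hW Λ σ₀ hf
  refine ⟨μ, isGibbs_of_integral_avg hW fun Λ f hf => ?_⟩
  -- Once `Λ' ⊇ Λ`, consistency shows that the finite-volume measure in `Λ'` gives `f` and its
  -- average over `Λ` the same integral; this passes to the limit.
  refine tendsto_nhds_unique (hlim _ (hW.continuous_avg Λ hf)) ((hlim f hf).congr' ?_)
  filter_upwards [hU (eventually_ge_atTop Λ)] with Λ' hΛ'
  exact (hW.avg_avg hΛ' (hpos Λ) f σ₀).symm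

end LocalWeights

end

end KagomePotts

namespace KagomePotts

noncomputable section

open Filter Topology LocalWeights

/-! ### Oscillation bounds. -/

section Oscillation

variable {S : Type} {q : ℕ}

/-- `v y` bounds the change of `f` under a change of the spin at `y`. -/
def OscBound (f : (S → Fin q) → ℝ) (v : S → ℝ) : Prop :=
  ∀ y σ σ', (∀ z, z ≠ y → σ z = σ' z) → |f σ - f σ'| ≤ v y

theorem OscBound.nonneg [NeZero q] {f : (S → Fin q) → ℝ} {v : S → ℝ} (h : OscBound f v) (y : S) :
    0 ≤ v y := by
  simpa using h y (fun _ => 0) (fun _ => 0) fun _ _ => rfl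

theorem exists_bound_of_continuous {f : (S → Fin q) → ℝ} (hf : Continuous f) :
    ∃ M, 0 ≤ M ∧ ∀ σ, |f σ| ≤ M := by
  obtain ⟨M, hM⟩ := isCompact_univ.exists_bound_of_continuousOn hf.continuousOn
  exact ⟨max M 0, le_max_right _ _, fun σ => (hM σ trivial).trans (le_max_left _ _)⟩

theorem oscBound_oscillation {f : (S → Fin q) → ℝ} (hf : Continuous f) :
    OscBound f (oscillation f) := by
  intro y σ σ' h
  obtain ⟨M, -, hM⟩ := exists_bound_of_continuous hf
  refine le_ciSup (f := fun p : {p : (S → Fin q) × (S → Fin q) // ∀ z, z ≠ y → p.1 z = p.2 z} =>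
    |f p.1.1 - f p.1.2|) ⟨M + M, ?_⟩ ⟨(σ, σ'), h⟩
  rintro _ ⟨p, rfl⟩
  exact (abs_sub _ _).trans (add_le_add (hM _) (hM _))

theorem oscillation_nonneg (f : (S → Fin q) → ℝ) (y : S) : 0 ≤ oscillation f y :=
  Real.iSup_nonneg fun _ => abs_nonneg _

theorem OscBound.abs_sub_le_sum {f : (S → Fin q) → ℝ} {v : S → ℝ} (h : OscBound f v)
    (F : Finset S) {σ σ' : S → Fin q} (hF : ∀ x ∉ F, σ x = σ' x) :
    |f σ - f σ'| ≤ ∑ y ∈ F, v y := by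
  classical
  induction F using Finset.induction_on generalizing σ with
  | empty =>
    have : σ = σ' := funext fun x => hF x (by simp)
    simp [this]
  | insert a F ha ih =>
    rw [Finset.sum_insert ha]
    calc |f σ - f σ'| = |(f σ - f (Function.update σ a (σ' a))) +
          (f (Function.update σ a (σ' a)) - f σ')| := by ring_nf
      _ ≤ _ := abs_add_le _ _
      _ ≤ v a + ∑ y ∈ F, v y := by
        refine add_le_add (h a _ _ fun z hz => by simp [hz]) (ih fun x hx => ?_)
        by_cases hxa : x = a
        · subst hxa; simp
        · rw [Function.update_of_ne hxa]
          exact hF x (by simp [hxa, hx])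

/-- Changing finitely many spins costs a partial sum, and by continuity the configurations that
agree with `σ` on a large finite set suffice. -/
theorem OscBound.abs_sub_le_tsum [NeZero q] {f : (S → Fin q) → ℝ} {v : S → ℝ} (h : OscBound f v)
    (hf : Continuous f) (hv : Summable v) (σ σ' : S → Fin q) :
    |f σ - f σ'| ≤ ∑' y, v y := by
  have h1 : Tendsto (fun F : Finset S => glue F (fun x => σ x) σ') atTop (𝓝 σ) := by
    rw [tendsto_pi_nhds]
    intro x
    refine tendsto_const_nhds.congr' ?_
    filter_upwards [eventually_ge_atTop {x}] with F hF
    rw [glue_of_mem _ _ (hF (Finset.mem_singleton_self x))]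
  have h2 : Tendsto (fun F : Finset S => |f (glue F (fun x => σ x) σ') - f σ'|) atTop
      (𝓝 |f σ - f σ'|) :=
    (((hf.tendsto σ).comp h1).sub_const _).abs
  refine le_of_tendsto' h2 fun F => ?_
  exact (h.abs_sub_le_sum F fun x hx => glue_of_notMem _ _ hx).trans
    (hv.sum_le_tsum F fun y _ => h.nonneg y)

end Oscillation

/-- Blocks `B i` that can be updated, with the outer sites `N i` that influence them and the
constants `C i z y` by which an oscillation at `z ∈ B i` is passed to `y ∈ N i`. -/
structure BlockData (S ι : Type) where
  B : ι → Finset S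
  N : ι → Finset S
  C : ι → S → S → ℝ
  C_nonneg : ∀ i z y, 0 ≤ C i z y

/-! ### Contraction of oscillation vectors under block updates. -/

namespace BlockData

variable {S ι : Type} (D : BlockData S ι)

open Classical in
/-- The effect of an update of the block `B i` on a vector of oscillations. -/
def fire (i : ι) (v : S → ℝ) (y : S) : ℝ :=
  if y ∈ D.B i then 0 else if y ∈ D.N i then v y + ∑ z ∈ D.B i, v z * D.C i z y else v y

/-- The effect of successive updates. -/
def fireList (l : List ι) (v : S → ℝ) : S → ℝ :=
  l.foldl (fun v i => D.fire i v) v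

variable {D}

theorem fire_nonneg {v : S → ℝ} (hv : ∀ y, 0 ≤ v y) (i : ι) (y : S) : 0 ≤ D.fire i v y := by
  unfold fire
  split_ifs
  · exact le_rfl
  · exact add_nonneg (hv y) (Finset.sum_nonneg fun z _ => mul_nonneg (hv z) (D.C_nonneg _ _ _))
  · exact hv y

theorem le_fire {v : S → ℝ} (hv : ∀ y, 0 ≤ v y) {i : ι} {y : S} (hy : y ∉ D.B i) :
    v y ≤ D.fire i v y := by
  unfold fire
  rw [if_neg hy]
  split_ifs
  · exact le_add_of_nonneg_right
      (Finset.sum_nonneg fun z _ => mul_nonneg (hv z) (D.C_nonneg _ _ _))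
  · exact le_rfl

theorem summable_fire {v : S → ℝ} (hv : Summable v) (i : ι) : Summable (D.fire i v) := by
  classical
  refine (hv.congr_cofinite ?_)
  filter_upwards [((D.B i ∪ D.N i).finite_toSet).compl_mem_cofinite] with y hy
  simp only [Finset.coe_union, Set.mem_compl_iff, Set.mem_union, Finset.mem_coe, not_or] at hy
  simp [fire, hy.1, hy.2]

theorem hasSum_ite_mem {s : Finset S} [DecidableEq S] (f : S → ℝ) :
    HasSum (fun y => if y ∈ s then f y else 0) (∑ y ∈ s, f y) := by
  have : HasSum (fun y => if y ∈ s then f y else 0) (∑ y ∈ s, if y ∈ s then f y else 0) :=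
    hasSum_sum_of_ne_finset_zero fun b hb => if_neg hb
  simpa using this

theorem summable_mul_of_bounded {v h : S → ℝ} (hv : Summable v) (hv0 : ∀ y, 0 ≤ v y) {M : ℝ}
    (h0 : ∀ y, 0 ≤ h y) (hM : ∀ y, h y ≤ M) : Summable fun y => v y * h y :=
  Summable.of_nonneg_of_le (fun y => mul_nonneg (hv0 y) (h0 y))
    (fun y => mul_le_mul_of_nonneg_left (hM y) (hv0 y)) (hv.mul_right M)

/-- An update decreases every superharmonic potential. -/
theorem tsum_fire_add_le {v h : S → ℝ} (hv : Summable v) (hv0 : ∀ y, 0 ≤ v y) {M β : ℝ}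
    (h0 : ∀ y, 0 ≤ h y) (hM : ∀ y, h y ≤ M) {i : ι}
    (hC : ∀ z ∈ D.B i, ∑ y ∈ D.N i, D.C i z y * h y ≤ β * h z) :
    ∑' y, D.fire i v y * h y + (1 - β) * ∑ z ∈ D.B i, v z * h z ≤ ∑' y, v y * h y := by
  classical
  have hs := (summable_mul_of_bounded hv hv0 h0 hM).hasSum
  have hB := hasSum_ite_mem (s := D.B i) fun y => v y * h y
  have hN := hasSum_ite_mem (s := D.N i) fun y => (∑ z ∈ D.B i, v z * D.C i z y) * h y
  -- The mass in `B i` disappears and the mass passed to `N i` is added. Sites lying in both sets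
  -- are only overcounted, which keeps the inequality.
  have hle : ∑' y, D.fire i v y * h y ≤
      ∑' y, v y * h y - ∑ z ∈ D.B i, v z * h z +
        ∑ y ∈ D.N i, (∑ z ∈ D.B i, v z * D.C i z y) * h y := by
    refine hasSum_le (fun y => ?_) (summable_mul_of_bounded (summable_fire hv i)
      (fire_nonneg hv0 i) h0 hM).hasSum ((hs.sub hB).add hN)
    have hnn : 0 ≤ (∑ z ∈ D.B i, v z * D.C i z y) * h y :=
      mul_nonneg (Finset.sum_nonneg fun z _ => mul_nonneg (hv0 z) (D.C_nonneg _ _ _)) (h0 y)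
    by_cases hyB : y ∈ D.B i
    · simp only [fire, hyB, if_true]
      split_ifs <;> simp [hnn]
    · by_cases hyN : y ∈ D.N i
      · simp only [fire, hyB, hyN, if_true, if_false]
        linarith
      · simp [fire, hyB, hyN]
  -- Summing over the receiving sites first bounds the mass that each `z` passes on by `β` times its
  -- own.
  have hswap : ∑ y ∈ D.N i, (∑ z ∈ D.B i, v z * D.C i z y) * h y ≤
      β * ∑ z ∈ D.B i, v z * h z := by
    calc ∑ y ∈ D.N i, (∑ z ∈ D.B i, v z * D.C i z y) * h y
        = ∑ z ∈ D.B i, v z * ∑ y ∈ D.N i, D.C i z y * h y := by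
          simp only [Finset.sum_mul, Finset.mul_sum]
          rw [Finset.sum_comm]
          simp only [mul_assoc]
      _ ≤ ∑ z ∈ D.B i, v z * (β * h z) :=
          Finset.sum_le_sum fun z hz => mul_le_mul_of_nonneg_left (hC z hz) (hv0 z)
      _ = β * ∑ z ∈ D.B i, v z * h z := by
          rw [Finset.mul_sum]
          exact Finset.sum_congr rfl fun z _ => by ring
  linarith

theorem fireList_nonneg {v : S → ℝ} (hv : ∀ y, 0 ≤ v y) (l : List ι) (y : S) :
    0 ≤ D.fireList l v y := by
  induction l generalizing v with
  | nil => exact hv y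
  | cons i l ih => exact ih (fire_nonneg hv i)

theorem summable_fireList {v : S → ℝ} (hv : Summable v) (l : List ι) :
    Summable (D.fireList l v) := by
  induction l generalizing v with
  | nil => exact hv
  | cons i l ih => exact ih (summable_fire hv i)

section Contraction

variable {w : S → ℝ} {wmin wmax β : ℝ}

/-- Until the first update of a block containing it, the value of `v` at a site of `A` can only grow
(`le_fire`). When that update comes, at least the fraction `1 - β` of its weighted mass is lost. In
the induction, the sites covered by the first block leave `A`. -/
theorem tsum_fireList_add_le {v : S → ℝ} (hv : Summable v) (hv0 : ∀ y, 0 ≤ v y)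
    (hw0 : ∀ y, 0 ≤ w y) (hwmax : ∀ y, w y ≤ wmax) (hβ : β ≤ 1)
    (hC : ∀ i, ∀ z ∈ D.B i, ∑ y ∈ D.N i, D.C i z y * w y ≤ β * w z) (l : List ι)
    (A : Finset S) (hA : ∀ y ∈ A, ∃ i ∈ l, y ∈ D.B i) :
    ∑' y, D.fireList l v y * w y + (1 - β) * ∑ z ∈ A, v z * w z ≤ ∑' y, v y * w y := by
  classical
  induction l generalizing v A with
  | nil =>
    have : A = ∅ := Finset.eq_empty_of_forall_notMem fun y hy => by simpa using hA y hy
    simp [this, fireList]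
  | cons i l ih =>
    have h1 := ih (summable_fire (D := D) hv i) (fire_nonneg hv0 i) (A \ D.B i) (by
      intro y hy
      rw [Finset.mem_sdiff] at hy
      obtain ⟨j, hj, hyj⟩ := hA y hy.1
      rcases List.mem_cons.1 hj with rfl | hj
      · exact absurd hyj hy.2
      · exact ⟨j, hj, hyj⟩)
    have h2 := tsum_fire_add_le hv hv0 hw0 hwmax (hC i)
    have h3 : ∑ z ∈ A, v z * w z ≤
        ∑ z ∈ D.B i, v z * w z + ∑ z ∈ A \ D.B i, D.fire i v z * w z := by
      rw [← Finset.sum_inter_add_sum_sdiff A (D.B i)]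
      refine add_le_add (Finset.sum_le_sum_of_subset_of_nonneg Finset.inter_subset_right
        fun z _ _ => mul_nonneg (hv0 z) (hw0 z)) (Finset.sum_le_sum fun z hz => ?_)
      exact mul_le_mul_of_nonneg_right (le_fire hv0 (Finset.mem_sdiff.1 hz).2) (hw0 z)
    have h4 := mul_le_mul_of_nonneg_left h3 (sub_nonneg.2 hβ)
    change ∑' y, D.fireList l (D.fire i v) y * w y + _ ≤ _
    linarith

/-- A finite set `A` carries at least half of the weighted mass; updating one block for each of its
sites removes at least `(1 - β) / 2` of the whole. -/
theorem exists_fireList_half {v : S → ℝ} (hv : Summable v) (hv0 : ∀ y, 0 ≤ v y)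
    (hcover : ∀ y, ∃ i, y ∈ D.B i) (hw0 : ∀ y, 0 ≤ w y) (hwmax : ∀ y, w y ≤ wmax) (hβ : β ≤ 1)
    (hC : ∀ i, ∀ z ∈ D.B i, ∑ y ∈ D.N i, D.C i z y * w y ≤ β * w z) :
    ∃ l, ∑' y, D.fireList l v y * w y ≤ (1 - (1 - β) / 2) * ∑' y, v y * w y := by
  classical
  have hs := summable_mul_of_bounded hv hv0 hw0 hwmax
  obtain ⟨A, hA⟩ : ∃ A : Finset S, (∑' y, v y * w y) / 2 ≤ ∑ y ∈ A, v y * w y := by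
    have hnn : 0 ≤ ∑' y, v y * w y := tsum_nonneg fun y => mul_nonneg (hv0 y) (hw0 y)
    rcases hnn.eq_or_lt with h0 | hpos
    · exact ⟨∅, by simp [← h0]⟩
    · obtain ⟨A, hA⟩ := (hs.hasSum.eventually (lt_mem_nhds (half_lt_self hpos))).exists
      exact ⟨A, hA.le⟩
  choose b hb using hcover
  refine ⟨A.toList.map b, ?_⟩
  have := tsum_fireList_add_le hv hv0 hw0 hwmax hβ hC (A.toList.map b) A (fun y hy =>
    ⟨b y, List.mem_map.2 ⟨y, Finset.mem_toList.2 hy, rfl⟩, hb y⟩)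
  have h4 := mul_le_mul_of_nonneg_left hA (sub_nonneg.2 hβ)
  linarith

/-- The total oscillation can be made arbitrarily small by finitely many updates. -/
theorem exists_fireList_lt {v : S → ℝ} (hv : Summable v) (hv0 : ∀ y, 0 ≤ v y)
    (hcover : ∀ y, ∃ i, y ∈ D.B i) (hwmin : 0 < wmin) (hw0 : ∀ y, wmin ≤ w y)
    (hwmax : ∀ y, w y ≤ wmax) (hβ : 0 ≤ β) (hβ1 : β < 1)
    (hC : ∀ i, ∀ z ∈ D.B i, ∑ y ∈ D.N i, D.C i z y * w y ≤ β * w z) {ε : ℝ} (hε : 0 < ε) :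
    ∃ l, ∑' y, D.fireList l v y < ε := by
  have hw0' : ∀ y, 0 ≤ w y := fun y => hwmin.le.trans (hw0 y)
  have key : ∀ n : ℕ, ∃ l, ∑' y, D.fireList l v y * w y ≤
      (1 - (1 - β) / 2) ^ n * ∑' y, v y * w y := by
    intro n
    induction n with
    | zero => exact ⟨[], by simp [fireList]⟩
    | succ n ih =>
      obtain ⟨l, hl⟩ := ih
      obtain ⟨l', hl'⟩ := exists_fireList_half (summable_fireList hv l) (fireList_nonneg hv0 l)
        hcover hw0' hwmax hβ1.le hC
      refine ⟨l ++ l', ?_⟩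
      have e : D.fireList (l ++ l') v = D.fireList l' (D.fireList l v) := by
        simp [fireList]
      rw [e, pow_succ']
      refine hl'.trans ?_
      rw [mul_assoc]
      exact mul_le_mul_of_nonneg_left hl (by linarith)
  have hlim : Tendsto (fun n : ℕ => (1 - (1 - β) / 2) ^ n * ∑' y, v y * w y) atTop (𝓝 0) := by
    have := (tendsto_pow_atTop_nhds_zero_of_lt_one (r := 1 - (1 - β) / 2) (by linarith)
      (by linarith)).mul_const (∑' y, v y * w y)
    simpa using this
  -- The target `wmin * ε` compensates for passing from the weighted to the unweighted sum.
  obtain ⟨n, hn⟩ := (hlim.eventually (gt_mem_nhds (mul_pos hwmin hε))).exists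
  obtain ⟨l, hl⟩ := key n
  refine ⟨l, ?_⟩
  have h1 : wmin * ∑' y, D.fireList l v y ≤ ∑' y, D.fireList l v y * w y := by
    rw [← tsum_mul_left]
    refine Summable.tsum_le_tsum (fun y => ?_) ((summable_fireList hv l).mul_left _)
      (summable_mul_of_bounded (summable_fireList hv l) (fireList_nonneg hv0 l) hw0' hwmax)
    rw [mul_comm]
    exact mul_le_mul_of_nonneg_left (hw0 y) (fireList_nonneg hv0 l y)
  exact lt_of_mul_lt_mul_left ((h1.trans hl).trans_lt hn) hwmin.le

end Contraction

end BlockData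

/-! ### Change of covariances under averaging. -/

section Covariance

variable {S : Type} {q : ℕ} {W : LocalWeights S q}

/-- The covariance of `f` and `g`. -/
def covar (μ : Measure (S → Fin q)) (f g : (S → Fin q) → ℝ) : ℝ :=
  ∫ σ, f σ * g σ ∂μ - (∫ σ, f σ ∂μ) * ∫ σ, g σ ∂μ

/-- This is a conditional covariance given the spins outside `Λ`. Both functions may be centred, and
each then varies by at most its total oscillation over `Λ`. -/
theorem abs_avg_sub_mul_le [NeZero q] (hW : W.IsLocal) (hpos : ∀ Λ σ, 0 < W.partition Λ σ)
    (Λ : Finset S) {f g : (S → Fin q) → ℝ} {v u : S → ℝ} (hf : OscBound f v) (hg : OscBound g u)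
    (σ : S → Fin q) :
    |W.avg Λ (fun σ => (f σ - W.avg Λ f σ) * g σ) σ| ≤ (∑ y ∈ Λ, v y) * ∑ y ∈ Λ, u y := by
  classical
  have hcst : ∀ τ : Λ → Fin q, W.avg Λ f (glue Λ τ σ) = W.avg Λ f σ := fun τ =>
    hW.dependsOn_avg Λ f fun x hx => glue_of_notMem _ _ hx
  have hone := sum_kernel (W := W) (hpos Λ σ)
  -- The deviation of `f` from its conditional mean averages to zero, so the constant `g σ` may be
  -- subtracted from the second factor.
  have hzero : W.avg Λ (fun σ => (f σ - W.avg Λ f σ) * g σ) σ =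
      W.avg Λ (fun σ' => (f σ' - W.avg Λ f σ) * (g σ' - g σ)) σ := by
    have : ∑ τ : Λ → Fin q, W.kernel Λ τ σ * ((f (glue Λ τ σ) - W.avg Λ f σ) * g σ) = 0 := by
      have e : ∀ τ : Λ → Fin q, W.kernel Λ τ σ * ((f (glue Λ τ σ) - W.avg Λ f σ) * g σ) =
          (W.kernel Λ τ σ * f (glue Λ τ σ)) * g σ - W.kernel Λ τ σ * (W.avg Λ f σ * g σ) :=
        fun τ => by ring
      simp only [e]
      rw [Finset.sum_sub_distrib, ← Finset.sum_mul, ← Finset.sum_mul, hone, avg, sub_eq_zero]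
      simp only [one_mul]
    rw [avg, avg, ← sub_eq_zero, ← Finset.sum_sub_distrib, ← this]
    refine Finset.sum_congr (by congr!) fun τ _ => ?_
    rw [hcst]; ring
  rw [hzero]
  refine abs_avg_le hW (hpos Λ σ) fun τ => ?_
  rw [abs_mul]
  have hf0 : 0 ≤ ∑ y ∈ Λ, v y := Finset.sum_nonneg fun y _ => hf.nonneg y
  refine mul_le_mul ?_ (hg.abs_sub_le_sum Λ fun x hx => glue_of_notMem _ _ hx) (abs_nonneg _) hf0
  have : f (glue Λ τ σ) - W.avg Λ f σ = W.avg Λ (fun σ' => f (glue Λ τ σ) - f σ') σ := by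
    simp only [avg, mul_sub]
    rw [Finset.sum_sub_distrib, ← Finset.sum_mul]
    congr 1
    rw [show ∑ τ : Λ → Fin q, W.kernel Λ τ σ = 1 from hone.symm ▸ by congr!, one_mul]
  rw [this]
  refine abs_avg_le hW (hpos Λ σ) fun τ' => hf.abs_sub_le_sum Λ fun x hx => ?_
  rw [glue_of_notMem _ _ hx, glue_of_notMem _ _ hx]

/-- Replacing `f` by its average keeps the mean of `f` and changes the mean of the product by the
expected conditional covariance. -/
theorem abs_covar_le_add [Countable S] [NeZero q] (hW : W.IsLocal)
    (hpos : ∀ Λ σ, 0 < W.partition Λ σ) {μ : Measure (S → Fin q)} (hμ : W.IsGibbs μ)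
    (Λ : Finset S) {f g : (S → Fin q) → ℝ} {v u : S → ℝ} (hfc : Continuous f)
    (hgc : Continuous g) (hf : OscBound f v) (hg : OscBound g u) :
    |covar μ f g| ≤ |covar μ (W.avg Λ f) g| + (∑ y ∈ Λ, v y) * ∑ y ∈ Λ, u y := by
  have := hμ.1
  have hac := hW.continuous_avg Λ hfc
  have hc : Continuous fun σ => (f σ - W.avg Λ f σ) * g σ := (hfc.sub hac).mul hgc
  have e : covar μ f g = covar μ (W.avg Λ f) g +
      ∫ σ, W.avg Λ (fun σ => (f σ - W.avg Λ f σ) * g σ) σ ∂μ := by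
    rw [hμ.integral_avg hW Λ hc, covar, covar, hμ.integral_avg hW Λ hfc]
    simp only [sub_mul]
    rw [integral_sub (integrable_of_continuous (f := fun σ => f σ * g σ) (hfc.mul hgc))
      (integrable_of_continuous (f := fun σ => W.avg Λ f σ * g σ) (hac.mul hgc))]
    ring
  rw [e]
  refine (abs_add_le _ _).trans (add_le_add_right ?_ _)
  have := norm_integral_le_of_norm_le_const (μ := μ)
    (f := fun σ => W.avg Λ (fun σ => (f σ - W.avg Λ f σ) * g σ) σ)
    (.of_forall fun σ => abs_avg_sub_mul_le hW hpos Λ hf hg σ)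
  simpa using this

/-- Subtracting the constant `f σ₀` from `f` does not change the covariance and makes `f` bounded by
`T`. -/
theorem abs_covar_le_of_osc [Countable S] {μ : Measure (S → Fin q)} [IsProbabilityMeasure μ]
    {f g : (S → Fin q) → ℝ} (hf : Continuous f) (hg : Continuous g) {T M : ℝ}
    (hT : ∀ σ σ', |f σ - f σ'| ≤ T) (hM : ∀ σ, |g σ| ≤ M) (σ₀ : S → Fin q) :
    |covar μ f g| ≤ 2 * T * M := by
  have hM0 : 0 ≤ M := (abs_nonneg _).trans (hM σ₀)
  have hT0 : 0 ≤ T := (abs_nonneg _).trans (hT σ₀ σ₀)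
  have e : covar μ f g = covar μ (fun σ => f σ - f σ₀) g := by
    rw [covar, covar]
    simp only [sub_mul]
    rw [integral_sub (integrable_of_continuous (f := fun σ => f σ * g σ) (hf.mul hg))
      (integrable_of_continuous (f := fun σ => f σ₀ * g σ) (continuous_const.mul hg)),
      integral_sub (integrable_of_continuous hf) (integrable_of_continuous continuous_const),
      integral_const_mul]
    simp
    ring
  have h1 : |∫ σ, (f σ - f σ₀) * g σ ∂μ| ≤ T * M := by
    have := norm_integral_le_of_norm_le_const (μ := μ) (f := fun σ => (f σ - f σ₀) * g σ)
      (C := T * M) (.of_forall fun σ => by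
        rw [Real.norm_eq_abs, abs_mul]
        exact mul_le_mul (hT _ _) (hM _) (abs_nonneg _) hT0)
    simpa using this
  have h2 : |∫ σ, (f σ - f σ₀) ∂μ| ≤ T := by
    have := norm_integral_le_of_norm_le_const (μ := μ) (f := fun σ => f σ - f σ₀)
      (C := T) (.of_forall fun σ => hT _ _)
    simpa using this
  have h3 : |∫ σ, g σ ∂μ| ≤ M := by
    have := norm_integral_le_of_norm_le_const (μ := μ) (f := g) (C := M) (.of_forall hM)
    simpa using this
  rw [e, covar]
  refine (abs_sub _ _).trans ?_
  rw [abs_mul (∫ σ, (f σ - f σ₀) ∂μ)]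
  have := mul_le_mul h2 h3 (abs_nonneg _) hT0
  linarith

end Covariance

/-! ### Uniqueness and exponential decay from contracting block updates. -/

section Main

variable {S ι : Type} {q : ℕ} {W : LocalWeights S q}

/-- Successive updates of blocks. -/
def avgList (W : LocalWeights S q) (D : BlockData S ι) (l : List ι) (f : (S → Fin q) → ℝ) :
    (S → Fin q) → ℝ :=
  l.foldl (fun f i => W.avg (D.B i) f) f

variable {D : BlockData S ι}

theorem continuous_avgList (hW : W.IsLocal) (l : List ι) {f : (S → Fin q) → ℝ}
    (hf : Continuous f) : Continuous (avgList W D l f) := by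
  induction l generalizing f with
  | nil => exact hf
  | cons i l ih => exact ih (hW.continuous_avg _ hf)

theorem integral_avgList [Countable S] (hW : W.IsLocal) {μ : Measure (S → Fin q)}
    (hμ : W.IsGibbs μ) (l : List ι) {f : (S → Fin q) → ℝ} (hf : Continuous f) :
    ∫ σ, avgList W D l f σ ∂μ = ∫ σ, f σ ∂μ := by
  induction l generalizing f with
  | nil => rfl
  | cons i l ih => exact (ih (hW.continuous_avg _ hf)).trans (hμ.integral_avg hW _ hf)

theorem oscBound_avgList (hW : W.IsLocal)
    (hosc : ∀ i f v, Continuous f → OscBound f v → OscBound (W.avg (D.B i) f) (D.fire i v))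
    (l : List ι) {f : (S → Fin q) → ℝ} {v : S → ℝ} (hf : Continuous f) (h : OscBound f v) :
    OscBound (avgList W D l f) (D.fireList l v) := by
  induction l generalizing f v with
  | nil => exact h
  | cons i l ih => exact ih (hW.continuous_avg _ hf) (hosc i f v hf h)

/-- Cylinder indicators are continuous with finite total oscillation, and they determine the
finite-dimensional marginals and hence the measure. -/
theorem eq_of_integral_eq [Countable S] [NeZero q] {μ ν : Measure (S → Fin q)}
    [IsProbabilityMeasure μ] [IsProbabilityMeasure ν]
    (h : ∀ (f : (S → Fin q) → ℝ) (v : S → ℝ), Continuous f → OscBound f v → Summable v →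
      ∫ σ, f σ ∂μ = ∫ σ, f σ ∂ν) : μ = ν := by
  classical
  have hP : IsProjectiveLimit μ fun I : Finset S => μ.map I.restrict := fun I => rfl
  refine hP.unique fun I => ?_
  refine Measure.ext_of_singleton fun t => ?_
  rw [Measure.map_apply (Finset.measurable_restrict I) (measurableSet_singleton t),
    Measure.map_apply (Finset.measurable_restrict I) (measurableSet_singleton t)]
  have e : (I.restrict ⁻¹' {t} : Set (S → Fin q)) = cylinderSet I t := by
    ext σ
    simp [cylinderSet, funext_iff, Finset.restrict]
  have hm := measurableSet_cylinderSet I t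
  have hosc : OscBound ((cylinderSet I t).indicator fun _ => (1 : ℝ))
      (fun y => if y ∈ I then 1 else 0) := by
    intro y σ σ' hσ
    beta_reduce
    split_ifs with hy
    · by_cases h1 : σ ∈ cylinderSet I t <;> by_cases h2 : σ' ∈ cylinderSet I t <;> simp [h1, h2]
    · have : σ ∈ cylinderSet I t ↔ σ' ∈ cylinderSet I t :=
        forall_congr' fun x => by rw [hσ x fun hx => hy (hx ▸ x.2)]
      simp [Set.indicator_apply, this]
  have := h _ _ (continuous_indicator_cylinderSet I t) hosc
    (BlockData.hasSum_ite_mem fun _ => 1).summable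
  rw [integral_indicator hm, integral_indicator hm] at this
  simp only [integral_const, smul_eq_mul, mul_one, Measure.real, Measure.restrict_apply_univ]
    at this
  rw [e]
  exact ((ENNReal.toReal_eq_toReal_iff' (measure_ne_top _ _) (measure_ne_top _ _)).1 this).symm

/-- The sum telescopes along the updates. Each one lowers the potential `∑ v y * H y` by at least
`(1 - β)` times the part in the block, and by `hκH` this pays for the change of the covariance,
which is at most the product of the block sums of `v` and `u`. -/
theorem abs_covar_le_potential [Countable S] [NeZero q] (hW : W.IsLocal)
    (hpos : ∀ Λ σ, 0 < W.partition Λ σ) {μ : Measure (S → Fin q)} (hμ : W.IsGibbs μ)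
    (hosc : ∀ i f v, Continuous f → OscBound f v → OscBound (W.avg (D.B i) f) (D.fire i v))
    {g : (S → Fin q) → ℝ} {u H : S → ℝ} (hg : Continuous g) (hgu : OscBound g u)
    {M β κ : ℝ} (hH0 : ∀ y, 0 ≤ H y) (hHM : ∀ y, H y ≤ M) (hβ : β < 1) (hκ : 0 < κ)
    (hC : ∀ i, ∀ z ∈ D.B i, ∑ y ∈ D.N i, D.C i z y * H y ≤ β * H z)
    (hκH : ∀ i, ∀ z ∈ D.B i, κ * ∑ y ∈ D.B i, u y ≤ H z)
    (l : List ι) {f : (S → Fin q) → ℝ} {v : S → ℝ} (hf : Continuous f) (hfv : OscBound f v)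
    (hv : Summable v) :
    (1 - β) * κ * |covar μ f g| ≤ (∑' y, v y * H y - ∑' y, D.fireList l v y * H y) +
      (1 - β) * κ * |covar μ (avgList W D l f) g| := by
  induction l generalizing f v with
  | nil => simp [avgList, BlockData.fireList]
  | cons i l ih =>
    have h1 := ih (hW.continuous_avg (D.B i) hf) (hosc i f v hf hfv) (BlockData.summable_fire hv i)
    have h2 := BlockData.tsum_fire_add_le hv hfv.nonneg hH0 hHM (hC i)
    have h3 := abs_covar_le_add hW hpos hμ (D.B i) hf hg hfv hgu
    have h4 : κ * ((∑ y ∈ D.B i, v y) * ∑ y ∈ D.B i, u y) ≤ ∑ z ∈ D.B i, v z * H z := by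
      calc κ * ((∑ y ∈ D.B i, v y) * ∑ y ∈ D.B i, u y)
          = ∑ z ∈ D.B i, v z * (κ * ∑ y ∈ D.B i, u y) := by rw [← Finset.sum_mul]; ring
        _ ≤ _ := Finset.sum_le_sum fun z hz =>
          mul_le_mul_of_nonneg_left (hκH i z hz) (hfv.nonneg z)
    have h5 := mul_le_mul_of_nonneg_left h4 (sub_nonneg.2 hβ.le)
    have h6 := mul_le_mul_of_nonneg_left h3 (mul_nonneg (sub_nonneg.2 hβ.le) hκ.le)
    change _ ≤ (_ - ∑' y, D.fireList l (D.fire i v) y * H y) +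
      (1 - β) * κ * |covar μ (avgList W D l (W.avg (D.B i) f)) g|
    linarith

/-- A weighted block version of the Dobrushin uniqueness theorem, with exponential decay of
correlations. -/
theorem uniqueWithDecay_of_blocks [Countable S] [NeZero q] (hW : W.IsLocal)
    (hpos : ∀ Λ σ, 0 < W.partition Λ σ) (D : BlockData S ι) (hcover : ∀ y, ∃ i, y ∈ D.B i)
    (hosc : ∀ i f v, Continuous f → OscBound f v → OscBound (W.avg (D.B i) f) (D.fire i v))
    {w : S → ℝ} {wmin wmax β : ℝ} (hwmin : 0 < wmin) (hw0 : ∀ y, wmin ≤ w y)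
    (hwmax : ∀ y, w y ≤ wmax) (hβ : 0 ≤ β) (hβ1 : β < 1)
    (hC : ∀ i, ∀ z ∈ D.B i, ∑ y ∈ D.N i, D.C i z y * w y ≤ β * w z)
    (d : S → S → ℕ) (R : ℕ)
    (hd : ∀ i, ∀ z ∈ D.B i, ∀ y ∈ D.N i, ∀ x, d z x ≤ d y x + R)
    (hd' : ∀ i, ∀ z ∈ D.B i, ∀ y ∈ D.B i, d z y ≤ R) : UniqueWithDecay d W := by
  have hw0' : ∀ y, 0 ≤ w y := fun y => hwmin.le.trans (hw0 y)
  have hsmall : ∀ {v : S → ℝ}, Summable v → (∀ y, 0 ≤ v y) → ∀ ε : ℝ, 0 < ε →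
      ∃ l, ∑' y, D.fireList l v y < ε := fun hv hv0 ε hε =>
    BlockData.exists_fireList_lt hv hv0 hcover hwmin hw0 hwmax hβ hβ1 hC hε
  obtain ⟨μ, hμ⟩ := hW.exists_isGibbs hpos
  have hμp := hμ.1
  refine ⟨μ, hμ, fun ν hν => ?_, ?_⟩
  · have := hν.1
    refine eq_of_integral_eq fun f v hf hfv hv => ?_
    refine eq_of_forall_dist_le fun ε hε => ?_
    -- After these updates the function is constant up to `ε / 2`, so every Gibbs measure assigns to
    -- `f` a value within `ε / 2` of the updated function at `σ₀`.
    obtain ⟨l, hl⟩ := hsmall hv hfv.nonneg (ε / 2) (half_pos hε)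
    let σ₀ : S → Fin q := fun _ => 0
    have hb := (oscBound_avgList hW hosc l hf hfv).abs_sub_le_tsum
      (continuous_avgList hW l hf) (BlockData.summable_fireList hv l)
    have hest : ∀ ρ : Measure (S → Fin q), W.IsGibbs ρ →
        |∫ σ, f σ ∂ρ - avgList W D l f σ₀| ≤ ε / 2 := by
      intro ρ hρ
      have := hρ.1
      have h1 := norm_integral_le_of_norm_le_const (μ := ρ)
        (f := fun σ => avgList W D l f σ - avgList W D l f σ₀) (C := ε / 2)
        (.of_forall fun σ => (hb σ σ₀).trans hl.le)
      rw [integral_sub (integrable_of_continuous (continuous_avgList hW l hf))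
        (integrable_of_continuous continuous_const), integral_avgList hW hρ l hf] at h1
      simpa using h1
    rw [Real.dist_eq]
    have h1 := abs_le.1 (hest ν hν)
    have h2 := abs_le.1 (hest μ hμ)
    rw [abs_le]
    constructor <;> linarith [h1.1, h1.2, h2.1, h2.2]
  -- One block update moves oscillation by a distance of at most `R`, which costs a factor `exp (m *
  -- R)` in the exponential potential; `m` is small enough for the contraction to survive this.
  · obtain ⟨m, hmβ, hm⟩ : ∃ m : ℝ, β * Real.exp (m * R) < 1 ∧ 0 < m := by
      have hc : ContinuousAt (fun m : ℝ => β * Real.exp (m * R)) 0 := by fun_prop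
      have h1 : ∀ᶠ m in 𝓝 (0 : ℝ), β * Real.exp (m * R) < 1 :=
        hc.eventually (gt_mem_nhds (by simpa using hβ1))
      exact ((h1.filter_mono nhdsWithin_le_nhds).and
        (self_mem_nhdsWithin : Set.Ioi (0 : ℝ) ∈ 𝓝[>] 0)).exists
    set β' := β * Real.exp (m * R) with hβ'
    set κ := wmin * Real.exp (-m * R) with hκdef
    have hκ : 0 < κ := mul_pos hwmin (Real.exp_pos _)
    have hK : 0 < (1 - β') * κ := mul_pos (sub_pos.2 hmβ) hκ
    refine ⟨m, ((1 - β') * κ)⁻¹ * wmax, hm, fun f g hfs hgs => ?_⟩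
    set v := oscillation f with hv
    set u := oscillation g with hu
    have hu0 : ∀ y, 0 ≤ u y := oscillation_nonneg g
    have hv0 : ∀ y, 0 ≤ v y := oscillation_nonneg f
    have hfv := oscBound_oscillation f.continuous
    have hgu := oscBound_oscillation g.continuous
    have hexp1 : ∀ a b, Real.exp (-m * (d a b : ℝ)) ≤ 1 := fun a b => by
      rw [Real.exp_le_one_iff]
      have : 0 ≤ m * (d a b : ℝ) := by positivity
      linarith
    have hEs : ∀ y, Summable fun x => Real.exp (-m * (d y x : ℝ)) * u x := fun y =>
      Summable.of_nonneg_of_le (fun x => mul_nonneg (Real.exp_pos _).le (hu0 x))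
        (fun x => mul_le_of_le_one_left (hu0 x) (hexp1 y x)) hgs
    -- Up to a constant, the right-hand side of the decay estimate is the sum of `v y * E y`. The
    -- potential `H` is `E` times the contracting weight.
    let E : S → ℝ := fun y => ∑' x, Real.exp (-m * (d y x : ℝ)) * u x
    have hE0 : ∀ y, 0 ≤ E y := fun y =>
      tsum_nonneg fun x => mul_nonneg (Real.exp_pos _).le (hu0 x)
    have hEM : ∀ y, E y ≤ ∑' x, u x := fun y =>
      Summable.tsum_le_tsum (fun x => mul_le_of_le_one_left (hu0 x) (hexp1 y x)) (hEs y) hgs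
    have hwmax0 : ∀ y : S, 0 ≤ wmax := fun y => (hw0' y).trans (hwmax y)
    let H : S → ℝ := fun y => w y * E y
    have hH0 : ∀ y, 0 ≤ H y := fun y => mul_nonneg (hw0' y) (hE0 y)
    have hHM : ∀ y, H y ≤ wmax * ∑' x, u x := fun y =>
      mul_le_mul (hwmax y) (hEM y) (hE0 y) (hwmax0 y)
    have hEcmp : ∀ i, ∀ z ∈ D.B i, ∀ y ∈ D.N i, E y ≤ Real.exp (m * R) * E z := by
      intro i z hz y hy
      rw [← tsum_mul_left]
      refine Summable.tsum_le_tsum (fun x => ?_) (hEs y) ((hEs z).mul_left _)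
      rw [← mul_assoc, ← Real.exp_add]
      refine mul_le_mul_of_nonneg_right (Real.exp_le_exp.2 ?_) (hu0 x)
      have : (d z x : ℝ) ≤ d y x + R := by exact_mod_cast hd i z hz y hy x
      nlinarith
    have hCH : ∀ i, ∀ z ∈ D.B i, ∑ y ∈ D.N i, D.C i z y * H y ≤ β' * H z := by
      intro i z hz
      calc ∑ y ∈ D.N i, D.C i z y * H y
          ≤ ∑ y ∈ D.N i, (D.C i z y * w y) * (Real.exp (m * R) * E z) := by
            refine Finset.sum_le_sum fun y hy => ?_
            rw [← mul_assoc]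
            exact mul_le_mul_of_nonneg_left (hEcmp i z hz y hy)
              (mul_nonneg (D.C_nonneg _ _ _) (hw0' y))
        _ = (∑ y ∈ D.N i, D.C i z y * w y) * (Real.exp (m * R) * E z) := by
            rw [Finset.sum_mul]
        _ ≤ (β * w z) * (Real.exp (m * R) * E z) :=
            mul_le_mul_of_nonneg_right (hC i z hz) (mul_nonneg (Real.exp_pos _).le (hE0 z))
        _ = β' * H z := by simp only [hβ', H]; ring
    have hκH : ∀ i, ∀ z ∈ D.B i, κ * ∑ y ∈ D.B i, u y ≤ H z := by
      intro i z hz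
      have : Real.exp (-m * R) * ∑ y ∈ D.B i, u y ≤ E z := by
        calc Real.exp (-m * R) * ∑ y ∈ D.B i, u y
            ≤ ∑ y ∈ D.B i, Real.exp (-m * (d z y : ℝ)) * u y := by
              rw [Finset.mul_sum]
              refine Finset.sum_le_sum fun y hy =>
                mul_le_mul_of_nonneg_right (Real.exp_le_exp.2 ?_) (hu0 y)
              have : (d z y : ℝ) ≤ R := by exact_mod_cast hd' i z hz y hy
              nlinarith
          _ ≤ E z := (hEs z).sum_le_tsum _ fun x _ => mul_nonneg (Real.exp_pos _).le (hu0 x)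
      calc κ * ∑ y ∈ D.B i, u y = wmin * (Real.exp (-m * R) * ∑ y ∈ D.B i, u y) := by
            rw [hκdef]; ring
        _ ≤ w z * E z := mul_le_mul (hw0 z) this (mul_nonneg (Real.exp_pos _).le
            (Finset.sum_nonneg fun y _ => hu0 y)) (hw0' z)
    obtain ⟨M, hM0, hM⟩ := exists_bound_of_continuous g.continuous
    have hmain : (1 - β') * κ * |covar μ f g| ≤ ∑' y, v y * H y := by
      refine le_of_forall_pos_le_add fun ε hε => ?_
      -- By `abs_covar_le_of_osc` the covariance left over after the updates contributes at most `K`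
      -- times the remaining oscillation; the summand 1 makes `K` positive even if `M` is zero.
      set K := (1 - β') * κ * (2 * M) + 1 with hKd
      have hK0 : 0 < K := by positivity
      obtain ⟨l, hl⟩ := hsmall hfs hv0 (ε / K) (div_pos hε hK0)
      have h1 := abs_covar_le_potential hW hpos hμ hosc g.continuous hgu hH0 hHM hmβ hκ hCH hκH l
        f.continuous hfv hfs
      have h2 := abs_covar_le_of_osc (μ := μ) (continuous_avgList (D := D) hW l f.continuous)
        g.continuous ((oscBound_avgList hW hosc l f.continuous hfv).abs_sub_le_tsum
          (continuous_avgList hW l f.continuous) (BlockData.summable_fireList hfs l)) hM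
        (fun _ => 0)
      have h3 : 0 ≤ ∑' y, D.fireList l v y * H y :=
        tsum_nonneg fun y => mul_nonneg (BlockData.fireList_nonneg hv0 l y) (hH0 y)
      have h4 := mul_le_mul_of_nonneg_left h2 hK.le
      have hT0 : 0 ≤ ∑' y, D.fireList l v y := tsum_nonneg (BlockData.fireList_nonneg hv0 l)
      have h5 : (∑' y, D.fireList l v y) * K < ε := (lt_div_iff₀ hK0).1 hl
      rw [hKd] at h5
      nlinarith
    have hlast : ∑' y, v y * H y ≤ wmax * ∑' x, ∑' y,
        v x * Real.exp (-m * (d x y : ℝ)) * u y := by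
      have e : ∀ x, ∑' y, v x * Real.exp (-m * (d x y : ℝ)) * u y = v x * E x := by
        intro x
        rw [← tsum_mul_left]
        simp only [mul_assoc]
      simp only [e]
      rw [← tsum_mul_left]
      have hs1 := BlockData.summable_mul_of_bounded hfs hv0 hE0 hEM
      refine Summable.tsum_le_tsum (fun y => ?_)
        (BlockData.summable_mul_of_bounded hfs hv0 hH0 hHM) (hs1.mul_left _)
      calc v y * H y = w y * (v y * E y) := by simp only [H]; ring
        _ ≤ wmax * (v y * E y) :=
          mul_le_mul_of_nonneg_right (hwmax y) (mul_nonneg (hv0 y) (hE0 y))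
    change |covar μ f g| ≤ _
    rw [mul_assoc, inv_mul_eq_div, le_div_iff₀ hK, mul_comm]
    exact hmain.trans hlast

end Main

end

end KagomePotts

/-! ### Single-site updates and the Dobrushin constant. -/

namespace KagomePotts

noncomputable section

open Filter Topology LocalWeights

/-- Because `k` and `k'` have the same mass, `F` may be replaced by `F` minus its minimum, which
lies between 0 and `a`. Only the spins with `k' s ≤ k s` then contribute positively, and their
excess mass is at most `c`. -/
theorem sum_mul_sub_le {q : ℕ} [NeZero q] {k k' F : Fin q → ℝ} {a c : ℝ}
    (hone : ∑ s, k s = ∑ s, k' s) (hc : ∀ A : Finset (Fin q), |∑ s ∈ A, k s - ∑ s ∈ A, k' s| ≤ c)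
    (hF : ∀ s t, |F s - F t| ≤ a) : ∑ s, (k s - k' s) * F s ≤ c * a := by
  classical
  obtain ⟨t, -, ht⟩ := Finset.exists_min_image Finset.univ F ⟨0, Finset.mem_univ _⟩
  have ha : 0 ≤ a := (abs_nonneg _).trans (hF 0 0)
  set A := Finset.univ.filter fun s => k' s ≤ k s
  calc ∑ s, (k s - k' s) * F s = ∑ s, (k s - k' s) * (F s - F t) := by
        simp only [mul_sub]
        rw [Finset.sum_sub_distrib, ← Finset.sum_mul, Finset.sum_sub_distrib, hone]
        simp
    _ ≤ ∑ s, if k' s ≤ k s then (k s - k' s) * a else 0 := by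
        refine Finset.sum_le_sum fun s _ => ?_
        have h0 : 0 ≤ F s - F t := sub_nonneg.2 (ht s (Finset.mem_univ _))
        split_ifs with h
        · exact mul_le_mul_of_nonneg_left ((le_abs_self _).trans (hF s t)) (sub_nonneg.2 h)
        · exact mul_nonpos_of_nonpos_of_nonneg (by linarith) h0
    _ = (∑ s ∈ A, k s - ∑ s ∈ A, k' s) * a := by
        rw [← Finset.sum_filter, ← Finset.sum_mul, Finset.sum_sub_distrib]
    _ ≤ c * a := mul_le_mul_of_nonneg_right ((le_abs_self _).trans (hc A)) ha

/-- The change of the integrand, under the kernel `k'`, costs `b`; the change of the kernel, with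
`F` fixed, costs `c * a`. -/
theorem abs_sum_mul_sub_sum_mul_le {q : ℕ} [NeZero q] {k k' F F' : Fin q → ℝ} {a b c : ℝ}
    (hk' : ∀ s, 0 ≤ k' s) (h1 : ∑ s, k s = 1) (h1' : ∑ s, k' s = 1)
    (hc : ∀ A : Finset (Fin q), |∑ s ∈ A, k s - ∑ s ∈ A, k' s| ≤ c)
    (hF : ∀ s t, |F s - F t| ≤ a) (hFF : ∀ s, |F s - F' s| ≤ b) :
    |∑ s, k s * F s - ∑ s, k' s * F' s| ≤ b + c * a := by
  have e : ∑ s, k s * F s - ∑ s, k' s * F' s =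
      ∑ s, k' s * (F s - F' s) + ∑ s, (k s - k' s) * F s := by
    rw [← Finset.sum_sub_distrib, ← Finset.sum_add_distrib]
    exact Finset.sum_congr rfl fun s _ => by ring
  have hA : |∑ s, k' s * (F s - F' s)| ≤ b := by
    calc |∑ s, k' s * (F s - F' s)| ≤ ∑ s, |k' s * (F s - F' s)| := Finset.abs_sum_le_sum_abs _ _
      _ ≤ ∑ s, k' s * b := Finset.sum_le_sum fun s _ => by
          rw [abs_mul, abs_of_nonneg (hk' s)]
          exact mul_le_mul_of_nonneg_left (hFF s) (hk' s)
      _ = b := by rw [← Finset.sum_mul, h1', one_mul]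
  have hB : |∑ s, (k s - k' s) * F s| ≤ c * a := by
    rw [abs_le]
    constructor
    · have := sum_mul_sub_le (F := fun s => -F s) (a := a) (h1.trans h1'.symm) hc fun s t => by
        rw [← abs_neg]; convert hF s t using 2; ring
      simp only [mul_neg, Finset.sum_neg_distrib] at this
      linarith
    · exact sum_mul_sub_le (h1.trans h1'.symm) hc hF
  rw [e]
  exact (abs_add_le _ _).trans (add_le_add hA hB)

namespace LocalWeights

variable {S : Type} {q : ℕ} {W : LocalWeights S q}

theorem glue_singleton [DecidableEq S] (x : S) (s : Fin q) (σ : S → Fin q) :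
    glue {x} (fun _ => s) σ = Function.update σ x s := by
  funext z
  by_cases hz : z = x
  · subst hz; rw [glue_of_mem _ _ (Finset.mem_singleton_self z)]; simp
  · rw [glue_of_notMem _ _ (by simpa using hz), Function.update_of_ne hz]

theorem sum_singleton_config {M : Type*} [AddCommMonoid M] {x : S} [DecidableEq S]
    (g : ((({x} : Finset S) : Type) → Fin q) → M) :
    ∑ τ, g τ = ∑ s : Fin q, g fun _ => s := by
  have : Unique (({x} : Finset S) : Type) :=
    ⟨⟨⟨x, Finset.mem_singleton_self x⟩⟩, fun y => Subtype.ext (Finset.mem_singleton.1 y.2)⟩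
  exact (Equiv.sum_comp (Equiv.funUnique (({x} : Finset S) : Type) (Fin q)).symm g).symm

theorem avg_singleton [DecidableEq S] (W : LocalWeights S q) (x : S) (f : (S → Fin q) → ℝ)
    (σ : S → Fin q) :
    W.avg {x} f σ = ∑ s, W.kernel {x} (fun _ => s) σ * f (Function.update σ x s) := by
  classical
  rw [avg]
  refine (Finset.sum_congr (by congr!) fun _ _ => rfl).trans
    ((sum_singleton_config _).trans ?_)
  simp only [glue_singleton]

theorem sum_kernel_singleton {x : S} {σ : S → Fin q} (h : 0 < W.partition {x} σ) :
    ∑ s, W.kernel {x} (fun _ => s) σ = 1 := by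
  classical
  rw [← sum_kernel h, sum_singleton_config]

theorem IsLocal.siteProb_nonneg (hW : W.IsLocal) (x : S) (A : Finset (Fin q)) (σ : S → Fin q) :
    0 ≤ W.siteProb x A σ :=
  Finset.sum_nonneg fun _ _ => hW.kernel_nonneg _ _ _

theorem IsLocal.siteProb_le_one (hW : W.IsLocal) (x : S) (A : Finset (Fin q)) (σ : S → Fin q) :
    W.siteProb x A σ ≤ 1 := by
  classical
  rcases (hW.partition_nonneg {x} σ).eq_or_lt with h | h
  · simp [siteProb, kernel, ← h]
  · rw [← sum_kernel_singleton h]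
    exact Finset.sum_le_sum_of_subset_of_nonneg (Finset.subset_univ A)
      fun _ _ _ => hW.kernel_nonneg _ _ _

theorem le_interdep (W : LocalWeights S q) {x y : S} {σ σ' : S → Fin q}
    (h : ∀ z, z ≠ y → σ z = σ' z) (A : Finset (Fin q)) :
    ENNReal.ofReal |W.siteProb x A σ - W.siteProb x A σ'| ≤ W.interdep x y :=
  le_iSup_of_le σ (le_iSup_of_le σ' (le_iSup_of_le h (le_iSup_of_le A le_rfl)))

theorem interdep_le {x y : S} {c : ℝ≥0∞}
    (h : ∀ σ σ', (∀ z, z ≠ y → σ z = σ' z) → ∀ A : Finset (Fin q),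
      ENNReal.ofReal |W.siteProb x A σ - W.siteProb x A σ'| ≤ c) : W.interdep x y ≤ c :=
  iSup_le fun σ => iSup_le fun σ' => iSup_le fun hσ => iSup_le fun A => h σ σ' hσ A

/-- This makes the constants finite, so that no information is lost in passing to `toReal`. -/
theorem IsLocal.interdep_le_one (hW : W.IsLocal) (x y : S) : W.interdep x y ≤ 1 := by
  refine interdep_le fun σ σ' _ A => ?_
  rw [ENNReal.ofReal_le_one, abs_le]
  constructor <;>
    linarith [hW.siteProb_nonneg x A σ, hW.siteProb_nonneg x A σ', hW.siteProb_le_one x A σ,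
      hW.siteProb_le_one x A σ']

theorem IsLocal.abs_siteProb_sub_le (hW : W.IsLocal) {x y : S} {σ σ' : S → Fin q}
    (h : ∀ z, z ≠ y → σ z = σ' z) (A : Finset (Fin q)) :
    |W.siteProb x A σ - W.siteProb x A σ'| ≤ (W.interdep x y).toReal :=
  (ENNReal.ofReal_le_iff_le_toReal
    ((hW.interdep_le_one x y).trans_lt ENNReal.one_lt_top).ne).1 (W.le_interdep h A)

theorem IsLocal.interdep_eq_zero (hW : W.IsLocal) {x y : S} (hxy : y ∉ W.closureOf {x}) :
    W.interdep x y = 0 := by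
  refine le_antisymm (interdep_le fun σ σ' h A => ?_) zero_le
  have : ∀ s : Fin q, W.kernel {x} (fun _ => s) σ = W.kernel {x} (fun _ => s) σ' := fun s =>
    hW.dependsOn_kernel _ _ fun z hz => h z fun hzy => hxy (hzy ▸ hz.1)
  simp [siteProb, this]

theorem sum_interdep_le_dobrushin (W : LocalWeights S q) (x : S) (N : Finset S) (hN : x ∉ N) :
    ∑ y ∈ N, W.interdep x y ≤ W.dobrushin := by
  refine le_trans ?_ (le_iSup (fun x => ∑' y : {y : S // y ≠ x}, W.interdep x y) x)
  have hN' : ∀ y ∈ N, y ≠ x := fun y hy h => hN (h ▸ hy)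
  let N' : Finset {y : S // y ≠ x} :=
    N.attach.map ⟨fun y : {y // y ∈ N} => (⟨y.1, hN' y.1 y.2⟩ : {y : S // y ≠ x}),
      fun a b h => Subtype.ext (congrArg (fun z : {y : S // y ≠ x} => z.1) h)⟩
  calc ∑ y ∈ N, W.interdep x y = ∑ y ∈ N', W.interdep x y := by
        rw [Finset.sum_map, ← Finset.sum_attach]
        rfl
    _ ≤ _ := ENNReal.sum_le_tsum N'

theorem IsLocal.sum_toReal_interdep_le (hW : W.IsLocal) (h : W.dobrushin < 1) (x : S)
    (N : Finset S) (hN : x ∉ N) :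
    ∑ y ∈ N, (W.interdep x y).toReal ≤ W.dobrushin.toReal := by
  rw [← ENNReal.toReal_sum fun y _ =>
    ((hW.interdep_le_one x y).trans_lt ENNReal.one_lt_top).ne]
  exact ENNReal.toReal_mono (h.trans ENNReal.one_lt_top).ne
    (W.sum_interdep_le_dobrushin x N hN)

/-- The change, under a change of the spin at `y`, of an average of `f` with respect to the kernel
at the site `x`. -/
theorem IsLocal.abs_sum_kernel_mul_sub_le [NeZero q] (hW : W.IsLocal)
    (hpos : ∀ x σ, 0 < W.partition {x} σ) {x y : S} {σ σ' : S → Fin q}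
    (h : ∀ z, z ≠ y → σ z = σ' z) {F F' : Fin q → ℝ} {a b : ℝ} (hF : ∀ s t, |F s - F t| ≤ a)
    (hFF : ∀ s, |F s - F' s| ≤ b) :
    |∑ s, W.kernel {x} (fun _ => s) σ * F s - ∑ s, W.kernel {x} (fun _ => s) σ' * F' s| ≤
      b + (W.interdep x y).toReal * a :=
  abs_sum_mul_sub_sum_mul_le (fun _ => hW.kernel_nonneg _ _ _)
    (sum_kernel_singleton (hpos x σ)) (sum_kernel_singleton (hpos x σ'))
    (fun A => hW.abs_siteProb_sub_le h A) hF hFF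

open Classical in
/-- Single-site updates. -/
def siteBlocks (hW : W.IsLocal) : BlockData S S where
  B x := {x}
  N x := (hW.finite_closureOf {x}).toFinset.erase x
  C x _ y := (W.interdep x y).toReal
  C_nonneg _ _ _ := ENNReal.toReal_nonneg

/-- The Dobrushin uniqueness theorem with exponential decay of correlations. -/
theorem IsLocal.uniqueWithDecay_of_dobrushin_lt_one [Countable S] [NeZero q] (hW : W.IsLocal)
    (hpos : ∀ x σ, 0 < W.partition {x} σ) (hdob : W.dobrushin < 1) (d : S → S → ℕ) (R : ℕ)
    (hd : ∀ A, ∀ x ∈ W.supp A, ∀ y ∈ W.supp A, ∀ z, d x z ≤ d y z + R)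
    (hd0 : ∀ x, d x x = 0) : UniqueWithDecay d W := by
  classical
  refine uniqueWithDecay_of_blocks hW (hW.partition_pos hpos) (siteBlocks hW)
    (fun y => ⟨y, Finset.mem_singleton_self y⟩) ?_ (w := fun _ => 1) (wmin := 1) (wmax := 1)
    (β := W.dobrushin.toReal) one_pos (fun _ => le_rfl) (fun _ => le_rfl)
    ENNReal.toReal_nonneg ?_ ?_ d R ?_ ?_
  · intro x f v hf hfv y σ σ' h
    by_cases hyx : y = x
    · subst hyx
      have : W.avg {y} f σ = W.avg {y} f σ' := hW.dependsOn_avg _ _ fun z hz => h z (by simpa using hz)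
      simp [siteBlocks, BlockData.fire, this]
    · have hup : ∀ s, |f (Function.update σ x s) - f (Function.update σ' x s)| ≤ v y := by
        refine fun s => hfv y _ _ fun z hz => ?_
        by_cases hzx : z = x
        · subst hzx; simp
        · rw [Function.update_of_ne hzx, Function.update_of_ne hzx, h z hz]
      have hupx : ∀ s t, |f (Function.update σ x s) - f (Function.update σ x t)| ≤ v x :=
        fun s t => hfv x _ _ fun z hz => by rw [Function.update_of_ne hz, Function.update_of_ne hz]
      have key := hW.abs_sum_kernel_mul_sub_le hpos h hupx hup (x := x)
      change |W.avg {x} f σ - W.avg {x} f σ'| ≤ _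
      rw [avg_singleton, avg_singleton]
      refine key.trans ?_
      by_cases hyN : y ∈ W.closureOf {x}
      · simp [siteBlocks, BlockData.fire, hyx, hyN, mul_comm]
      · simp [siteBlocks, BlockData.fire, hyx, hyN, hW.interdep_eq_zero hyN]
  · exact (ENNReal.toReal_lt_toReal (hdob.trans ENNReal.one_lt_top).ne ENNReal.one_ne_top).2 hdob
  · intro x z hz
    simp only [mul_one]
    exact hW.sum_toReal_interdep_le hdob x _ (Finset.notMem_erase x _)
  · intro x z hz y hy w
    have hz' : z = x := Finset.mem_singleton.1 hz
    have hy' : y ∈ W.closureOf {x} := by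
      have := Finset.mem_of_mem_erase hy
      simpa using this
    subst hz'
    obtain ⟨A, hA, hyA⟩ := Set.mem_iUnion₂.1 hy'
    exact hd A z (mem_touching_singleton.1 hA) y hyA w
  · intro x z hz y hy
    have hz' : z = x := Finset.mem_singleton.1 hz
    have hy' : y = x := Finset.mem_singleton.1 hy
    rw [hz', hy', hd0]
    exact Nat.zero_le _

end LocalWeights

end

end KagomePotts

namespace KagomePotts

noncomputable section

open Filter Topology LocalWeights

/-! ### Summing out clusters of the Potts model. -/

section Potts

variable {V ι : Type} {G : SimpleGraph V} {K : ι → Set V} {q : ℕ}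

/-- The graph is locally finite, and the clusters are finite and separated. -/
structure Decimable (G : SimpleGraph V) (K : ι → Set V) : Prop where
  finite_adj : ∀ v, {u | G.Adj v u}.Finite
  finite_cluster : ∀ i, (K i).Finite
  separated : SeparatedClusters G K

theorem finite_setOf_mem_sym2 {S : Type} (e : Sym2 S) : {x | x ∈ e}.Finite := by
  induction e with
  | _ a b =>
    refine (Set.toFinite {a, b}).subset fun x hx => ?_
    simpa using hx

theorem finite_edges {G : SimpleGraph V} (h : ∀ v, {u | G.Adj v u}.Finite) (x : V) :
    {e : G.edgeSet | x ∈ (e : Sym2 V)}.Finite := by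
  refine (((h x).image fun u => s(x, u)).preimage Subtype.val_injective.injOn).subset ?_
  rintro ⟨e, he⟩ hx
  obtain ⟨u, rfl⟩ := Sym2.mem_iff_exists.1 (show x ∈ e from hx)
  exact ⟨u, he, rfl⟩

theorem isLocal_potts (h : ∀ v, {u | G.Adj v u}.Finite) (q : ℕ) : (potts G q).IsLocal where
  finite_index x := finite_edges h x
  finite_supp _ := finite_setOf_mem_sym2 _

theorem edgeFactor_mk {S : Type} (x y : S) (σ : S → Fin q) :
    edgeFactor s(x, y) σ = if σ x = σ y then 0 else 1 := by
  simp [edgeFactor]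

theorem prod_edgeFactor {S : Type} {H : SimpleGraph S} (Λ : Finset S) (E : Finset H.edgeSet)
    (hE : ∀ e : H.edgeSet, e ∈ E ↔ ∃ x ∈ Λ, x ∈ (e : Sym2 S)) (σ : S → Fin q)
    [Decidable (∀ x y, H.Adj x y → x ∈ Λ → σ x ≠ σ y)] :
    ∏ e ∈ E, edgeFactor (e : Sym2 S) σ =
      if ∀ x y, H.Adj x y → x ∈ Λ → σ x ≠ σ y then 1 else 0 := by
  split_ifs with h
  · refine Finset.prod_eq_one ?_
    rintro ⟨e, he⟩ heE
    obtain ⟨x, hx, hxe⟩ := (hE _).1 heE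
    obtain ⟨y, rfl⟩ := Sym2.mem_iff_exists.1 (show x ∈ e from hxe)
    simp only
    rw [edgeFactor_mk, if_neg (h x y he hx)]
  · push Not at h
    obtain ⟨x, y, hxy, hx, he⟩ := h
    refine Finset.prod_eq_zero (i := ⟨s(x, y), hxy⟩) ((hE _).2 ⟨x, hx, Sym2.mem_mk_left x y⟩) ?_
    simp only
    rw [edgeFactor_mk, if_pos he]

open Classical in
theorem boltzmann_potts (h : ∀ v, {u | G.Adj v u}.Finite) (Λ : Finset V) (σ : V → Fin q) :
    (potts G q).boltzmann Λ σ = if ∀ x y, G.Adj x y → x ∈ Λ → σ x ≠ σ y then 1 else 0 := by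
  rw [(isLocal_potts h q).boltzmann_eq]
  refine prod_edgeFactor Λ _ (fun e => (Set.Finite.mem_toFinset _).trans ?_) σ
  exact ⟨fun ⟨x, hx, hxΛ⟩ => ⟨x, hxΛ, hx⟩, fun ⟨x, hxΛ, hx⟩ => ⟨x, hx, hxΛ⟩⟩

namespace Decimable

theorem finite_borders (h : Decimable G K) (x : Remaining K) : {i | Borders G K i x}.Finite := by
  refine Set.Finite.subset ((h.finite_adj x).biUnion (t := fun u => {i | u ∈ K i}) fun u _ => ?_) ?_
  · refine Set.Subsingleton.finite fun i hi j hj => ?_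
    by_contra hij
    exact Set.disjoint_left.1 (h.separated i j hij).1 hi hj
  · rintro i ⟨u, hu, hux⟩
    exact Set.mem_biUnion hux.symm hu

theorem finite_plaquette (h : Decimable G K) (i : ι) : {x | Borders G K i x}.Finite := by
  refine Set.Finite.subset (((h.finite_cluster i).biUnion fun u _ => h.finite_adj u).preimage
    Subtype.val_injective.injOn) ?_
  rintro x ⟨u, hu, hux⟩
  exact Set.mem_biUnion hu hux

theorem finite_linkGraph (h : Decimable G K) (x : Remaining K) :
    {y | (linkGraph G K).Adj x y}.Finite :=
  (h.finite_adj x).preimage Subtype.val_injective.injOn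

theorem isLocal (h : Decimable G K) (q : ℕ) : (decimated G K q).IsLocal where
  finite_index x := by
    refine Set.Finite.subset (((h.finite_borders x).image Sum.inl).union
      ((finite_edges h.finite_linkGraph x).image Sum.inr)) ?_
    rintro (i | e) hx
    · exact Or.inl ⟨i, hx, rfl⟩
    · exact Or.inr ⟨e, hx, rfl⟩
  finite_supp := by
    rintro (i | e)
    · exact h.finite_plaquette i
    · exact finite_setOf_mem_sym2 _

/-- The clusters whose plaquette meets `Λ`. -/
def clusters (h : Decimable G K) (Λ : Finset (Remaining K)) : Finset ι :=
  (Λ.finite_toSet.biUnion fun x _ => h.finite_borders x).toFinset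

theorem mem_clusters (h : Decimable G K) {Λ : Finset (Remaining K)} {i : ι} :
    i ∈ h.clusters Λ ↔ ∃ x ∈ Λ, Borders G K i x := by
  simp [clusters]

/-- The sites of the clusters whose plaquette meets `Λ`. -/
def clusterSites (h : Decimable G K) (Λ : Finset (Remaining K)) : Finset V :=
  ((h.clusters Λ).finite_toSet.biUnion fun i _ => h.finite_cluster i).toFinset

theorem mem_clusterSites (h : Decimable G K) {Λ : Finset (Remaining K)} {u : V} :
    u ∈ h.clusterSites Λ ↔ ∃ i ∈ h.clusters Λ, u ∈ K i := by
  simp [clusterSites]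

open Classical in
theorem boltzmann_decimated (h : Decimable G K) (Λ : Finset (Remaining K))
    (ρ : Remaining K → Fin q) :
    (decimated G K q).boltzmann Λ ρ = (∏ i ∈ h.clusters Λ, (clusterWeight G K i ρ : ℝ)) *
      if ∀ x y, (linkGraph G K).Adj x y → x ∈ Λ → ρ x ≠ ρ y then 1 else 0 := by
  have hE : {e : (linkGraph G K).edgeSet | ∃ x ∈ Λ, x ∈ (e : Sym2 (Remaining K))}.Finite := by
    refine (Λ.finite_toSet.biUnion fun x _ => finite_edges h.finite_linkGraph x).subset ?_
    rintro e ⟨x, hx, hxe⟩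
    exact Set.mem_biUnion hx hxe
  have e : ((h.isLocal q).finite_touching Λ).toFinset =
      (h.clusters Λ).disjSum hE.toFinset := by
    ext A
    refine (Set.Finite.mem_toFinset _).trans ?_
    rcases A with i | e
    · refine Iff.trans ?_ (Finset.inl_mem_disjSum.trans h.mem_clusters).symm
      exact ⟨fun ⟨x, hx, hxΛ⟩ => ⟨x, hxΛ, hx⟩, fun ⟨x, hxΛ, hx⟩ => ⟨x, hx, hxΛ⟩⟩
    · refine Iff.trans ?_ (Finset.inr_mem_disjSum.trans (Set.Finite.mem_toFinset _)).symm
      exact ⟨fun ⟨x, hx, hxΛ⟩ => ⟨x, hxΛ, hx⟩, fun ⟨x, hxΛ, hx⟩ => ⟨x, hx, hxΛ⟩⟩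
  refine ((h.isLocal q).boltzmann_eq Λ ρ).trans ((Finset.prod_congr e fun _ _ => rfl).trans
    ((Finset.prod_disjSum _ _ _).trans ?_))
  congr 1
  exact prod_edgeFactor Λ _ (fun e => by rw [Set.Finite.mem_toFinset]; rfl) ρ

/-- The embedding of the remaining sites. -/
def remEmb (K : ι → Set V) : Remaining K ↪ V := Function.Embedding.subtype _

open Classical in
/-- The block consisting of `Λ` and of the clusters whose plaquette meets `Λ`. -/
def block (h : Decimable G K) (Λ : Finset (Remaining K)) : Finset V :=
  Λ.map (remEmb K) ∪ h.clusterSites Λ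

theorem disjoint_map_clusterSites (h : Decimable G K) (Λ Λ' : Finset (Remaining K)) :
    Disjoint (Λ'.map (remEmb K)) (h.clusterSites Λ) := by
  rw [Finset.disjoint_left]
  intro u hu hu'
  obtain ⟨x, -, rfl⟩ := Finset.mem_map.1 hu
  obtain ⟨i, -, hi⟩ := h.mem_clusterSites.1 hu'
  exact x.2 i hi

/-- Compatibility of the spins of a cluster with each other and with the remaining spins. -/
def Compatible (G : SimpleGraph V) (K : ι → Set V) (i : ι) (t : Remaining K → Fin q)
    (η : K i → Fin q) : Prop :=
  (∀ u v : K i, G.Adj u v → η u ≠ η v) ∧ ∀ (u : K i) (y : Remaining K), G.Adj u y → η u ≠ t y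

/-- An edge starting in a cluster ends in the same cluster or at a remaining site, since distinct
clusters are not joined by edges. Properness in the block therefore splits into a condition on the
links and a separate condition for each cluster. -/
theorem proper_iff (h : Decimable G K) (Λ : Finset (Remaining K)) (σ : V → Fin q)
    (η : h.clusterSites Λ → Fin q) :
    (∀ u v, G.Adj u v → u ∈ h.block Λ →
      glue (h.clusterSites Λ) η σ u ≠ glue (h.clusterSites Λ) η σ v) ↔
    (∀ x y, (linkGraph G K).Adj x y → x ∈ Λ → σ x ≠ σ y) ∧
      ∀ i : h.clusters Λ, Compatible G K i (fun x => σ x)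
        fun u => η ⟨u, h.mem_clusterSites.2 ⟨i, i.2, u.2⟩⟩ := by
  classical
  have hrem : ∀ x : Remaining K, glue (h.clusterSites Λ) η σ x = σ x := fun x =>
    glue_of_notMem _ _ fun hx => by
      obtain ⟨i, -, hi⟩ := h.mem_clusterSites.1 hx
      exact x.2 i hi
  have hclu : ∀ (i : h.clusters Λ) (u : K i), glue (h.clusterSites Λ) η σ u =
      η ⟨u, h.mem_clusterSites.2 ⟨i, i.2, u.2⟩⟩ := fun i u => glue_of_mem _ _ _
  have hmemc : ∀ (i : h.clusters Λ) (u : K i), (u : V) ∈ h.block Λ := fun i u =>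
    Finset.mem_union_right _ (h.mem_clusterSites.2 ⟨i, i.2, u.2⟩)
  constructor
  · intro H
    refine ⟨fun x y hxy hx => ?_, fun i => ⟨fun u v huv => ?_, fun u y huy => ?_⟩⟩
    · have := H x y hxy (Finset.mem_union_left _ (Finset.mem_map_of_mem (remEmb K) hx))
      rwa [hrem, hrem] at this
    · have := H u v huv (hmemc i u)
      rwa [hclu i, hclu i] at this
    · have := H u y huy (hmemc i u)
      rwa [hclu i, hrem] at this
  · rintro ⟨H1, H2⟩ u v huv hu
    rcases Finset.mem_union.1 hu with hu | hu
    · obtain ⟨x, hx, rfl⟩ := Finset.mem_map.1 hu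
      change glue _ η σ (x : V) ≠ _
      by_cases hv : ∀ i, v ∉ K i
      · have := H1 x ⟨v, hv⟩ huv hx
        rw [← hrem, ← hrem] at this
        exact this
      · push Not at hv
        obtain ⟨i, hi⟩ := hv
        have hb : i ∈ h.clusters Λ := h.mem_clusters.2 ⟨x, hx, v, hi, huv.symm⟩
        have := (H2 ⟨i, hb⟩).2 ⟨v, hi⟩ x huv.symm
        exact fun he => this (((hclu ⟨i, hb⟩ ⟨v, hi⟩).symm.trans he.symm).trans (hrem x))
    · obtain ⟨i, hi, hui⟩ := h.mem_clusterSites.1 hu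
      by_cases hv : ∀ j, v ∉ K j
      · have := (H2 ⟨i, hi⟩).2 ⟨u, hui⟩ ⟨v, hv⟩ huv
        exact fun he => this (((hclu ⟨i, hi⟩ ⟨u, hui⟩).symm.trans he).trans (hrem ⟨v, hv⟩))
      · push Not at hv
        obtain ⟨j, hj⟩ := hv
        rcases eq_or_ne i j with rfl | hij
        · have := (H2 ⟨i, hi⟩).1 ⟨u, hui⟩ ⟨v, hj⟩ huv
          exact fun he =>
            this (((hclu ⟨i, hi⟩ ⟨u, hui⟩).symm.trans he).trans (hclu ⟨i, hi⟩ ⟨v, hj⟩))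
        · exact absurd huv ((h.separated i j hij).2 u hui v hj)

/-- Spins of the sites of several clusters, cluster by cluster. -/
def splitClusters (h : Decimable G K) (Λ : Finset (Remaining K)) (q : ℕ) :
    (h.clusterSites Λ → Fin q) ≃ ((i : h.clusters Λ) → K i → Fin q) :=
  Equiv.ofBijective
    (fun η i u => η ⟨u, h.mem_clusterSites.2 ⟨i, i.2, u.2⟩⟩) (by
    constructor
    · intro η η' he
      funext u
      obtain ⟨i, hi, hu⟩ := h.mem_clusterSites.1 u.2
      exact congrFun (congrFun he ⟨i, hi⟩) ⟨u, hu⟩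
    · intro f
      choose c hc hmem using fun u : h.clusterSites Λ => h.mem_clusterSites.1 u.2
      refine ⟨fun u => f ⟨c u, hc u⟩ ⟨u, hmem u⟩, ?_⟩
      funext i u
      have key : ∀ j : h.clusters Λ, ∀ hj : (u : V) ∈ K j, f j ⟨u, hj⟩ = f i u := by
        intro j hj
        have : j = i := by
          by_contra hne
          exact Set.disjoint_left.1
            (h.separated j i fun e => hne (Subtype.ext e)).1 hj u.2
        subst this
        rfl
      exact key _ _)

/-- The Boltzmann weight is an indicator, so the sum counts proper extensions to the clusters. The
conditions are independent, and the count is the product of the cluster weights. -/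
theorem sum_boltzmann (h : Decimable G K) [DecidableEq V] (Λ : Finset (Remaining K))
    (σ : V → Fin q) :
    sumOver (h.clusterSites Λ) ((potts G q).boltzmann (h.block Λ)) σ =
      (decimated G K q).boltzmann Λ fun x => σ x := by
  classical
  rw [h.boltzmann_decimated, sumOver]
  simp only [boltzmann_potts h.finite_adj, h.proper_iff]
  by_cases hl : ∀ x y, (linkGraph G K).Adj x y → x ∈ Λ → σ x ≠ σ y
  · rw [if_pos hl, mul_one, Finset.sum_boole, ← Fintype.card_subtype, ← Nat.card_eq_fintype_card,
      ← Finset.prod_coe_sort, ← Nat.cast_prod]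
    congr 1
    refine (Nat.card_congr ((h.splitClusters Λ q).subtypeEquiv (q := fun f =>
      ∀ i : h.clusters Λ, Compatible G K i (fun x => σ x) (f i)) fun η => and_iff_right hl)).trans ?_
    rw [Nat.card_congr (Equiv.subtypePiEquivPi (p := fun i : h.clusters Λ =>
        Compatible G K i fun x => σ x)), Nat.card_pi]
    rfl
  · rw [if_neg hl, mul_zero]
    exact Finset.sum_eq_zero fun η _ => if_neg fun h => hl h.1

open Classical in
/-- Replace the spins in `Λ`. -/
def glueRem (Λ : Finset (Remaining K)) (τ : Λ → Fin q) (σ : V → Fin q) (v : V) : Fin q :=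
  if h : ∃ hv : ∀ i, v ∉ K i, (⟨v, hv⟩ : Remaining K) ∈ Λ then τ ⟨⟨v, h.1⟩, h.2⟩ else σ v

theorem glueRem_rem (Λ : Finset (Remaining K)) (τ : Λ → Fin q) (σ : V → Fin q) :
    (fun x : Remaining K => glueRem Λ τ σ x) = glue Λ τ fun x => σ x := by
  funext x
  by_cases hx : x ∈ Λ
  · rw [glue_of_mem _ _ hx, glueRem, dif_pos ⟨x.2, hx⟩]
  · rw [glue_of_notMem _ _ hx, glueRem, dif_neg fun h => hx h.2]

theorem glue_map_remEmb (Λ : Finset (Remaining K)) (τ : Λ.map (remEmb K) → Fin q)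
    (σ : V → Fin q) :
    glue (Λ.map (remEmb K)) τ σ =
      glueRem Λ (fun x => τ ⟨x, Finset.mem_map_of_mem (remEmb K) x.2⟩) σ := by
  funext v
  by_cases hv : v ∈ Λ.map (remEmb K)
  · rw [glue_of_mem _ _ hv]
    obtain ⟨x, hx, rfl⟩ := Finset.mem_map.1 hv
    rw [glueRem, dif_pos ⟨x.2, hx⟩]
  · rw [glue_of_notMem _ _ hv, glueRem, dif_neg]
    rintro ⟨h1, h2⟩
    exact hv (Finset.mem_map_of_mem (remEmb K) h2)

theorem bijective_comp_remEmb (Λ : Finset (Remaining K)) :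
    Function.Bijective fun (τ : Λ.map (remEmb K) → Fin q) (x : Λ) =>
      τ ⟨x, Finset.mem_map_of_mem (remEmb K) x.2⟩ := by
  constructor
  · intro τ τ' he
    funext ⟨v, hv⟩
    obtain ⟨x, hx, rfl⟩ := Finset.mem_map.1 hv
    exact congrFun he ⟨x, hx⟩
  · intro τ
    have hx : ∀ v : Λ.map (remEmb K), ∃ x : Λ, (x : V) = v := fun v => by
      obtain ⟨x, hx, hxv⟩ := Finset.mem_map.1 v.2
      exact ⟨⟨x, hx⟩, hxv⟩
    choose p hp using hx
    refine ⟨fun v => τ (p v), funext fun x => congrArg τ (Subtype.ext (Subtype.ext (hp _)))⟩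

theorem sumOver_union {S : Type} [DecidableEq S] {s t : Finset S} (hst : Disjoint s t)
    (f : (S → Fin q) → ℝ) (σ : S → Fin q) :
    sumOver (s ∪ t) f σ = sumOver s (sumOver t f) σ := by
  simp only [sumOver]
  rw [← Fintype.sum_prod_type', ← Equiv.sum_comp (Equiv.piFinsetUnion (fun _ => Fin q) hst)]
  refine Finset.sum_congr rfl fun p _ => ?_
  congr 1
  funext x
  by_cases ht : x ∈ t
  · rw [glue_of_mem _ _ (Finset.mem_union_right s ht), glue_of_mem _ _ ht]
    exact Equiv.piFinsetUnion_right (fun _ => Fin q) hst ht _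
  · rw [glue_of_notMem _ _ ht]
    by_cases hs : x ∈ s
    · rw [glue_of_mem _ _ (Finset.mem_union_left t hs), glue_of_mem _ _ hs]
      exact Equiv.piFinsetUnion_left (fun _ => Fin q) hst hs _
    · rw [glue_of_notMem _ _ hs, glue_of_notMem]
      simp [hs, ht]

/-- The sum over the block is taken over the clusters first; `f` is constant there and comes out of
the inner sum. -/
theorem sumOver_block (h : Decimable G K) [DecidableEq V] [DecidableEq (Remaining K)]
    (Λ : Finset (Remaining K))
    {f : (V → Fin q) → ℝ} (hf : DependsOn f (h.clusterSites Λ : Set V)ᶜ) (σ : V → Fin q) :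
    sumOver (h.block Λ) (fun σ => (potts G q).boltzmann (h.block Λ) σ * f σ) σ =
      ∑ τ : Λ → Fin q, (decimated G K q).boltzmann Λ (glue Λ τ fun x => σ x) *
        f (glueRem Λ τ σ) := by
  have e : h.block Λ = Λ.map (remEmb K) ∪ h.clusterSites Λ := by
    unfold block; congr!
  have e1 : (fun σ => (potts G q).boltzmann (h.block Λ) σ * f σ) =
      fun σ => f σ * (potts G q).boltzmann (h.block Λ) σ := by
    funext σ; ring
  have key := sumOver_union (h.disjoint_map_clusterSites Λ Λ)
    (fun σ => f σ * (potts G q).boltzmann (h.block Λ) σ) σ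
  rw [← e] at key
  rw [e1, key, sumOver]
  refine Fintype.sum_bijective _ (bijective_comp_remEmb Λ) _ _ fun τ => ?_
  rw [sumOver_mul_left hf, h.sum_boltzmann, mul_comm, glue_map_remEmb, glueRem_rem]

/-- The kernel of the Potts model in a block, applied to functions that do not depend on the
spins of the clusters, is given by the kernel of the decimated model. -/
theorem avg_block (h : Decimable G K) [DecidableEq (Remaining K)] (Λ : Finset (Remaining K))
    {f : (V → Fin q) → ℝ} (hf : DependsOn f (h.clusterSites Λ : Set V)ᶜ) (σ : V → Fin q) :
    (potts G q).avg (h.block Λ) f σ =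
      ∑ τ : Λ → Fin q, (decimated G K q).kernel Λ τ (fun x => σ x) * f (glueRem Λ τ σ) := by
  classical
  have hZ : (potts G q).partition (h.block Λ) σ =
      (decimated G K q).partition Λ fun x => σ x := by
    have := h.sumOver_block (q := q) Λ (f := fun _ => 1) (fun _ _ _ => rfl) σ
    simp only [mul_one] at this
    rw [partition_eq_sumOver, this, partition]
    congr!
  rw [avg_eq_sumOver, h.sumOver_block Λ hf, hZ, Finset.sum_div]
  refine Finset.sum_congr (by congr!) fun τ _ => ?_
  rw [kernel]; ring

/-- Summing out clusters maps Gibbs measures to Gibbs measures of the decimated model. -/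
theorem decimationMapsGibbs [Countable V] (h : Decimable G K) (q : ℕ) :
    DecimationMapsGibbs G K q := by
  classical
  intro μ hμ
  have := hμ.1
  have hr : Continuous fun (σ : V → Fin q) (x : Remaining K) => σ x :=
    continuous_pi fun x => continuous_apply _
  have hrm : Measurable fun (σ : V → Fin q) (x : Remaining K) => σ x :=
    measurable_pi_lambda _ fun x => measurable_pi_apply _
  have := Measure.isProbabilityMeasure_map (μ := μ) hrm.aemeasurable
  refine isGibbs_of_integral_avg (h.isLocal q) fun Λ f hf => ?_
  have hint : ∀ g : (Remaining K → Fin q) → ℝ, Continuous g →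
      ∫ ρ, g ρ ∂(μ.map fun σ (x : Remaining K) => σ x) = ∫ σ, g (fun x => σ x) ∂μ := fun g hg =>
    integral_map hrm.aemeasurable hg.measurable.aestronglyMeasurable
  rw [hint _ ((h.isLocal q).continuous_avg Λ hf), hint f hf]
  -- The block kernel acts on functions of the remaining spins as the decimated kernel, so
  -- invariance of `μ` under the block gives invariance of its image under `Λ`.
  refine Eq.trans (integral_congr_ae (.of_forall fun σ => ?_))
    (hμ.integral_avg (isLocal_potts h.finite_adj q) (h.block Λ) (hf.comp hr))
  simp only
  rw [h.avg_block Λ, avg]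
  · refine Finset.sum_congr (by congr!) fun τ _ => ?_
    rw [glueRem_rem]
  · intro σ σ' hσ
    simp only
    congr 1
    funext x
    refine hσ x fun hx => ?_
    obtain ⟨i, -, hi⟩ := h.mem_clusterSites.1 (Finset.mem_coe.1 hx)
    exact x.2 i hi

end Decimable

end Potts

end

end KagomePotts

namespace KagomePotts

noncomputable section

open Filter Topology LocalWeights

/-! ### Distances controlled by short walks. -/

section Distance

variable {V : Type} {G : SimpleGraph V}

/-- There is a walk of length at most `n` from `x` to `y`. -/
def Near (G : SimpleGraph V) (n : ℕ) (x y : V) : Prop :=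
  ∃ p : G.Walk x y, p.length ≤ n

theorem Near.refl (G : SimpleGraph V) (n : ℕ) (x : V) : Near G n x x :=
  ⟨.nil, Nat.zero_le _⟩

theorem near_of_adj {x y : V} (h : G.Adj x y) : Near G 1 x y :=
  ⟨.cons h .nil, by simp⟩

theorem Near.symm {n : ℕ} {x y : V} (h : Near G n x y) : Near G n y x := by
  obtain ⟨p, hp⟩ := h
  exact ⟨p.reverse, by simpa using hp⟩

theorem Near.trans {m n : ℕ} {x y z : V} (h : Near G m x y) (h' : Near G n y z) :
    Near G (m + n) x z := by
  obtain ⟨p, hp⟩ := h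
  obtain ⟨p', hp'⟩ := h'
  exact ⟨p.append p', by rw [SimpleGraph.Walk.length_append]; omega⟩

theorem Near.mono {m n : ℕ} {x y : V} (h : Near G m x y) (hmn : m ≤ n) : Near G n x y := by
  obtain ⟨p, hp⟩ := h
  exact ⟨p, hp.trans hmn⟩

theorem Near.dist_le {n : ℕ} {x y : V} (h : Near G n x y) : G.dist x y ≤ n := by
  obtain ⟨p, hp⟩ := h
  exact (SimpleGraph.dist_le p).trans hp

/-- `G.dist` is 0 between vertices that are not connected, so the triangle inequality needs the walk
and not only a bound on the distance. -/
theorem Near.dist_le_add {n : ℕ} {x y : V} (h : Near G n x y) (z : V) :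
    G.dist x z ≤ G.dist y z + n := by
  have h1 : G.Reachable x y := by
    obtain ⟨p, -⟩ := h
    exact ⟨p⟩
  have h2 : G.dist x z ≤ G.dist x y + G.dist y z := h1.dist_triangle_left z
  have := h.dist_le
  omega

end Distance

/-! ### Oscillations of block averages. -/

section Blocks

variable {S : Type} {q : ℕ} {W : LocalWeights S q}

theorem abs_avg_sub_le (hW : W.IsLocal) {Λ : Finset S} {σ : S → Fin q}
    (hpos : 0 < W.partition Λ σ) {f : (S → Fin q) → ℝ} {M c : ℝ}
    (hM : ∀ τ, |f (glue Λ τ σ) - c| ≤ M) : |W.avg Λ f σ - c| ≤ M := by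
  classical
  have e : W.avg Λ f σ - c = W.avg Λ (fun σ => f σ - c) σ := by
    simp only [avg, mul_sub]
    rw [Finset.sum_sub_distrib, ← Finset.sum_mul]
    have h1 := sum_kernel hpos
    rw [show ∑ τ : Λ → Fin q, W.kernel Λ τ σ = 1 from h1 ▸ by congr!, one_mul]
  rw [e]
  exact abs_avg_le hW hpos hM

/-- A crude estimate for the oscillation of an average. -/
theorem abs_avg_sub_avg_le [NeZero q] (hW : W.IsLocal) (hpos : ∀ Λ σ, 0 < W.partition Λ σ)
    (Λ : Finset S) {f : (S → Fin q) → ℝ} {v : S → ℝ} (hf : OscBound f v) {y : S} (hy : y ∉ Λ)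
    {σ σ' : S → Fin q} (h : ∀ z, z ≠ y → σ z = σ' z) :
    |W.avg Λ f σ - W.avg Λ f σ'| ≤ v y + ∑ z ∈ Λ, v z := by
  classical
  -- Without any coupling, two arbitrary fillings of `Λ` are compared; the configurations differ
  -- only on `Λ` and at `y`.
  refine abs_avg_sub_le hW (hpos Λ σ) fun τ => ?_
  rw [abs_sub_comm]
  refine abs_avg_sub_le hW (hpos Λ σ') fun τ' => ?_
  rw [← Finset.sum_insert hy]
  refine hf.abs_sub_le_sum _ fun x hx => ?_
  rw [Finset.mem_insert, not_or] at hx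
  rw [glue_of_notMem _ _ hx.2, glue_of_notMem _ _ hx.2, h x hx.1]

/-- A site that shares no factor with the block does not influence its kernel. -/
theorem abs_avg_sub_avg_le_of_notMem (hW : W.IsLocal)
    (hpos : ∀ Λ σ, 0 < W.partition Λ σ)
    (Λ : Finset S) {f : (S → Fin q) → ℝ} {v : S → ℝ} (hf : OscBound f v) {y : S}
    (hy' : y ∉ W.closureOf Λ) {σ σ' : S → Fin q} (h : ∀ z, z ≠ y → σ z = σ' z) :
    |W.avg Λ f σ - W.avg Λ f σ'| ≤ v y := by
  classical
  -- The two kernels coincide, so the same filling of `Λ` can be used for both boundary conditions.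
  have e : W.avg Λ f σ - W.avg Λ f σ' =
      W.avg Λ (fun ρ => f ρ - f (glue Λ (fun x => ρ x) σ')) σ := by
    simp only [avg, mul_sub]
    rw [Finset.sum_sub_distrib]
    congr 1
    refine Finset.sum_congr rfl fun τ _ => ?_
    rw [hW.dependsOn_kernel Λ τ fun x hx => h x fun hxy => hy' (hxy ▸ hx.1)]
    congr 2
    funext x
    by_cases hx : x ∈ Λ
    · rw [glue_of_mem _ _ hx, glue_of_mem _ _ hx, glue_of_mem _ _ hx]
    · rw [glue_of_notMem _ _ hx, glue_of_notMem _ _ hx]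
  rw [e]
  refine abs_avg_le hW (hpos Λ σ) fun τ => hf y _ _ fun z hz => ?_
  by_cases hzΛ : z ∈ Λ
  · rw [glue_of_mem _ _ hzΛ, glue_of_mem _ _ hzΛ, glue_of_mem _ _ hzΛ]
  · rw [glue_of_notMem _ _ hzΛ, glue_of_notMem _ _ hzΛ, h z hz]

end Blocks

/-! ### From the Dobrushin condition of the decimated model to the Potts model. -/

namespace Decimable

variable {V ι : Type} {G : SimpleGraph V} {K : ι → Set V} {q : ℕ}

theorem glueRem_singleton [DecidableEq V] (x : Remaining K) (s : Fin q) (σ : V → Fin q) :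
    glueRem {x} (fun _ => s) σ = Function.update σ x s := by
  funext v
  by_cases hv : v = x
  · subst hv
    rw [glueRem, dif_pos ⟨x.2, Finset.mem_singleton_self x⟩]
    simp
  · rw [Function.update_of_ne hv, glueRem, dif_neg]
    rintro ⟨h1, h2⟩
    exact hv (congrArg Subtype.val (Finset.mem_singleton.1 h2))

theorem avg_block_singleton (h : Decimable G K) [DecidableEq V] (x : Remaining K)
    {f : (V → Fin q) → ℝ} (hf : DependsOn f (h.clusterSites {x} : Set V)ᶜ) (σ : V → Fin q) :
    (potts G q).avg (h.block {x}) f σ =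
      ∑ s, (decimated G K q).kernel {x} (fun _ => s) (fun x => σ x) *
        f (Function.update σ x s) := by
  classical
  rw [h.avg_block {x} hf]
  refine (sum_singleton_config _).trans ?_
  simp only [glueRem_singleton]

theorem clusterSites_subset_block (h : Decimable G K) (Λ : Finset (Remaining K)) :
    h.clusterSites Λ ⊆ h.block Λ := by
  classical
  exact Finset.subset_union_right

theorem mem_block_singleton (h : Decimable G K) {x : Remaining K} {z : V} :
    z ∈ h.block {x} ↔ z = x ∨ z ∈ h.clusterSites {x} := by
  classical
  rw [block, Finset.mem_union]
  refine or_congr_left ?_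
  simp [remEmb]

theorem notMem_clusterSites (h : Decimable G K) {Λ : Finset (Remaining K)} (x : Remaining K) :
    (x : V) ∉ h.clusterSites Λ := fun hx => by
  obtain ⟨i, -, hi⟩ := h.mem_clusterSites.1 hx
  exact x.2 i hi

/-- By separation, the sites adjacent to the clusters around `x` and outside them are remaining
sites, on a common plaquette with `x`. -/
theorem mem_closureOf_of_potts (h : Decimable G K) (q : ℕ) {x : Remaining K} {y : V}
    (hy : y ∈ (potts G q).closureOf (h.clusterSites {x})) (hy' : y ∉ h.clusterSites {x}) :
    ∃ hr : ∀ i, y ∉ K i, (⟨y, hr⟩ : Remaining K) ∈ (decimated G K q).closureOf {x} := by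
  obtain ⟨⟨e, he⟩, ⟨u, hue, hu⟩, hye⟩ := Set.mem_iUnion₂.1 hy
  have hue' : u ∈ e := hue
  have hye' : y ∈ e := hye
  have huy : u ≠ y := fun huy => hy' (huy ▸ hu)
  have hadj : G.Adj u y := by
    rw [(Sym2.mem_and_mem_iff huy).1 ⟨hue', hye'⟩] at he
    exact he
  obtain ⟨i, hi, hui⟩ := h.mem_clusterSites.1 hu
  have hr : ∀ j, y ∉ K j := by
    intro j hj
    rcases eq_or_ne i j with rfl | hij
    · exact hy' (h.mem_clusterSites.2 ⟨i, hi, hj⟩)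
    · exact (h.separated i j hij).2 u hui y hj hadj
  refine ⟨hr, Set.mem_iUnion₂.2 ⟨Sum.inl i, mem_touching_singleton.2 ?_, u, hui, hadj⟩⟩
  obtain ⟨x', hx', hb⟩ := h.mem_clusters.1 hi
  rw [Finset.mem_singleton] at hx'
  exact hx' ▸ hb

open Classical in
/-- Updates of a remaining site together with the clusters around it. -/
def blocks (h : Decimable G K) (q : ℕ) : BlockData V (Remaining K) where
  B x := h.block {x}
  N x := (((h.isLocal q).finite_closureOf {x}).toFinset.erase x).map (remEmb K)
  C x z y := (if hy : ∀ i, y ∉ K i then ((decimated G K q).interdep x ⟨y, hy⟩).toReal else 0) +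
    if z ∈ h.clusterSites {x} then 1 else 0
  C_nonneg x z y := by
    refine add_nonneg ?_ ?_ <;> split_ifs <;> first | exact ENNReal.toReal_nonneg | norm_num

theorem sum_block_singleton (h : Decimable G K) (x : Remaining K) (g : V → ℝ) :
    ∑ z ∈ h.block {x}, g z = g x + ∑ z ∈ h.clusterSites {x}, g z := by
  classical
  have e : h.block {x} = insert (x : V) (h.clusterSites {x}) := by
    ext z
    rw [h.mem_block_singleton, Finset.mem_insert]
  rw [e, Finset.sum_insert (h.notMem_clusterSites x)]

theorem mem_blocks_N (h : Decimable G K) {x : Remaining K} {y : V} :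
    y ∈ (h.blocks q).N x ↔ ∃ hr : ∀ i, y ∉ K i, (⟨y, hr⟩ : Remaining K) ≠ x ∧
      (⟨y, hr⟩ : Remaining K) ∈ (decimated G K q).closureOf {x} := by
  classical
  constructor
  · intro hy
    obtain ⟨y', hy', rfl⟩ := Finset.mem_map.1 hy
    obtain ⟨h1, h2⟩ := Finset.mem_erase.1 hy'
    exact ⟨y'.2, h1, (Set.Finite.mem_toFinset _).1 h2⟩
  · rintro ⟨hr, h1, h2⟩
    exact Finset.mem_map.2 ⟨⟨y, hr⟩, Finset.mem_erase.2 ⟨h1, (Set.Finite.mem_toFinset _).2 h2⟩, rfl⟩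

/-- The update is done in two stages: the clusters around `x` are averaged with everything else
fixed, and the result is averaged with the decimated kernel at `x`. With `T` the total oscillation
on these clusters, the first stage leaves an oscillation of at most `v x + T` at `x` and `v y + T`
at `y`. The second yields `v y + T + c (v x + T)`, where `c` is the influence of `y` on `x`. Hence
the constant in `blocks` is `c` for `x` and `c + 1` for a cluster site. -/
theorem oscBound_avg_block [NeZero q] (h : Decimable G K)
    (hP : ∀ Λ σ, 0 < (potts G q).partition Λ σ)
    (hD : ∀ x σ, 0 < (decimated G K q).partition {x} σ) (x : Remaining K) {f : (V → Fin q) → ℝ}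
    {v : V → ℝ} (hfv : OscBound f v) :
    OscBound ((potts G q).avg (h.block {x}) f) ((h.blocks q).fire x v) := by
  classical
  intro y σ σ' hσ
  have hloc := isLocal_potts h.finite_adj q
  have hv := hfv.nonneg
  set U := h.clusterSites {x} with hU
  by_cases hyB : y ∈ h.block {x}
  · have e : (potts G q).avg (h.block {x}) f σ = (potts G q).avg (h.block {x}) f σ' :=
      hloc.dependsOn_avg _ f fun z hz => hσ z fun hzy => hz (hzy ▸ hyB)
    rw [e]
    simp [BlockData.fire, blocks, hyB]
  have hyx : y ≠ x := fun e => hyB (h.mem_block_singleton.2 (Or.inl e))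
  have hyU : y ∉ U := fun e => hyB (h.mem_block_singleton.2 (Or.inr e))
  set T := ∑ z ∈ U, v z with hT
  have hT0 : 0 ≤ T := Finset.sum_nonneg fun z _ => hv z
  set f₁ := (potts G q).avg U f with hf₁
  have hdep : DependsOn f₁ (U : Set V)ᶜ := hloc.dependsOn_avg U f
  rw [← hloc.avg_avg (h.clusterSites_subset_block {x}) (hP _) f,
    ← hloc.avg_avg (h.clusterSites_subset_block {x}) (hP _) f, h.avg_block_singleton x hdep,
    h.avg_block_singleton x hdep]
  have ha : ∀ s t, |f₁ (Function.update σ x s) - f₁ (Function.update σ x t)| ≤ v x + T :=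
    fun s t => abs_avg_sub_avg_le hloc hP U hfv (h.notMem_clusterSites x) fun z hz => by
      rw [Function.update_of_ne hz, Function.update_of_ne hz]
  have hup : ∀ s, ∀ z, z ≠ y → Function.update σ (x : V) s z = Function.update σ' (x : V) s z := by
    intro s z hz
    by_cases hzx : z = x
    · subst hzx; simp
    · rw [Function.update_of_ne hzx, Function.update_of_ne hzx, hσ z hz]
  by_cases hyN : y ∈ (h.blocks q).N x
  · obtain ⟨hr, -, -⟩ := h.mem_blocks_N.1 hyN
    have hb : ∀ s, |f₁ (Function.update σ x s) - f₁ (Function.update σ' x s)| ≤ v y + T :=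
      fun s => abs_avg_sub_avg_le hloc hP U hfv hyU (hup s)
    have key := (h.isLocal q).abs_sum_kernel_mul_sub_le hD (x := x) (y := ⟨y, hr⟩)
      (σ := fun x => σ x) (σ' := fun x => σ' x)
      (fun z hz => hσ z fun e => hz (Subtype.ext e)) ha hb
    refine key.trans (le_of_eq ?_)
    have hB : (h.blocks q).B x = h.block {x} := rfl
    rw [BlockData.fire, if_neg (show y ∉ (h.blocks q).B x from hyB), if_pos hyN, hB, h.sum_block_singleton]
    have e1 : ∀ z ∈ h.clusterSites {x}, v z * (h.blocks q).C x z y =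
        v z * (((decimated G K q).interdep x ⟨y, hr⟩).toReal + 1) := fun z hz => by
      simp only [blocks]
      rw [dif_pos hr, if_pos hz]
    have e2 : (h.blocks q).C x x y = ((decimated G K q).interdep x ⟨y, hr⟩).toReal := by
      simp only [blocks]
      rw [dif_pos hr, if_neg (h.notMem_clusterSites x), add_zero]
    rw [Finset.sum_congr rfl e1, e2, ← Finset.sum_mul]
    ring
  -- A site outside `N` affects neither the cluster average nor the decimated kernel, so only its
  -- direct oscillation remains.
  · have hycl : y ∉ (potts G q).closureOf U := fun hcl => by
      obtain ⟨hr, hr'⟩ := h.mem_closureOf_of_potts q hcl hyU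
      exact hyN (h.mem_blocks_N.2 ⟨hr, fun e => hyx (congrArg Subtype.val e), hr'⟩)
    have hb : ∀ s, |f₁ (Function.update σ x s) - f₁ (Function.update σ' x s)| ≤ v y :=
      fun s => abs_avg_sub_avg_le_of_notMem hloc hP U hfv hycl (hup s)
    have hk : ∀ s : Fin q, (decimated G K q).kernel {x} (fun _ => s) (fun x => σ x) =
        (decimated G K q).kernel {x} (fun _ => s) fun x => σ' x := by
      refine fun s => (h.isLocal q).dependsOn_kernel _ _ fun z hz => hσ z ?_
      rintro rfl
      exact hyN (h.mem_blocks_N.2 ⟨z.2, fun e => hyx (congrArg Subtype.val e), hz.1⟩)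
    have key := abs_sum_mul_sub_sum_mul_le (c := 0)
      (fun s => (h.isLocal q).kernel_nonneg {x} (fun _ => s) fun x => σ' x)
      (sum_kernel_singleton (hD x fun x => σ x)) (sum_kernel_singleton (hD x fun x => σ' x))
      (fun A => by simp [hk]) ha hb
    refine key.trans (le_of_eq ?_)
    rw [BlockData.fire, if_neg (show y ∉ (h.blocks q).B x from hyB), if_neg hyN]
    ring

theorem near_of_mem_supp (hcl : ∀ i, G.IsClique (K i)) {q : ℕ}
    {A : (decimated G K q).Index} {x y : Remaining K} (hx : x ∈ (decimated G K q).supp A)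
    (hy : y ∈ (decimated G K q).supp A) : Near G 3 x y := by
  rcases A with i | e
  · obtain ⟨u, hu, hux⟩ := hx
    obtain ⟨u', hu', huy⟩ := hy
    have hm : Near G 1 u u' := by
      by_cases huu : u = u'
      · subst huu; exact Near.refl _ _ _
      · exact near_of_adj (hcl i hu hu' huu)
    exact ((near_of_adj hux.symm).trans hm).trans (near_of_adj huy)
  · have hx' : x ∈ (e : Sym2 (Remaining K)) := hx
    have hy' : y ∈ (e : Sym2 (Remaining K)) := hy
    by_cases hxy : x = y
    · subst hxy; exact Near.refl _ _ _
    · have he := e.2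
      rw [(Sym2.mem_and_mem_iff hxy).1 ⟨hx', hy'⟩] at he
      exact (near_of_adj (show G.Adj x y from he)).mono (by norm_num)

theorem near_of_mem_block (h : Decimable G K) (hcl : ∀ i, G.IsClique (K i)) {x : Remaining K}
    {z : V} (hz : z ∈ h.block {x}) : Near G 2 x z := by
  rcases h.mem_block_singleton.1 hz with rfl | hz
  · exact Near.refl _ _ _
  · obtain ⟨i, hi, hzi⟩ := h.mem_clusterSites.1 hz
    obtain ⟨x', hx', u, hu, hux⟩ := h.mem_clusters.1 hi
    rw [Finset.mem_singleton] at hx'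
    subst hx'
    by_cases huz : u = z
    · subst huz; exact (near_of_adj hux.symm).mono (by norm_num)
    · exact (near_of_adj hux.symm).trans (near_of_adj (hcl i hu hzi huz))

/-- If the decimated model satisfies the Dobrushin condition, then it has a unique Gibbs measure,
with exponential decay of correlations. -/
theorem uniqueWithDecay_decimated [Countable V] [NeZero q] (h : Decimable G K)
    (hcl : ∀ i, G.IsClique (K i)) (hD : ∀ x σ, 0 < (decimated G K q).partition {x} σ)
    (hdob : (decimated G K q).dobrushin < 1) :
    UniqueWithDecay (fun x y : Remaining K => G.dist x y) (decimated G K q) :=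
  (h.isLocal q).uniqueWithDecay_of_dobrushin_lt_one hD hdob _ 3
    (fun _ _ hx _ hy z => (near_of_mem_supp hcl hx hy).dist_le_add z)
    fun _ => SimpleGraph.dist_self

/-- If the decimated model satisfies the Dobrushin condition, then the Potts model has a unique
Gibbs measure, with exponential decay of correlations. -/
theorem uniqueWithDecay_potts [Countable V] [NeZero q] (h : Decimable G K)
    (hcl : ∀ i, G.IsClique (K i)) (hP : ∀ x σ, 0 < (potts G q).partition {x} σ)
    (hD : ∀ x σ, 0 < (decimated G K q).partition {x} σ)
    (hdob : (decimated G K q).dobrushin < 1) (hcov : ∀ i, ∃ x, Borders G K i x) {n : ℕ}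
    (hn : ∀ x, ((decimated G K q).closureOf {x}).ncard ≤ n) :
    UniqueWithDecay G.dist (potts G q) := by
  classical
  have hloc := isLocal_potts h.finite_adj q
  have hP' := hloc.partition_pos hP
  set β₀ := (decimated G K q).dobrushin.toReal
  have hβ₀ : β₀ < 1 :=
    (ENNReal.toReal_lt_toReal (hdob.trans ENNReal.one_lt_top).ne ENNReal.one_ne_top).2 hdob
  have hN : ∀ x, ((h.blocks q).N x).card ≤ n := fun x => by
    refine le_trans ?_ (hn x)
    rw [Set.ncard_eq_toFinset_card _ ((h.isLocal q).finite_closureOf {x})]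
    simp only [blocks, Finset.card_map]
    exact Finset.card_le_card (Finset.erase_subset _ _)
  -- A cluster site passes on at most `∑ (c + 1) ≤ β₀ + n ≤ n + 1`, and only to remaining sites,
  -- which have weight 1. The weight `2 * (n + 1)` makes this at most one half of what was there,
  -- which explains `max β₀ (1 / 2)` below.
  set w : V → ℝ := fun y => if ∀ i, y ∉ K i then 1 else 2 * (n + 1) with hw
  have hn0 : (0 : ℝ) ≤ n := Nat.cast_nonneg n
  have hwN : ∀ x, ∀ y ∈ (h.blocks q).N x, w y = 1 := fun x y hy => by
    obtain ⟨hr, -, -⟩ := h.mem_blocks_N.1 hy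
    simp only [hw, if_pos hr]
  have hwU : ∀ x : Remaining K, ∀ z ∈ h.clusterSites {x}, w z = 2 * (n + 1) := fun x z hz => by
    obtain ⟨i, -, hi⟩ := h.mem_clusterSites.1 hz
    simp only [hw]
    rw [if_neg fun hr => hr i hi]
  have hsum : ∀ x, ∑ y ∈ (h.blocks q).N x, (h.blocks q).C x x y ≤ β₀ := by
    intro x
    have := (h.isLocal q).sum_toReal_interdep_le hdob x
      (((h.isLocal q).finite_closureOf {x}).toFinset.erase x) (Finset.notMem_erase x _)
    refine le_trans (le_of_eq ?_) this
    simp only [blocks]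
    rw [Finset.sum_map]
    refine Finset.sum_congr rfl fun y _ => ?_
    rw [dif_pos (show ∀ i, remEmb K y ∉ K i from y.2), if_neg (h.notMem_clusterSites x), add_zero]
    rfl
  have hCz : ∀ x, ∀ z ∈ h.clusterSites {x}, ∀ y,
      (h.blocks q).C x z y = (h.blocks q).C x x y + 1 := fun x z hz y => by
    simp only [blocks]
    rw [if_pos hz, if_neg (h.notMem_clusterSites x), add_zero]
  -- The range 5 comes from at most 2 steps from a block site to its centre and at most 3 from there
  -- to a site sharing a factor.
  refine uniqueWithDecay_of_blocks hloc hP' (h.blocks q) ?_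
    (fun x f v _ hfv => h.oscBound_avg_block hP' hD x hfv) (w := w) (wmin := 1)
    (wmax := 2 * (n + 1)) (β := max β₀ (1 / 2)) one_pos ?_ ?_ (by positivity)
    (max_lt hβ₀ (by norm_num)) ?_ G.dist 5 ?_ ?_
  · intro y
    by_cases hy : ∀ i, y ∉ K i
    · exact ⟨⟨y, hy⟩, h.mem_block_singleton.2 (Or.inl rfl)⟩
    · push Not at hy
      obtain ⟨i, hi⟩ := hy
      obtain ⟨x, hx⟩ := hcov i
      exact ⟨x, h.mem_block_singleton.2 (Or.inr (h.mem_clusterSites.2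
        ⟨i, h.mem_clusters.2 ⟨x, Finset.mem_singleton_self x, hx⟩, hi⟩))⟩
  · intro y
    simp only [hw]
    split_ifs
    · exact le_rfl
    · linarith
  · intro y
    simp only [hw]
    split_ifs
    · linarith
    · exact le_rfl
  · intro x z hz
    have e : ∑ y ∈ (h.blocks q).N x, (h.blocks q).C x z y * w y =
        ∑ y ∈ (h.blocks q).N x, (h.blocks q).C x z y :=
      Finset.sum_congr rfl fun y hy => by rw [hwN x y hy, mul_one]
    rw [e]
    rcases h.mem_block_singleton.1 hz with rfl | hz
    · refine (hsum x).trans ?_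
      have : w x = 1 := by simp only [hw]; rw [if_pos x.2]
      rw [this, mul_one]
      exact le_max_left _ _
    · rw [hwU x z hz]
      simp only [hCz x z hz]
      rw [Finset.sum_add_distrib]
      have h1 := hsum x
      have h2 : ∑ y ∈ (h.blocks q).N x, (1 : ℝ) ≤ n := by
        rw [Finset.sum_const, nsmul_eq_mul, mul_one]
        exact_mod_cast hN x
      have h3 : (1 / 2 : ℝ) * (2 * (n + 1)) ≤ max β₀ (1 / 2) * (2 * (n + 1)) :=
        mul_le_mul_of_nonneg_right (le_max_right _ _) (by positivity)
      linarith
  · intro x z hz y hy w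
    obtain ⟨hr, -, hy⟩ := h.mem_blocks_N.1 hy
    obtain ⟨A, hA, hyA⟩ := Set.mem_iUnion₂.1 hy
    have := near_of_mem_supp hcl (mem_touching_singleton.1 hA) hyA
    exact ((h.near_of_mem_block hcl hz).symm.trans this).dist_le_add w
  · intro x z hz y hy
    exact (((h.near_of_mem_block hcl hz).symm.trans (h.near_of_mem_block hcl hy)).mono
      (by norm_num)).dist_le

end Decimable

end

end KagomePotts

namespace KagomePotts

noncomputable section

open Filter Topology LocalWeights

/-! ### Total variation distance of normalized weights. -/

section Normalized

variable {q : ℕ}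

/-- The probability of `A` under the normalized weights `w`. -/
def normProb (w : Fin q → ℝ) (A : Finset (Fin q)) : ℝ :=
  (∑ s ∈ A, w s) / ∑ s, w s

theorem normProb_compl {w : Fin q → ℝ} (hZ : 0 < ∑ s, w s) (A : Finset (Fin q)) :
    normProb w Aᶜ = 1 - normProb w A := by
  rw [normProb, normProb, eq_sub_iff_add_eq, ← add_div, Finset.sum_compl_add_sum,
    div_self hZ.ne']

/-- If `c` is at most the ratio of the partition functions, then `c w'(A)` divided by that of `w` is
at most the probability of `A` under `w'`. What remains is bounded by the positive part of `w - c
w'`. -/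
theorem normProb_sub_le {w w' : Fin q → ℝ} (hw' : ∀ s, 0 ≤ w' s) (hZ : 0 < ∑ s, w s)
    (hZ' : 0 < ∑ s, w' s) {c t : ℝ} (hc : c * ∑ s, w' s ≤ ∑ s, w s)
    (h : ∑ s, max (w s - c * w' s) 0 ≤ t * ∑ s, w s) (A : Finset (Fin q)) :
    normProb w A - normProb w' A ≤ t := by
  have h0 : 0 ≤ ∑ s ∈ A, w' s := Finset.sum_nonneg fun s _ => hw' s
  have h1 : c * (∑ s ∈ A, w' s) / ∑ s, w s ≤ normProb w' A := by
    rw [normProb, div_le_div_iff₀ hZ hZ']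
    nlinarith
  have h2 : normProb w A - c * (∑ s ∈ A, w' s) / ∑ s, w s ≤ t := by
    rw [normProb, ← sub_div, div_le_iff₀ hZ, Finset.mul_sum, ← Finset.sum_sub_distrib]
    refine le_trans (Finset.sum_le_sum fun s _ => le_max_left _ 0) (le_trans ?_ h)
    exact Finset.sum_le_sum_of_subset_of_nonneg (Finset.subset_univ A)
      fun _ _ _ => le_max_right _ _
  linarith

theorem abs_normProb_sub_le_of_le {w w' : Fin q → ℝ} (hw' : ∀ s, 0 ≤ w' s)
    (hZ : 0 < ∑ s, w s) (hZ' : 0 < ∑ s, w' s) {c t : ℝ} (hc : c * ∑ s, w' s ≤ ∑ s, w s)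
    (h : ∑ s, max (w s - c * w' s) 0 ≤ t * ∑ s, w s) (A : Finset (Fin q)) :
    |normProb w A - normProb w' A| ≤ t := by
  rw [abs_le]
  constructor
  · have := normProb_sub_le hw' hZ hZ' hc h Aᶜ
    rw [normProb_compl hZ, normProb_compl hZ'] at this
    linarith
  · exact normProb_sub_le hw' hZ hZ' hc h A

/-- A bound on the total variation distance of two normalized weights, by means of an arbitrary
relative normalization `c`. -/
theorem abs_normProb_sub_le {w w' : Fin q → ℝ} (hw : ∀ s, 0 ≤ w s) (hw' : ∀ s, 0 ≤ w' s)
    (hZ : 0 < ∑ s, w s) (hZ' : 0 < ∑ s, w' s) {c t : ℝ} (hc : 0 < c)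
    (h : ∑ s, max (w s - c * w' s) 0 ≤ t * ∑ s, w s)
    (h' : ∑ s, max (c * w' s - w s) 0 ≤ t * (c * ∑ s, w' s)) (A : Finset (Fin q)) :
    |normProb w A - normProb w' A| ≤ t := by
  -- One of the two hypotheses suffices, depending on which side of `c` the ratio of the partition
  -- functions lies. This allows a convenient `c` that is independent of the partition functions.
  rcases le_total (c * ∑ s, w' s) (∑ s, w s) with hle | hle
  · exact abs_normProb_sub_le_of_le hw' hZ hZ' hle h A
  · rw [abs_sub_comm]
    refine abs_normProb_sub_le_of_le (c := c⁻¹) hw hZ' hZ ?_ ?_ A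
    · rwa [inv_mul_le_iff₀ hc]
    · have e : ∀ s, max (w' s - c⁻¹ * w s) 0 = c⁻¹ * max (c * w' s - w s) 0 := fun s => by
        rw [mul_max_of_nonneg _ _ (inv_nonneg.2 hc.le), mul_zero]
        congr 1
        field_simp
      simp only [e]
      rw [← Finset.mul_sum, inv_mul_le_iff₀ hc]
      linarith

end Normalized

/-! ### Influences computed from explicit weights on finitely many neighbours. -/

section Chart

variable {S : Type} {q k : ℕ} {W : LocalWeights S q}

/-- The site `x` interacts with the sites `nb`, and `wt` gives its Boltzmann weights. -/
structure LocalChart (W : LocalWeights S q) (wt : (Fin k → Fin q) → Fin q → ℝ) (x : S)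
    (nb : Fin k → S) : Prop where
  injective : Function.Injective nb
  ne : ∀ j, nb j ≠ x
  eq : ∀ [DecidableEq S] ρ s, W.boltzmann {x} (Function.update ρ x s) = wt (ρ ∘ nb) s

/-- The influence of the `j`-th argument on the normalized weights. -/
def influence (wt : (Fin k → Fin q) → Fin q → ℝ) (j : Fin k) : ℝ≥0∞ :=
  ⨆ (t : Fin k → Fin q) (t' : Fin k → Fin q) (_ : ∀ i, i ≠ j → t i = t' i)
    (A : Finset (Fin q)), ENNReal.ofReal |normProb (wt t) A - normProb (wt t') A|

theorem le_influence (wt : (Fin k → Fin q) → Fin q → ℝ) {j : Fin k} {t t' : Fin k → Fin q}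
    (h : ∀ i, i ≠ j → t i = t' i) (A : Finset (Fin q)) :
    ENNReal.ofReal |normProb (wt t) A - normProb (wt t') A| ≤ influence wt j :=
  le_iSup_of_le t (le_iSup_of_le t' (le_iSup_of_le h (le_iSup_of_le A le_rfl)))

theorem influence_le {wt : (Fin k → Fin q) → Fin q → ℝ} {j : Fin k} {c : ℝ}
    (h : ∀ t t' : Fin k → Fin q, (∀ i, i ≠ j → t i = t' i) → ∀ A,
      |normProb (wt t) A - normProb (wt t') A| ≤ c) : influence wt j ≤ ENNReal.ofReal c :=
  iSup_le fun t => iSup_le fun t' => iSup_le fun ht => iSup_le fun A =>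
    ENNReal.ofReal_le_ofReal (h t t' ht A)

/-- A permutation of the arguments under which the weights are invariant carries admissible pairs
for one argument to admissible pairs for another; the inverse gives the reverse inequality. -/
theorem influence_symm {wt : (Fin k → Fin q) → Fin q → ℝ} (π : Equiv.Perm (Fin k))
    (h : ∀ t, wt (t ∘ π) = wt t) (j : Fin k) : influence wt (π j) = influence wt j := by
  have key : ∀ (π : Equiv.Perm (Fin k)), (∀ t, wt (t ∘ π) = wt t) → ∀ j,
      influence wt (π j) ≤ influence wt j := by
    intro π h j
    refine iSup_le fun t => iSup_le fun t' => iSup_le fun ht => iSup_le fun A => ?_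
    rw [← h t, ← h t']
    exact le_influence wt (fun i hi => ht _ fun e => hi (π.injective e)) A
  refine le_antisymm (key π h j) ?_
  have := key π⁻¹ (fun t => by
    rw [← h (t ∘ (π⁻¹ : Equiv.Perm (Fin k)))]
    congr 1
    funext i
    simp) (π j)
  simpa using this

theorem siteProb_eq [DecidableEq S] (W : LocalWeights S q) (x : S) (A : Finset (Fin q))
    (ρ : S → Fin q) :
    W.siteProb x A ρ = normProb (fun s => W.boltzmann {x} (Function.update ρ x s)) A := by
  classical
  have hZ : W.partition {x} ρ = ∑ s, W.boltzmann {x} (Function.update ρ x s) := by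
    rw [partition]
    refine (Finset.sum_congr (by congr!) fun _ _ => rfl).trans
      ((sum_singleton_config _).trans ?_)
    simp only [glue_singleton]
  rw [siteProb, normProb, ← hZ, Finset.sum_div]
  simp only [kernel, glue_singleton]

namespace LocalChart

variable {wt : (Fin k → Fin q) → Fin q → ℝ} {x : S} {nb : Fin k → S}

theorem partition_eq (h : LocalChart W wt x nb) (ρ : S → Fin q) :
    W.partition {x} ρ = ∑ s, wt (ρ ∘ nb) s := by
  classical
  rw [partition]
  refine (Finset.sum_congr (by congr!) fun _ _ => rfl).trans ((sum_singleton_config _).trans ?_)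
  simp only [glue_singleton, h.eq]

theorem siteProb_eq (h : LocalChart W wt x nb) (A : Finset (Fin q)) (ρ : S → Fin q) :
    W.siteProb x A ρ = normProb (wt (ρ ∘ nb)) A := by
  classical
  rw [KagomePotts.siteProb_eq]
  simp only [h.eq]

theorem interdep_eq [NeZero q] (h : LocalChart W wt x nb) (j : Fin k) :
    W.interdep x (nb j) = influence wt j := by
  refine le_antisymm ?_ ?_
  · refine interdep_le fun σ σ' hσ A => ?_
    rw [h.siteProb_eq, h.siteProb_eq]
    exact le_influence wt (fun i hi => hσ _ fun e => hi (h.injective e)) A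
  · refine iSup_le fun t => iSup_le fun t' => iSup_le fun ht => iSup_le fun A => ?_
    -- Injectivity of `nb` allows every assignment of neighbour spins to be extended to the lattice,
    -- here by the spin 0, so the two suprema agree.
    have hext : ∀ t : Fin k → Fin q, Function.extend nb t (fun _ => 0) ∘ nb = t := fun t =>
      funext fun i => h.injective.extend_apply _ _ _
    have := W.le_interdep (x := x) (y := nb j) (σ := Function.extend nb t fun _ => 0)
      (σ' := Function.extend nb t' fun _ => 0) (fun z hz => by
        by_cases hr : ∃ i, nb i = z
        · obtain ⟨i, rfl⟩ := hr
          rw [h.injective.extend_apply, h.injective.extend_apply]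
          exact ht i fun e => hz (e ▸ rfl)
        · rw [Function.extend_apply' _ _ _ hr, Function.extend_apply' _ _ _ hr]) A
    rwa [h.siteProb_eq, h.siteProb_eq, hext, hext] at this

theorem interdep_eq_zero (h : LocalChart W wt x nb) {y : S} (hy : ∀ j, nb j ≠ y) :
    W.interdep x y = 0 := by
  refine le_antisymm (interdep_le fun σ σ' hσ A => ?_) zero_le
  have : σ ∘ nb = σ' ∘ nb := funext fun j => hσ _ (hy j)
  rw [h.siteProb_eq, h.siteProb_eq, this]
  simp

theorem tsum_interdep [NeZero q] (h : LocalChart W wt x nb) :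
    ∑' y : {y : S // y ≠ x}, W.interdep x y = ∑ j, influence wt j := by
  have hinj : Function.Injective fun j => (⟨nb j, h.ne j⟩ : {y : S // y ≠ x}) := fun i j e =>
    h.injective (congrArg Subtype.val e)
  rw [← hinj.tsum_eq, tsum_fintype]
  · exact Finset.sum_congr rfl fun j _ => h.interdep_eq j
  · intro y hy
    by_contra hr
    refine hy (h.interdep_eq_zero fun j hj => hr ⟨j, Subtype.ext hj⟩)

end LocalChart

theorem dobrushin_eq [NeZero q] [Nonempty S] {wt : (Fin k → Fin q) → Fin q → ℝ}
    (h : ∀ x, ∃ nb, LocalChart W wt x nb) : W.dobrushin = ∑ j, influence wt j := by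
  have : ∀ x, ∑' y : {y : S // y ≠ x}, W.interdep x y = ∑ j, influence wt j := fun x => by
    obtain ⟨nb, hnb⟩ := h x
    exact hnb.tsum_interdep
  rw [dobrushin]
  simp only [this]
  exact ciSup_const

end Chart

/-- Both decimations have this local structure: a site lies on two plaquettes and has two surviving
links. -/
theorem Decimable.boltzmann_singleton {V ι : Type} {G : SimpleGraph V} {K : ι → Set V} {q : ℕ}
    (h : Decimable G K) {x y z : Remaining K} {i₁ i₂ : ι} (hi : i₁ ≠ i₂)
    (hb : ∀ i, Borders G K i x ↔ i = i₁ ∨ i = i₂)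
    (hl : ∀ y', (linkGraph G K).Adj x y' ↔ y' = y ∨ y' = z) (ρ : Remaining K → Fin q) :
    (decimated G K q).boltzmann {x} ρ =
      if ρ x ≠ ρ y ∧ ρ x ≠ ρ z then
        ((clusterWeight G K i₁ ρ : ℝ) * clusterWeight G K i₂ ρ) else 0 := by
  classical
  have e : h.clusters {x} = {i₁, i₂} := by
    ext i
    simp [h.mem_clusters, hb]
  have e' : (∀ x' y', (linkGraph G K).Adj x' y' → x' ∈ ({x} : Finset (Remaining K)) →
      ρ x' ≠ ρ y') ↔ ρ x ≠ ρ y ∧ ρ x ≠ ρ z := by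
    constructor
    · intro H
      exact ⟨H x y ((hl y).2 (Or.inl rfl)) (Finset.mem_singleton_self x),
        H x z ((hl z).2 (Or.inr rfl)) (Finset.mem_singleton_self x)⟩
    · rintro ⟨H1, H2⟩ x' y' hadj hx'
      rw [Finset.mem_singleton] at hx'
      subst hx'
      rcases (hl y').1 hadj with rfl | rfl
      · exact H1
      · exact H2
  rw [h.boltzmann_decimated, e, Finset.prod_pair hi, if_congr e' rfl rfl]
  split_ifs <;> simp

end

end KagomePotts

namespace KagomePotts

noncomputable section

open Filter Topology LocalWeights

/-! ### Local structure of the Kagomé lattice. -/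

section KagomeGeometry

theorem finite_adj_kagome (v : KagomeSite) : {u | kagome.Adj v u}.Finite := by
  refine Set.Finite.of_finite_image (f := Subtype.val) ?_ Subtype.val_injective.injOn
  refine ((Set.finite_Icc (v.1.1 - 1) (v.1.1 + 1)).prod
    (Set.finite_Icc (v.1.2 - 1) (v.1.2 + 1))).subset ?_
  rintro _ ⟨u, hu, rfl⟩
  have hu' : triangular.Adj v.1 u.1 := hu
  simp only [triangular] at hu'
  simp only [Set.mem_prod, Set.mem_Icc]
  omega

theorem kagome_adj {a b c d : ℤ} {h h'} :
    kagome.Adj (⟨(a, b), h⟩ : KagomeSite) ⟨(c, d), h'⟩ ↔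
      (c - a = 1 ∧ d - b = 0) ∨ (c - a = -1 ∧ d - b = 0) ∨ (c - a = 0 ∧ d - b = 1) ∨
        (c - a = 0 ∧ d - b = -1) ∨ (c - a = 1 ∧ d - b = -1) ∨ (c - a = -1 ∧ d - b = 1) :=
  Iff.rfl

end KagomeGeometry

/-! ### Geometry of the single-site decimation. -/

section SiteGeometry

/-- The remaining site with coordinates `(m, 2n)`. -/
def siteRem (m n : ℤ) : Remaining topVertex :=
  ⟨⟨(m, 2 * n), by simp⟩, fun i h => by
    have : 2 * n = 2 * i.2 + 1 := congrArg Prod.snd h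
    omega⟩

theorem siteRem_inj {m n m' n' : ℤ} : siteRem m n = siteRem m' n' ↔ m = m' ∧ n = n' := by
  constructor
  · intro h
    have : (m, 2 * n) = (m', 2 * n') := congrArg (fun x : Remaining topVertex => x.1.1) h
    rw [Prod.mk.injEq] at this
    omega
  · rintro ⟨rfl, rfl⟩; rfl

theorem exists_siteRem (x : Remaining topVertex) : ∃ m n, x = siteRem m n := by
  obtain ⟨⟨⟨a, b⟩, h⟩, hx⟩ := x
  rcases Int.even_or_odd' b with ⟨n, rfl | rfl⟩
  · exact ⟨a, n, rfl⟩
  · rcases Int.even_or_odd' a with ⟨m, rfl | rfl⟩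
    · exact absurd rfl (hx (m, n))
    · exact absurd ⟨⟨m, rfl⟩, ⟨n, rfl⟩⟩ h

theorem siteNN_iff {m n m' n' : ℤ} :
    SiteNN (siteRem m n) (siteRem m' n') ↔ n = n' ∧ (m' = m - 1 ∨ m' = m + 1) := by
  change kagome.Adj (⟨(m, 2 * n), _⟩ : KagomeSite) ⟨(m', 2 * n'), _⟩ ↔ _
  rw [kagome_adj]
  omega

theorem borders_topVertex {i : ℤ × ℤ} {m n : ℤ} :
    Borders kagome topVertex i (siteRem m n) ↔
      (n = i.2 ∧ (m = 2 * i.1 ∨ m = 2 * i.1 + 1)) ∨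
        (n = i.2 + 1 ∧ (m = 2 * i.1 ∨ m = 2 * i.1 - 1)) := by
  obtain ⟨i, j⟩ := i
  constructor
  · rintro ⟨⟨⟨a, b⟩, h⟩, hu, hadj⟩
    have hu' : (a, b) = (2 * i, 2 * j + 1) := hu
    rw [Prod.mk.injEq] at hu'
    have := kagome_adj.1 (show kagome.Adj (⟨(a, b), h⟩ : KagomeSite) ⟨(m, 2 * n), _⟩ from hadj)
    omega
  · intro h
    refine ⟨⟨(2 * i, 2 * j + 1), by simp⟩, rfl, ?_⟩
    change kagome.Adj (⟨(2 * i, 2 * j + 1), _⟩ : KagomeSite) ⟨(m, 2 * n), _⟩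
    rw [kagome_adj]
    omega

theorem ncard_topVertex (i : ℤ × ℤ) : (topVertex i).ncard = 1 := by
  rw [Set.ncard_eq_one]
  refine ⟨⟨(2 * i.1, 2 * i.2 + 1), by simp⟩, ?_⟩
  ext v
  simp [topVertex, Subtype.ext_iff]

theorem isClique_topVertex (i : ℤ × ℤ) : kagome.IsClique (topVertex i) := by
  intro u hu v hv huv
  exact absurd (Subtype.ext ((show u.1 = _ from hu).trans (show v.1 = _ from hv).symm)) huv

theorem separated_topVertex : SeparatedClusters kagome topVertex := by
  rintro ⟨i, j⟩ ⟨i', j'⟩ hij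
  rw [ne_eq, Prod.mk.injEq] at hij
  constructor
  · rw [Set.disjoint_left]
    rintro ⟨⟨a, b⟩, h⟩ hu hu'
    have h1 : (a, b) = (2 * i, 2 * j + 1) := hu
    have h2 : (a, b) = (2 * i', 2 * j' + 1) := hu'
    rw [Prod.mk.injEq] at h1 h2
    omega
  · rintro ⟨⟨a, b⟩, h⟩ hu ⟨⟨a', b'⟩, h'⟩ hu' hadj
    have h1 : (a, b) = (2 * i, 2 * j + 1) := hu
    have h2 : (a', b') = (2 * i', 2 * j' + 1) := hu'
    rw [Prod.mk.injEq] at h1 h2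
    have := kagome_adj.1 hadj
    omega

theorem decimable_topVertex : Decimable kagome topVertex where
  finite_adj := finite_adj_kagome
  finite_cluster i := Set.finite_of_ncard_ne_zero (by rw [ncard_topVertex]; norm_num)
  separated := separated_topVertex

/-- Coordinates in which the remaining sites form a square lattice. -/
def squareEquiv : Remaining topVertex ≃ ℤ × ℤ :=
  (Equiv.ofBijective (fun p : ℤ × ℤ => siteRem (p.1 - p.2) p.2) ⟨by
    rintro ⟨a, b⟩ ⟨c, d⟩ h
    have := siteRem_inj.1 h
    simp only at this
    rw [Prod.mk.injEq]
    omega, by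
    intro x
    obtain ⟨m, n, rfl⟩ := exists_siteRem x
    exact ⟨(m + n, n), by simp⟩⟩).symm

theorem squareEquiv_siteRem (m n : ℤ) : squareEquiv (siteRem m n) = (m + n, n) := by
  rw [squareEquiv, Equiv.symm_apply_eq]
  exact siteRem_inj.2 ⟨(add_sub_cancel_right m n).symm, rfl⟩

theorem squareEquiv_siteNN (x y : Remaining topVertex) :
    SiteNN x y ↔ (squareEquiv x).2 = (squareEquiv y).2 ∧
      |(squareEquiv x).1 - (squareEquiv y).1| = 1 := by
  obtain ⟨m, n, rfl⟩ := exists_siteRem x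
  obtain ⟨m', n', rfl⟩ := exists_siteRem y
  rw [siteNN_iff, squareEquiv_siteRem, squareEquiv_siteRem]
  simp only [abs_eq (zero_le_one : (0 : ℤ) ≤ 1)]
  omega

/-- In the coordinates of `siteRem`, a plaquette consists of `2i, 2i + 1` in row `j` and `2i - 1,
2i` in row `j + 1`. Shifting row `n` by `n` makes it a unit square. -/
theorem squareEquiv_borders (i : ℤ × ℤ) : ∃ a b : ℤ, ∀ x, Borders kagome topVertex i x ↔
    squareEquiv x ∈ ({(a, b), (a + 1, b), (a, b + 1), (a + 1, b + 1)} : Set (ℤ × ℤ)) := by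
  refine ⟨2 * i.1 + i.2, i.2, fun x => ?_⟩
  obtain ⟨m, n, rfl⟩ := exists_siteRem x
  rw [borders_topVertex, squareEquiv_siteRem]
  simp only [Set.mem_insert_iff, Set.mem_singleton_iff, Prod.mk.injEq]
  omega

theorem siteNNN_iff {x y : Remaining topVertex} :
    SiteNNN x y ↔ x ≠ y ∧ ¬ SiteNN x y ∧
      ∃ i, Borders kagome topVertex i x ∧ Borders kagome topVertex i y := by
  refine and_congr_right fun _ => and_congr_right fun _ => ?_
  rw [sharedPlaquettes, Nat.one_le_iff_ne_zero, ← Nat.pos_iff_ne_zero,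
    Set.ncard_pos ((decimable_topVertex.finite_borders x).subset fun i hi => hi.1)]
  rfl

/-- The neighbourhood of a site in the decimated lattice. -/
structure SiteChart (x : Remaining topVertex) (i₁ i₂ : ℤ × ℤ) (nb : Fin 6 → Remaining topVertex) :
    Prop where
  injective : Function.Injective nb
  ne : ∀ j, nb j ≠ x
  index_ne : i₁ ≠ i₂
  nn : ∀ y, SiteNN x y ↔ y = nb 0 ∨ y = nb 1
  nnn : ∀ y, SiteNNN x y ↔ y = nb 2 ∨ y = nb 3 ∨ y = nb 4 ∨ y = nb 5
  borders : ∀ i, Borders kagome topVertex i x ↔ i = i₁ ∨ i = i₂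
  plaquette₁ : ∀ y, Borders kagome topVertex i₁ y ↔ y = x ∨ y = nb 0 ∨ y = nb 2 ∨ y = nb 3
  plaquette₂ : ∀ y, Borders kagome topVertex i₂ y ↔ y = x ∨ y = nb 1 ∨ y = nb 4 ∨ y = nb 5

/-- All conditions of a chart are reduced to statements about pairs of integers, which linear
arithmetic can decide. -/
theorem siteChart_of_coordinates {m n i j i' j' : ℤ} {f : Fin 6 → ℤ × ℤ}
    (hf : ∀ a b, f a = f b → a = b) (hne : ∀ a, f a ≠ (m, n)) (hi : (i, j) ≠ (i', j'))
    (hnn : ∀ k l, (n = l ∧ (k = m - 1 ∨ k = m + 1)) ↔ (k, l) = f 0 ∨ (k, l) = f 1)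
    (hb : ∀ k l, ((n = l ∧ (m = 2 * k ∨ m = 2 * k + 1)) ∨
        (n = l + 1 ∧ (m = 2 * k ∨ m = 2 * k - 1))) ↔ (k, l) = (i, j) ∨ (k, l) = (i', j'))
    (h₁ : ∀ k l, ((l = j ∧ (k = 2 * i ∨ k = 2 * i + 1)) ∨
        (l = j + 1 ∧ (k = 2 * i ∨ k = 2 * i - 1))) ↔
          (k, l) = (m, n) ∨ (k, l) = f 0 ∨ (k, l) = f 2 ∨ (k, l) = f 3)
    (h₂ : ∀ k l, ((l = j' ∧ (k = 2 * i' ∨ k = 2 * i' + 1)) ∨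
        (l = j' + 1 ∧ (k = 2 * i' ∨ k = 2 * i' - 1))) ↔
          (k, l) = (m, n) ∨ (k, l) = f 1 ∨ (k, l) = f 4 ∨ (k, l) = f 5) :
    SiteChart (siteRem m n) (i, j) (i', j') fun a => siteRem (f a).1 (f a).2 := by
  have e : ∀ (k l : ℤ) (p : ℤ × ℤ), siteRem k l = siteRem p.1 p.2 ↔ (k, l) = p := fun k l p => by
    rw [siteRem_inj, Prod.ext_iff]
  have e' : ∀ (k l m n : ℤ), siteRem k l = siteRem m n ↔ (k, l) = (m, n) := fun k l m n => by
    rw [siteRem_inj, Prod.mk.injEq]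
  have H1 : ∀ y, Borders kagome topVertex (i, j) y ↔ y = siteRem m n ∨
      y = siteRem (f 0).1 (f 0).2 ∨ y = siteRem (f 2).1 (f 2).2 ∨ y = siteRem (f 3).1 (f 3).2 := by
    intro y
    obtain ⟨k, l, rfl⟩ := exists_siteRem y
    rw [borders_topVertex, e, e, e, e', ← h₁]
  have H2 : ∀ y, Borders kagome topVertex (i', j') y ↔ y = siteRem m n ∨
      y = siteRem (f 1).1 (f 1).2 ∨ y = siteRem (f 4).1 (f 4).2 ∨ y = siteRem (f 5).1 (f 5).2 := by
    intro y
    obtain ⟨k, l, rfl⟩ := exists_siteRem y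
    rw [borders_topVertex, e, e, e, e', ← h₂]
  have HB : ∀ k, Borders kagome topVertex k (siteRem m n) ↔ k = (i, j) ∨ k = (i', j') := by
    rintro ⟨k, l⟩
    rw [borders_topVertex, ← hb]
  have HN : ∀ y, SiteNN (siteRem m n) y ↔ y = siteRem (f 0).1 (f 0).2 ∨
      y = siteRem (f 1).1 (f 1).2 := by
    intro y
    obtain ⟨k, l, rfl⟩ := exists_siteRem y
    rw [siteNN_iff, e, e, ← hnn]
  have hinj : Function.Injective fun a => siteRem (f a).1 (f a).2 := fun a b hab =>
    hf a b (by rw [Prod.ext_iff]; exact siteRem_inj.1 hab)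
  have hne' : ∀ a, siteRem (f a).1 (f a).2 ≠ siteRem m n := fun a h =>
    hne a (by rw [Prod.ext_iff]; exact siteRem_inj.1 h)
  refine ⟨hinj, hne', hi, HN, fun y => ?_, HB, H1, H2⟩
  rw [siteNNN_iff, HN]
  constructor
  · rintro ⟨h0, h1, k, hk, hky⟩
    rcases (HB k).1 hk with rfl | rfl
    · rcases (H1 y).1 hky with h | h | h | h
      · exact absurd h.symm h0
      · exact absurd (Or.inl h) h1
      · exact Or.inl h
      · exact Or.inr (Or.inl h)
    · rcases (H2 y).1 hky with h | h | h | h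
      · exact absurd h.symm h0
      · exact absurd (Or.inr h) h1
      · exact Or.inr (Or.inr (Or.inl h))
      · exact Or.inr (Or.inr (Or.inr h))
  · have key : ∀ a : Fin 6, a ≠ 0 → a ≠ 1 → siteRem m n ≠ siteRem (f a).1 (f a).2 ∧
        ¬ (siteRem (f a).1 (f a).2 = siteRem (f 0).1 (f 0).2 ∨
          siteRem (f a).1 (f a).2 = siteRem (f 1).1 (f 1).2) := fun a ha0 ha1 =>
      ⟨(hne' a).symm, fun h => h.elim (fun h => ha0 (hinj h)) fun h => ha1 (hinj h)⟩
    have B1 := (HB (i, j)).2 (Or.inl rfl)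
    have B2 := (HB (i', j')).2 (Or.inr rfl)
    rintro (rfl | rfl | rfl | rfl)
    · exact ⟨(key 2 (by decide) (by decide)).1, (key 2 (by decide) (by decide)).2, _, B1,
        (H1 _).2 (by simp)⟩
    · exact ⟨(key 3 (by decide) (by decide)).1, (key 3 (by decide) (by decide)).2, _, B1,
        (H1 _).2 (by simp)⟩
    · exact ⟨(key 4 (by decide) (by decide)).1, (key 4 (by decide) (by decide)).2, _, B2,
        (H2 _).2 (by simp)⟩
    · exact ⟨(key 5 (by decide) (by decide)).1, (key 5 (by decide) (by decide)).2, _, B2,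
        (H2 _).2 (by simp)⟩

/-- The parity of `m` tells which base corner of an up-pointing triangle the site is. One plaquette
surrounds the top of this triangle, the other lies below the row. -/
theorem exists_siteChart (x : Remaining topVertex) : ∃ i₁ i₂ nb, SiteChart x i₁ i₂ nb := by
  obtain ⟨m, n, rfl⟩ := exists_siteRem x
  rcases Int.even_or_odd' m with ⟨i, rfl | rfl⟩
  · refine ⟨_, _, _, siteChart_of_coordinates (m := 2 * i) (n := n) (i := i) (j := n) (i' := i)
      (j' := n - 1) (f := ![(2 * i + 1, n), (2 * i - 1, n), (2 * i - 1, n + 1), (2 * i, n + 1),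
        (2 * i, n - 1), (2 * i + 1, n - 1)]) ?_ ?_ ?_ ?_ ?_ ?_ ?_⟩
    · intro a b
      fin_cases a <;> fin_cases b <;> simp <;> omega
    · intro a
      fin_cases a <;> simp
    · simp; omega
    all_goals
      intro k l
      simp
      omega
  · refine ⟨_, _, _, siteChart_of_coordinates (m := 2 * i + 1) (n := n) (i := i) (j := n)
      (i' := i + 1) (j' := n - 1) (f := ![(2 * i, n), (2 * i + 2, n), (2 * i - 1, n + 1),
        (2 * i, n + 1), (2 * i + 2, n - 1), (2 * i + 3, n - 1)]) ?_ ?_ ?_ ?_ ?_ ?_ ?_⟩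
    · intro a b
      fin_cases a <;> fin_cases b <;> simp <;> omega
    · intro a
      fin_cases a <;> simp
    · simp
    all_goals
      intro k l
      simp
      omega

namespace SiteChart

variable {x : Remaining topVertex} {i₁ i₂ : ℤ × ℤ} {nb : Fin 6 → Remaining topVertex}

theorem ncard_nn (h : SiteChart x i₁ i₂ nb) : {y | SiteNN x y}.ncard = 2 := by
  have : {y | SiteNN x y} = {nb 0, nb 1} := by
    ext y; simp [h.nn]
  rw [this, Set.ncard_pair (h.injective.ne (by decide))]

theorem ncard_nnn (h : SiteChart x i₁ i₂ nb) : {y | SiteNNN x y}.ncard = 4 := by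
  classical
  have : {y | SiteNNN x y} = (({2, 3, 4, 5} : Finset (Fin 6)).map ⟨nb, h.injective⟩ : Set _) := by
    ext y; simp [h.nnn]
  rw [this, Set.ncard_coe_finset, Finset.card_map]
  rfl

end SiteChart

end SiteGeometry

end

end KagomePotts

namespace KagomePotts

noncomputable section

open Filter Topology LocalWeights

/-! ### Number of sites interacting with a given site. -/

section Decimated

variable {V ι : Type} {G : SimpleGraph V} {K : ι → Set V} {q : ℕ}

theorem closureOf_decimated_subset (G : SimpleGraph V) (K : ι → Set V) (q : ℕ)
    (x : Remaining K) : (decimated G K q).closureOf {x} ⊆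
      {y | y = x ∨ (linkGraph G K).Adj x y ∨ ∃ i, Borders G K i x ∧ Borders G K i y} := by
  intro y hy
  obtain ⟨A, hA, hyA⟩ := Set.mem_iUnion₂.1 hy
  have hx := mem_touching_singleton.1 hA
  rcases A with i | e
  · exact Or.inr (Or.inr ⟨i, hx, hyA⟩)
  · have hx' : x ∈ (e : Sym2 (Remaining K)) := hx
    have hy' : y ∈ (e : Sym2 (Remaining K)) := hyA
    by_cases hxy : x = y
    · exact Or.inl hxy.symm
    · have he := e.2
      rw [(Sym2.mem_and_mem_iff hxy).1 ⟨hx', hy'⟩] at he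
      exact Or.inr (Or.inl he)

theorem ncard_closureOf_decimated_le {k : ℕ} {x : Remaining K} {nb : Fin k → Remaining K}
    (h₁ : ∀ y, (linkGraph G K).Adj x y → ∃ j, nb j = y)
    (h₂ : ∀ i, Borders G K i x → ∀ y, Borders G K i y → y = x ∨ ∃ j, nb j = y) :
    ((decimated G K q).closureOf {x}).ncard ≤ k + 1 := by
  have hsub : (decimated G K q).closureOf {x} ⊆ insert x (Set.range nb) := by
    refine (closureOf_decimated_subset G K q x).trans ?_
    rintro y (rfl | h | ⟨i, hx, hy⟩)
    · exact Set.mem_insert _ _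
    · exact Or.inr (h₁ y h)
    · rcases h₂ i hx y hy with rfl | h
      · exact Set.mem_insert _ _
      · exact Or.inr h
  refine (Set.ncard_le_ncard hsub ((Set.finite_range nb).insert x)).trans
    ((Set.ncard_insert_le _ _).trans (Nat.add_le_add_right ?_ 1))
  rw [← Set.image_univ]
  refine (Set.ncard_image_le Set.finite_univ).trans ?_
  rw [Set.ncard_univ, Nat.card_fin]

end Decimated

/-! ### Positivity of the single-site partition functions of the Potts model. -/

section KagomePositivity

/-- Two of the six neighbours in the triangular lattice have two odd coordinates and are missing;
which two depends on the parities of `a` and `b`. -/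
theorem exists_neighbours_kagome (v : KagomeSite) :
    ∃ F : Finset KagomeSite, F.card ≤ 4 ∧ ∀ u, kagome.Adj v u → u ∈ F := by
  obtain ⟨⟨a, b⟩, hv⟩ := v
  set F := (finite_adj_kagome ⟨(a, b), hv⟩).toFinset
  refine ⟨F, ?_, fun u hu => (Set.Finite.mem_toFinset _).2 hu⟩
  have key : ∃ p₁ p₂ p₃ p₄ : ℤ × ℤ, ∀ u ∈ F, u.1 ∈ ({p₁, p₂, p₃, p₄} : Finset (ℤ × ℤ)) := by
    have hadj : ∀ (c d : ℤ) (h : ¬ (Odd c ∧ Odd d)), (⟨(c, d), h⟩ : KagomeSite) ∈ F →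
        ((c - a = 1 ∧ d - b = 0) ∨ (c - a = -1 ∧ d - b = 0) ∨ (c - a = 0 ∧ d - b = 1) ∨
        (c - a = 0 ∧ d - b = -1) ∨ (c - a = 1 ∧ d - b = -1) ∨ (c - a = -1 ∧ d - b = 1)) :=
      fun c d h hF => by
        have h' : kagome.Adj (⟨(a, b), hv⟩ : KagomeSite) ⟨(c, d), h⟩ :=
          (Set.Finite.mem_toFinset (finite_adj_kagome ⟨(a, b), hv⟩)).1 hF
        exact kagome_adj.1 h'
    simp only [Int.odd_iff] at hv
    by_cases ha : a % 2 = 1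
    · refine ⟨(a + 1, b), (a - 1, b), (a + 1, b - 1), (a - 1, b + 1), ?_⟩
      rintro ⟨⟨c, d⟩, h⟩ hu
      have := hadj c d h hu
      simp only [Int.odd_iff] at h
      simp only [Finset.mem_insert, Finset.mem_singleton, Prod.mk.injEq]
      omega
    · by_cases hb : b % 2 = 1
      · refine ⟨(a, b + 1), (a, b - 1), (a + 1, b - 1), (a - 1, b + 1), ?_⟩
        rintro ⟨⟨c, d⟩, h⟩ hu
        have := hadj c d h hu
        simp only [Int.odd_iff] at h
        simp only [Finset.mem_insert, Finset.mem_singleton, Prod.mk.injEq]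
        omega
      · refine ⟨(a, b + 1), (a, b - 1), (a + 1, b), (a - 1, b), ?_⟩
        rintro ⟨⟨c, d⟩, h⟩ hu
        have := hadj c d h hu
        simp only [Int.odd_iff] at h
        simp only [Finset.mem_insert, Finset.mem_singleton, Prod.mk.injEq]
        omega
  obtain ⟨p₁, p₂, p₃, p₄, hp⟩ := key
  calc F.card = (F.image Subtype.val).card :=
        (Finset.card_image_of_injective _ Subtype.val_injective).symm
    _ ≤ ({p₁, p₂, p₃, p₄} : Finset (ℤ × ℤ)).card := Finset.card_le_card fun p hp' => by
        obtain ⟨u, hu, rfl⟩ := Finset.mem_image.1 hp'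
        exact hp u hu
    _ ≤ 4 := Finset.card_le_four

theorem partition_potts_kagome_pos {q : ℕ} (hq : 5 ≤ q) (x : KagomeSite)
    (σ : KagomeSite → Fin q) : 0 < (potts kagome q).partition {x} σ := by
  classical
  rw [(isLocal_potts finite_adj_kagome q).partition_pos_iff]
  obtain ⟨F, hF, hadj⟩ := exists_neighbours_kagome x
  obtain ⟨s, -, hs⟩ := Finset.exists_mem_notMem_of_card_lt_card (s := F.image σ)
    (t := (Finset.univ : Finset (Fin q))) (by
      rw [Finset.card_univ, Fintype.card_fin]
      exact Finset.card_image_le.trans_lt (by omega))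
  refine ⟨Function.update σ x s, fun y hy => Function.update_of_ne (by simpa using hy) _ _, ?_⟩
  rw [boltzmann_potts finite_adj_kagome, if_pos]
  · exact one_pos
  · intro u v huv hu
    rw [Finset.mem_singleton] at hu
    subst hu
    rw [Function.update_self, Function.update_of_ne huv.ne']
    rintro rfl
    exact hs (Finset.mem_image_of_mem σ (hadj v huv))

end KagomePositivity

/-! ### Weights of a site after single-site decimation and their symmetries. -/

section SiteWeights

variable {q : ℕ}

/-- The number of spins at the centre of a plaquette compatible with its four corners. -/
def corner (u a b s : Fin q) : ℕ := q - ({s, u, a, b} : Finset (Fin q)).card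

/-- The Boltzmann weights of a site in the model with single sites summed out. -/
def siteWt (t : Fin 6 → Fin q) (s : Fin q) : ℕ :=
  if s ≠ t 0 ∧ s ≠ t 1 then corner (t 0) (t 2) (t 3) s * corner (t 1) (t 4) (t 5) s else 0

theorem clusterWeight_topVertex {i : ℤ × ℤ} {a b c d : Remaining topVertex}
    (h : ∀ y, Borders kagome topVertex i y ↔ y = a ∨ y = b ∨ y = c ∨ y = d)
    (ρ : Remaining topVertex → Fin q) :
    clusterWeight kagome topVertex i ρ = corner (ρ b) (ρ c) (ρ d) (ρ a) := by
  let v₀ : topVertex i := ⟨⟨(2 * i.1, 2 * i.2 + 1), by simp⟩, rfl⟩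
  have huniq : ∀ u : topVertex i, u = v₀ := fun u =>
    Subtype.ext (Subtype.ext (show u.1.1 = _ from u.2))
  have hadj : ∀ (u : topVertex i) (y : Remaining topVertex), kagome.Adj u y ↔
      y = a ∨ y = b ∨ y = c ∨ y = d := fun u y => by
    rw [← h]
    refine ⟨fun hu => ⟨u, u.2, hu⟩, ?_⟩
    rintro ⟨u', hu', hadj⟩
    rwa [huniq u, ← huniq ⟨u', hu'⟩]
  rw [clusterWeight, corner]
  calc _ = Nat.card {s : Fin q // s ∉ ({ρ a, ρ b, ρ c, ρ d} : Finset (Fin q))} := by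
        refine Nat.card_congr ⟨fun η => ⟨η.1 v₀, ?_⟩, fun s => ⟨fun _ => s, ?_⟩, ?_, ?_⟩
        · have := fun y hy => η.2.2 v₀ y ((hadj v₀ y).2 hy)
          simp only [Finset.mem_insert, Finset.mem_singleton, not_or]
          exact ⟨this a (by simp), this b (by simp), this c (by simp), this d (by simp)⟩
        · have hs := s.2
          simp only [Finset.mem_insert, Finset.mem_singleton, not_or] at hs
          refine ⟨fun u v huv => ?_, fun u y huy => ?_⟩
          · rw [huniq u, huniq v] at huv
            exact absurd huv (SimpleGraph.irrefl _)
          · rcases (hadj u y).1 huy with rfl | rfl | rfl | rfl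
            · exact hs.1
            · exact hs.2.1
            · exact hs.2.2.1
            · exact hs.2.2.2
        · intro η
          refine Subtype.ext (funext fun u => ?_)
          rw [huniq u]
        · intro s
          rfl
    _ = q - ({ρ a, ρ b, ρ c, ρ d} : Finset (Fin q)).card := by
        rw [Nat.card_eq_fintype_card, Fintype.card_subtype_compl, Fintype.card_coe,
          Fintype.card_fin]

theorem SiteChart.localChart {x : Remaining topVertex} {i₁ i₂ : ℤ × ℤ}
    {nb : Fin 6 → Remaining topVertex} (h : SiteChart x i₁ i₂ nb) (q : ℕ) :
    LocalChart (decimated kagome topVertex q) (fun t s => (siteWt t s : ℝ)) x nb where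
  injective := h.injective
  ne := h.ne
  eq ρ s := by
    rw [decimable_topVertex.boltzmann_singleton h.index_ne h.borders (fun y' => h.nn y'),
      clusterWeight_topVertex h.plaquette₁, clusterWeight_topVertex h.plaquette₂]
    simp only [Function.update_self, Function.update_of_ne (h.ne _), siteWt, Function.comp_apply]
    split_ifs <;> simp

theorem corner_pos (hq : 5 ≤ q) (u a b s : Fin q) : 0 < corner u a b s := by
  have : ({s, u, a, b} : Finset (Fin q)).card ≤ 4 := Finset.card_le_four
  unfold corner
  omega

theorem sum_siteWt_pos (hq : 5 ≤ q) (t : Fin 6 → Fin q) : 0 < ∑ s, (siteWt t s : ℝ) := by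
  obtain ⟨s, -, hs⟩ := Finset.exists_mem_notMem_of_card_lt_card (s := {t 0, t 1})
    (t := (Finset.univ : Finset (Fin q))) (by
      rw [Finset.card_univ, Fintype.card_fin]
      exact Finset.card_le_two.trans_lt (by omega))
  simp only [Finset.mem_insert, Finset.mem_singleton, not_or] at hs
  refine Finset.sum_pos' (fun _ _ => Nat.cast_nonneg _) ⟨s, Finset.mem_univ _, ?_⟩
  rw [siteWt, if_pos hs]
  exact_mod_cast Nat.mul_pos (corner_pos hq _ _ _ _) (corner_pos hq _ _ _ _)

/-- Two symmetries suffice: exchanging the unlinked corners of the first plaquette, and exchanging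
the two plaquettes. -/
theorem influence_siteWt (q : ℕ) :
    influence (q := q) (fun t s => (siteWt t s : ℝ)) 1 =
        influence (q := q) (fun t s => (siteWt t s : ℝ)) 0 ∧
      ∀ j : Fin 6, 2 ≤ j → influence (q := q) (fun t s => (siteWt t s : ℝ)) j =
        influence (q := q) (fun t s => (siteWt t s : ℝ)) 2 := by
  have hc : ∀ u a b s : Fin q, corner u a b s = corner u b a s := fun u a b s => by
    rw [corner, corner, Finset.pair_comm a b]
  have s1 := influence_symm (q := q) (wt := fun t s => (siteWt t s : ℝ)) (Equiv.swap 2 3) fun t => by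
    funext s
    simp only [siteWt, Function.comp_apply]
    rw [Equiv.swap_apply_of_ne_of_ne (by decide) (by decide),
      Equiv.swap_apply_of_ne_of_ne (by decide) (by decide), Equiv.swap_apply_left,
      Equiv.swap_apply_right, Equiv.swap_apply_of_ne_of_ne (by decide) (by decide),
      Equiv.swap_apply_of_ne_of_ne (by decide) (by decide), hc (t 0) (t 3)]
  have s2 := influence_symm (q := q) (wt := fun t s => (siteWt t s : ℝ))
      (Equiv.swap 0 1 * Equiv.swap 2 4 * Equiv.swap 3 5) fun t => by
    funext s
    simp only [siteWt, Function.comp_apply]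
    rw [show (Equiv.swap 0 1 * Equiv.swap 2 4 * Equiv.swap 3 5 : Equiv.Perm (Fin 6)) 0 = 1 by decide,
      show (Equiv.swap 0 1 * Equiv.swap 2 4 * Equiv.swap 3 5 : Equiv.Perm (Fin 6)) 1 = 0 by decide,
      show (Equiv.swap 0 1 * Equiv.swap 2 4 * Equiv.swap 3 5 : Equiv.Perm (Fin 6)) 2 = 4 by decide,
      show (Equiv.swap 0 1 * Equiv.swap 2 4 * Equiv.swap 3 5 : Equiv.Perm (Fin 6)) 3 = 5 by decide,
      show (Equiv.swap 0 1 * Equiv.swap 2 4 * Equiv.swap 3 5 : Equiv.Perm (Fin 6)) 4 = 2 by decide,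
      show (Equiv.swap 0 1 * Equiv.swap 2 4 * Equiv.swap 3 5 : Equiv.Perm (Fin 6)) 5 = 3 by decide,
      mul_comm (corner (t 1) _ _ _)]
    simp only [and_comm]
  have e3 : influence (q := q) (fun t s => (siteWt t s : ℝ)) 3 =
      influence (q := q) (fun t s => (siteWt t s : ℝ)) 2 := s1 2
  refine ⟨s2 0, fun j hj => ?_⟩
  fin_cases j
  · exact absurd hj (by decide)
  · exact absurd hj (by decide)
  · rfl
  · exact e3
  · exact s2 2
  · exact (s2 3).trans e3

theorem dobrushin_topVertex (q : ℕ) [NeZero q] : (decimated kagome topVertex q).dobrushin =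
    2 * influence (q := q) (fun t s => (siteWt t s : ℝ)) 0 +
      4 * influence (q := q) (fun t s => (siteWt t s : ℝ)) 2 := by
  have : Nonempty (Remaining topVertex) := ⟨siteRem 0 0⟩
  obtain ⟨h1, h2⟩ := influence_siteWt q
  rw [dobrushin_eq fun x => by
    obtain ⟨i₁, i₂, nb, h⟩ := exists_siteChart x
    exact ⟨nb, h.localChart q⟩]
  rw [Fin.sum_univ_six, h1, h2 3 (by decide), h2 4 (by decide), h2 5 (by decide)]
  ring

end SiteWeights

end

end KagomePotts

namespace KagomePotts

noncomputable section

open Filter Topology LocalWeights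

/-! ### Analytic bounds for the single-site decimation. -/

section SiteBounds

variable {q : ℕ}

theorem abs_normProb_sub_le_of_mul {w w' : Fin q → ℝ} (hw : ∀ s, 0 ≤ w s) (hw' : ∀ s, 0 ≤ w' s)
    (hZ : 0 < ∑ s, w s) (hZ' : 0 < ∑ s, w' s) {p r t : ℝ} (hp : 0 < p) (hr : 0 < r)
    (h : ∑ s, max (p * w s - r * w' s) 0 ≤ t * (p * ∑ s, w s))
    (h' : ∑ s, max (r * w' s - p * w s) 0 ≤ t * (r * ∑ s, w' s)) (A : Finset (Fin q)) :
    |normProb w A - normProb w' A| ≤ t := by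
  have e : ∀ x : ℝ, max x 0 = p * max (x / p) 0 := fun x => by
    rw [mul_max_of_nonneg _ _ hp.le, mul_div_cancel₀ _ hp.ne', mul_zero]
  refine abs_normProb_sub_le hw hw' hZ hZ' (c := r / p) (div_pos hr hp) ?_ ?_ A
  · simp only [e (p * w _ - _), ← Finset.mul_sum] at h
    refine le_of_mul_le_mul_left (le_trans (le_of_eq ?_) (h.trans (le_of_eq ?_))) hp
    · congr 1
      refine Finset.sum_congr rfl fun s _ => ?_
      congr 1
      field_simp
    · ring
  · simp only [e (r * w' _ - _), ← Finset.mul_sum] at h'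
    refine le_of_mul_le_mul_left (le_trans (le_of_eq ?_) (h'.trans (le_of_eq ?_))) hp
    · congr 1
      refine Finset.sum_congr rfl fun s _ => ?_
      congr 1
      field_simp
    · field_simp

/-- This is the lower bound used for the partition functions: the terms in `F` are kept exactly, and
`n` further spins of `E` contribute at least `β` each. -/
theorem sum_add_mul_le_sum {g : Fin q → ℝ} {β : ℝ} (hg : ∀ s, 0 ≤ g s) (hβ : 0 ≤ β)
    {E : Finset (Fin q)} (hE : ∀ s ∈ E, β ≤ g s) (F : Finset (Fin q)) {n : ℕ}
    (hn : n + F.card ≤ E.card) : ∑ s ∈ F, g s + n * β ≤ ∑ s, g s := by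
  have h1 : (n : ℝ) * β ≤ ∑ s ∈ E \ F, g s := by
    have hc : n ≤ (E \ F).card := by
      have := Finset.le_card_sdiff F E
      omega
    calc (n : ℝ) * β ≤ (E \ F).card * β := by gcongr
      _ = ∑ s ∈ E \ F, β := by rw [Finset.sum_const, nsmul_eq_mul]
      _ ≤ ∑ s ∈ E \ F, g s := Finset.sum_le_sum fun s hs => hE s (Finset.mem_sdiff.1 hs).1
  calc ∑ s ∈ F, g s + n * β ≤ ∑ s ∈ F, g s + ∑ s ∈ E \ F, g s := by gcongr
    _ = ∑ s ∈ F ∪ E \ F, g s := (Finset.sum_union Finset.disjoint_sdiff).symm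
    _ ≤ ∑ s, g s := Finset.sum_le_sum_of_subset_of_nonneg (Finset.subset_univ _) fun s _ _ => hg s

/-- After cross-multiplication with `α'` and `α` the products `α * α' * g s` cancel. One difference
is then positive at most at `a`, the other at most at `a'` and `b`, and at `b` only if `α` exceeds
`α'`. The partition functions contain at least five spins with `g ≥ β ≥ 3` and prefactors of at
least 3, which yields 9/100. -/
theorem nextNearest_bound_of_le {g : Fin q → ℝ} {α α' β : ℝ} (hg : ∀ s, 0 ≤ g s)
    (hα : 3 ≤ α') (hβ : 3 ≤ β) {E : Finset (Fin q)} (hE : ∀ s ∈ E, β ≤ g s)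
    (hE' : ∀ s, s ∉ E → g s = 0) (hgE : ∀ s, g s ≤ β + 1) (hcard : 5 ≤ E.card) {a a' b : Fin q}
    (hαα' : α = α' ∨ α = α' + 1 ∧ a' ≠ b) (A : Finset (Fin q)) :
    |normProb (fun s => (α + if s = a ∨ s = b then 1 else 0) * g s) A -
      normProb (fun s => (α' + if s = a' ∨ s = b then 1 else 0) * g s) A| ≤ 9 / 100 := by
  have hle : α' ≤ α := by rcases hαα' with h | h <;> linarith [h]
  have hlow : ∀ F : Finset (Fin q), ∀ n : ℕ, n + F.card ≤ 5 →
      ∑ s ∈ F, g s + n * β ≤ ∑ s, g s := fun F n hn =>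
    sum_add_mul_le_sum hg (by linarith) hE F (by omega)
  have hZ : ∀ (γ : ℝ) (c : Fin q), γ * ∑ s, g s + g c ≤
      ∑ s, (γ + if s = c ∨ s = b then 1 else 0) * g s := fun γ c => by
    rw [Finset.mul_sum, ← Finset.sum_ite_eq' Finset.univ c g |>.trans (if_pos (Finset.mem_univ c)),
      ← Finset.sum_add_distrib]
    refine Finset.sum_le_sum fun s _ => ?_
    have := hg s
    split_ifs <;> first | linarith | simp_all
  have hZb : a' ≠ b → α' * ∑ s, g s + g a' + g b ≤
      ∑ s, (α' + if s = a' ∨ s = b then 1 else 0) * g s := fun hab => by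
    rw [Finset.mul_sum, ← Finset.sum_ite_eq' Finset.univ a' g |>.trans (if_pos (Finset.mem_univ _)),
      ← Finset.sum_ite_eq' Finset.univ b g |>.trans (if_pos (Finset.mem_univ _)),
      ← Finset.sum_add_distrib, ← Finset.sum_add_distrib]
    refine Finset.sum_le_sum fun s _ => ?_
    have := hg s
    split_ifs <;> first | linarith | simp_all
  have h4 : ∀ c, g c + 4 * β ≤ ∑ s, g s := fun c => by
    simpa using hlow {c} 4 (by simp)
  have hpos : 0 < ∑ s, g s := by linarith [h4 a, hg a]
  have hZa := hZ α a
  have hZa' := hZ α' a'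
  have hbd : ∀ γ : ℝ, 3 ≤ γ → ∀ c, g c ≤ 9 / 100 * (γ * ∑ s, g s + g c) := fun γ hγ c => by
    have := h4 c
    have := hgE c
    nlinarith [mul_nonneg (sub_nonneg.2 hγ) hpos.le]
  refine abs_normProb_sub_le_of_mul (p := α') (r := α) ?_ ?_ ?_ ?_ (by linarith) (by linarith)
    ?_ ?_ A
  · intro s
    exact mul_nonneg (by split_ifs <;> linarith) (hg s)
  · intro s
    exact mul_nonneg (by split_ifs <;> linarith) (hg s)
  · nlinarith [hg a]
  · nlinarith [hg a']
  · calc _ ≤ ∑ s, if s = a then α' * g s else 0 := by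
          refine Finset.sum_le_sum fun s _ => ?_
          have h0 := hg s
          have h1 : 0 ≤ (α - α') * g s := mul_nonneg (by linarith) h0
          have h2 : 0 ≤ α' * g s := mul_nonneg (by linarith) h0
          split_ifs <;> refine max_le ?_ ?_ <;> first | nlinarith | simp_all
      _ = α' * g a := by simp
      _ ≤ _ := by
          rw [mul_left_comm]
          refine mul_le_mul_of_nonneg_left ((hbd α (by linarith) a).trans ?_) (by linarith)
          linarith
  · calc _ ≤ ∑ s, ((if s = a' then α * g s else 0) + if s = b then (α - α') * g s else 0) := by
          refine Finset.sum_le_sum fun s _ => ?_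
          have h0 := hg s
          have h1 : 0 ≤ (α - α') * g s := mul_nonneg (by linarith) h0
          have h2 : 0 ≤ α' * g s := mul_nonneg (by linarith) h0
          split_ifs <;> refine max_le ?_ ?_ <;> first | nlinarith | simp_all
      _ = α * g a' + (α - α') * g b := by simp [Finset.sum_add_distrib]
      _ ≤ _ := by
          rw [mul_left_comm]
          rcases hαα' with h | ⟨h, hab⟩
          · rw [h, sub_self, zero_mul, add_zero]
            refine mul_le_mul_of_nonneg_left ((hbd α' (by linarith) a').trans ?_) (by linarith)
            linarith
          · have hZ' := hZb hab
            by_cases hb : b ∈ E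
            · have hy := hE b hb
              -- Besides `a'` and `b` there are three more spins in `E`. The extra term at `b` has
              -- relative coefficient `1 / α ≤ 1 / 4`, since `α = α' + 1`.
              have hG : g a' + g b + 3 * β ≤ ∑ s, g s := by
                simpa [Finset.sum_pair hab] using hlow {a', b} 3 (by
                  rw [Finset.card_pair hab])
              have hx := hgE a'
              have k1 : 3 * (g a' + g b + 3 * β) ≤ α' * ∑ s, g s :=
                mul_le_mul hα hG (by linarith [hg a', hg b]) (by linarith)
              have k2 : 1 / 4 * g b ≤ 9 / 100 *
                  ∑ s, (α' + if s = a' ∨ s = b then 1 else 0) * g s - g a' := by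
                linarith
              have k3 : g b ≤ α * (1 / 4 * g b) := by nlinarith
              have k4 := mul_le_mul_of_nonneg_left k2 (show 0 ≤ α by linarith)
              rw [h] at *
              linarith
            · rw [hE' b hb, mul_zero, add_zero]
              refine mul_le_mul_of_nonneg_left ((hbd α' (by linarith) a').trans ?_) (by linarith)
              linarith

/-- The main effect of changing a linked spin is that `u'` is allowed before and `u` after the
change; away from these two spins the weights agree up to normalization or, if `α = α' + 1`, up to
one more term. The mass of the newly allowed spin is compared with that of at least four others. -/
theorem nearest_bound_of_le {g : Fin q → ℝ} {α α' β : ℝ} (hg : ∀ s, 0 ≤ g s)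
    (hα : 3 ≤ α') (hβ : 3 ≤ β) {E : Finset (Fin q)} (hE : ∀ s ∈ E, β ≤ g s)
    (hE' : ∀ s, s ∉ E → g s = 0) (hgE : ∀ s, g s ≤ β + 1) (hcard : 6 ≤ E.card) {u u' a b : Fin q}
    (hu : u ≠ u') (hαα' : α = α' ∨ α = α' + 1 ∧ (u = a ∨ u = b)) (A : Finset (Fin q)) :
    |normProb (fun s => if s = u then 0 else (α + if s = a ∨ s = b then 1 else 0) * g s) A -
      normProb (fun s => if s = u' then 0 else (α' + if s = a ∨ s = b then 1 else 0) * g s) A| ≤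
      4 / 13 := by
  have hle : α' ≤ α := by rcases hαα' with h | h <;> linarith [h]
  set H := ∑ s, if s = u ∨ s = u' then 0 else g s with hH
  have hlow : ∀ F : Finset (Fin q), ∀ n : ℕ, n + F.card ≤ 4 →
      ∑ s ∈ F, (if s = u ∨ s = u' then 0 else g s) + n * β ≤ H := fun F n hn => by
    refine sum_add_mul_le_sum (fun s => ?_) (by linarith) (E := E \ {u, u'}) (fun s hs => ?_) F ?_
    · split_ifs
      exacts [le_rfl, hg s]
    · simp only [Finset.mem_sdiff, Finset.mem_insert, Finset.mem_singleton] at hs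
      rw [if_neg hs.2]
      exact hE s hs.1
    · have := Finset.le_card_sdiff {u, u'} E
      have := Finset.card_le_two (a := u) (b := u')
      omega
  have h4 : 4 * β ≤ H := by simpa using hlow ∅ 4 (by simp)
  -- A single weight is at most `(γ + 1) * (β + 1) ≤ 16/9 * γ * β`, while the other spins contribute
  -- at least `4 * γ * β`. The resulting fraction is `(16/9) / (16/9 + 4) = 4/13`.
  have hX : ∀ γ, 3 ≤ γ → ∀ c, 9 * ((γ + if c = a ∨ c = b then 1 else 0) * g c) ≤ 16 * (γ * β) :=
      fun γ hγ c => by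
    have h1 := hgE c
    have h2 : (γ + if c = a ∨ c = b then 1 else 0) ≤ γ + 1 := by split_ifs <;> linarith
    have h3 : (γ + if c = a ∨ c = b then 1 else 0) * g c ≤ (γ + 1) * (β + 1) :=
      mul_le_mul h2 h1 (hg c) (by linarith)
    nlinarith [mul_nonneg (sub_nonneg.2 hγ) (sub_nonneg.2 hβ)]
  have hX0 : ∀ γ, 3 ≤ γ → ∀ c, 0 ≤ (γ + if c = a ∨ c = b then 1 else 0) * g c := fun γ hγ c =>
    mul_nonneg (by split_ifs <;> linarith) (hg c)
  -- lower bounds for the partition functions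
  have hZ : ∀ γ, 3 ≤ γ → ∀ c c', c ≠ c' → (∀ s, s = u ∨ s = u' ↔ s = c ∨ s = c') →
      (γ + if c' = a ∨ c' = b then 1 else 0) * g c' + γ * H ≤
      ∑ s, if s = c then 0 else (γ + if s = a ∨ s = b then 1 else 0) * g s := fun γ hγ c c' hc hcc => by
    rw [hH, Finset.mul_sum, ← Finset.sum_ite_eq' Finset.univ c'
      (fun c' => (γ + if c' = a ∨ c' = b then 1 else 0) * g c') |>.trans
        (if_pos (Finset.mem_univ _)), ← Finset.sum_add_distrib]
    refine Finset.sum_le_sum fun s _ => ?_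
    have h0 := hg s
    have := hcc s
    by_cases h1 : s = c
    · subst h1
      simp [hc, this.2]
    · by_cases h2 : s = c'
      · subst h2
        simp [this.2, h1]
      · have h3 : ¬ (s = u ∨ s = u') := fun h => by simp_all
        simp only [h1, h2, h3, if_false, zero_add]
        split_ifs <;> nlinarith
  have hZ1 := hZ α (by linarith) u u' hu (fun s => Iff.rfl)
  have hZ2 := hZ α' hα u' u hu.symm (fun s => or_comm)
  set Z := ∑ s, if s = u then 0 else (α + if s = a ∨ s = b then 1 else 0) * g s
  set Z' := ∑ s, if s = u' then 0 else (α' + if s = a ∨ s = b then 1 else 0) * g s with hZ'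
  have hαβ : 0 < α * β := by nlinarith
  have hαβ' : 0 < α' * β := by nlinarith
  have m1 := mul_le_mul_of_nonneg_left h4 (show 0 ≤ α by linarith)
  have m2 := mul_le_mul_of_nonneg_left h4 (show 0 ≤ α' by linarith)
  have x1 := hX α (by linarith) u'
  have x2 := hX α' hα u
  have y1 := hX0 α (by linarith) u'
  have y2 := hX0 α' hα u
  refine abs_normProb_sub_le_of_mul (p := α') (r := α) ?_ ?_ ?_ ?_ (by linarith) (by linarith)
    ?_ ?_ A
  · intro s
    split_ifs <;> nlinarith [hg s]
  · intro s
    split_ifs <;> nlinarith [hg s]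
  · nlinarith
  · nlinarith
  · calc _ ≤ ∑ s, if s = u' then α' * ((α + if s = a ∨ s = b then 1 else 0) * g s) else 0 := by
          refine Finset.sum_le_sum fun s _ => ?_
          have h0 := hg s
          have h1 : 0 ≤ (α - α') * g s := mul_nonneg (by linarith) h0
          have h2 : 0 ≤ α' * g s := mul_nonneg (by linarith) h0
          have h3 : 0 ≤ α * (α' * g s) := mul_nonneg (by linarith) h2
          have h4 : 0 ≤ α * g s := mul_nonneg (by linarith) h0
          by_cases k1 : s = u
          · subst k1
            simp only [hu, if_true, if_false]
            refine max_le ?_ le_rfl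
            split_ifs <;> nlinarith
          · by_cases k2 : s = u'
            · subst k2
              simp only [k1, if_true, if_false]
              refine max_le ?_ ?_ <;> split_ifs <;> nlinarith
            · simp only [k1, k2, if_false]
              refine max_le ?_ le_rfl
              split_ifs <;> nlinarith
      _ = α' * ((α + if u' = a ∨ u' = b then 1 else 0) * g u') := by simp
      _ ≤ _ := by
          rw [mul_left_comm (4 / 13 : ℝ)]
          refine mul_le_mul_of_nonneg_left ?_ ?_ <;> linarith
  · rw [mul_left_comm (4 / 13 : ℝ)]
    rcases hαα' with h | ⟨h, hab⟩
    · calc _ ≤ ∑ s, if s = u then α * ((α' + if s = a ∨ s = b then 1 else 0) * g s) else 0 := by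
            refine Finset.sum_le_sum fun s _ => ?_
            have h0 := hg s
            have h2 : 0 ≤ α' * g s := mul_nonneg (by linarith) h0
            have h3 : 0 ≤ α' * (α' * g s) := mul_nonneg (by linarith) h2
            rw [h]
            by_cases k1 : s = u
            · subst k1
              simp only [hu, if_true, if_false]
              refine max_le ?_ ?_ <;> split_ifs <;> nlinarith
            · by_cases k2 : s = u'
              · subst k2
                simp only [k1, if_true, if_false]
                refine max_le ?_ le_rfl
                split_ifs <;> nlinarith
              · simp only [k1, k2, if_false, sub_self, max_self, le_refl]
        _ = α * ((α' + if u = a ∨ u = b then 1 else 0) * g u) := by simp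
        _ ≤ _ := by
            refine mul_le_mul_of_nonneg_left ?_ ?_ <;> linarith
    · -- the only other site where the reversed difference is positive
      obtain ⟨p, hp⟩ : ∃ p, ∀ s, (s = a ∨ s = b) ↔ (s = u ∨ s = p) := by
        rcases hab with rfl | rfl
        · exact ⟨b, fun s => Iff.rfl⟩
        · exact ⟨a, fun s => or_comm⟩
      set y := if p = u ∨ p = u' then 0 else g p with hy
      have hyH : y + 3 * β ≤ H := by simpa using hlow {p} 3 (by simp)
      have hZ3 : (α' + if u = a ∨ u = b then 1 else 0) * g u + (α' * H + y) ≤ Z' := by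
        rw [hH, Finset.mul_sum, ← Finset.sum_ite_eq' Finset.univ u
          (fun c' => (α' + if c' = a ∨ c' = b then 1 else 0) * g c') |>.trans
            (if_pos (Finset.mem_univ _)), hy, ← Finset.sum_ite_eq' Finset.univ p
          (fun p => if p = u ∨ p = u' then 0 else g p) |>.trans
            (if_pos (Finset.mem_univ _)), ← Finset.sum_add_distrib, ← Finset.sum_add_distrib, hZ']
        refine Finset.sum_le_sum fun s _ => ?_
        have h0 := hg s
        have := hp s
        by_cases k1 : s = u
        · subst k1
          simp [hu]
        · by_cases k2 : s = u'
          · subst k2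
            simp [k1]
          · by_cases k3 : s = p
            · rw [k3] at k1 k2 h0 ⊢
              simp only [hp p, k1, k2, or_self, or_true, if_false, if_true, zero_add]
              linarith
            · simp [this, k1, k2, k3]
      calc _ ≤ ∑ s, ((if s = u then α * ((α' + if s = a ∨ s = b then 1 else 0) * g s) else 0) +
              if s = p then (if s = u ∨ s = u' then 0 else g s) else 0) := by
            refine Finset.sum_le_sum fun s _ => ?_
            have h0 := hg s
            have hα0 : 0 ≤ α' := by linarith
            have := hp s
            simp only [this, h]
            by_cases k1 : s = u
            · subst k1
              simp only [hu, if_true, if_false, true_or, ite_self, add_zero, mul_zero, sub_zero]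
              exact max_le le_rfl (by positivity)
            · by_cases k2 : s = u'
              · subst k2
                simp only [k1, if_true, if_false, or_true, ite_self, add_zero, mul_zero, zero_sub]
                refine max_le (neg_nonpos.2 ?_) le_rfl
                split_ifs <;> positivity
              · simp only [k1, k2, if_false, false_or, zero_add]
                by_cases k3 : s = p
                · simp only [k3, if_true]
                  rw [k3] at h0
                  exact max_le (le_of_eq (by ring)) h0
                · simp only [k3, if_false]
                  exact max_le (le_of_eq (by ring)) le_rfl
        _ = α * ((α' + if u = a ∨ u = b then 1 else 0) * g u) + y := by
            simp [Finset.sum_add_distrib, hy]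
        _ ≤ _ := by
            set X := (α' + if u = a ∨ u = b then 1 else 0) * g u
            -- If the extra term `y` is nonzero, its spin lies in `E`, so `y ≥ β`. The spin also
            -- appears in `Z'` with weight at least `(α' + 1) * y`, more than enough to absorb `y /
            -- α ≤ y / 4`.
            have key : X + y / α ≤ 4 / 13 * Z' := by
              have hα4 : 4 ≤ α := by linarith
              rcases eq_or_ne y 0 with h0 | h0
              · rw [h0, zero_div]
                linarith
              · have hyE : β ≤ y := by
                  rw [hy] at h0 ⊢
                  split_ifs with h1
                  · simp [h1] at h0
                  · rw [if_neg h1] at h0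
                    exact hE p (by_contra fun hpE => h0 (hE' p hpE))
                have k1 : y / α ≤ y / 4 := by
                  gcongr
                  linarith
                have k2 := mul_le_mul_of_nonneg_left hyH (show 0 ≤ α' by linarith)
                have k3 := mul_le_mul_of_nonneg_left hyE (show 0 ≤ α' by linarith)
                linarith
            have := mul_le_mul_of_nonneg_left key (show 0 ≤ α by linarith)
            rwa [mul_add, mul_div_cancel₀ _ (show α ≠ 0 by linarith)] at this

end SiteBounds

end

end KagomePotts

namespace KagomePotts

noncomputable section

open Filter Topology LocalWeights

/-! ### The Dobrushin constant of the single-site decimation. -/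

section SiteInfluence

variable {q : ℕ}

/-- The value of `corner u a b s` for `s` different from `u`, `a` and `b`. -/
def cornerBase (u a b : Fin q) : ℕ := q - ({u, a, b} : Finset (Fin q)).card - 1

theorem corner_eq (hq : 4 ≤ q) {u a b s : Fin q} (hs : s ≠ u) :
    (corner u a b s : ℝ) = cornerBase u a b + if s = a ∨ s = b then 1 else 0 := by
  have h3 : ({u, a, b} : Finset (Fin q)).card ≤ 3 := Finset.card_le_three
  rw [corner, cornerBase]
  split_ifs with h
  · rw [Finset.insert_eq_of_mem (by simp [h])]
    norm_cast
    omega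
  · rw [Finset.card_insert_of_notMem (by simpa [hs] using h), Nat.sub_sub, add_zero]

theorem three_le_cornerBase (hq : 7 ≤ q) (u a b : Fin q) : (3 : ℝ) ≤ cornerBase u a b := by
  have h3 : ({u, a, b} : Finset (Fin q)).card ≤ 3 := Finset.card_le_three
  rw [cornerBase]
  norm_cast
  omega

/-- Replacing one element changes the cardinality of the set by at most 1. If `a' = b`, the new set
is as small as possible, so under `h` the base value cannot be larger before the change. -/
theorem cornerBase_replace_corner (hq : 4 ≤ q) {u a a' b : Fin q}
    (h : cornerBase u a' b ≤ cornerBase u a b) :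
    (cornerBase u a b : ℝ) = cornerBase u a' b ∨
      (cornerBase u a b : ℝ) = cornerBase u a' b + 1 ∧ a' ≠ b := by
  have e : ∀ x : Fin q, ({u, x, b} : Finset (Fin q)) = insert x {u, b} := fun x =>
    Finset.insert_comm _ _ _
  have h3 : ∀ x, ({u, x, b} : Finset (Fin q)).card ≤ 3 := fun x => Finset.card_le_three
  have h1 : ∀ x, ({u, x, b} : Finset (Fin q)).card ≤ ({u, b} : Finset (Fin q)).card + 1 :=
    fun x => by
      rw [e]
      exact Finset.card_insert_le _ _
  have h2 : ∀ x, ({u, b} : Finset (Fin q)).card ≤ ({u, x, b} : Finset (Fin q)).card := fun x => by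
    rw [e]
    exact Finset.card_le_card (Finset.subset_insert _ _)
  have k1 := h1 a
  have k2 := h2 a
  have k3 := h1 a'
  have k4 := h2 a'
  have k5 := h3 a
  have k6 := h3 a'
  rw [cornerBase, cornerBase] at *
  by_cases hab : a' = b
  · left
    norm_cast
    have : ({u, a', b} : Finset (Fin q)).card = ({u, b} : Finset (Fin q)).card := by
      rw [e, Finset.insert_eq_of_mem (by simp [hab])]
    omega
  · norm_cast
    simp only [hab, not_false_eq_true, and_true]
    omega

/-- If `u` differs from `a` and `b`, then `{u, a, b}` is as large as possible, and under `h` the two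
base values must agree. -/
theorem cornerBase_replace_side (hq : 4 ≤ q) {u u' a b : Fin q}
    (h : cornerBase u' a b ≤ cornerBase u a b) :
    (cornerBase u a b : ℝ) = cornerBase u' a b ∨
      (cornerBase u a b : ℝ) = cornerBase u' a b + 1 ∧ (u = a ∨ u = b) := by
  have h3 : ∀ x, ({x, a, b} : Finset (Fin q)).card ≤ 3 := fun x => Finset.card_le_three
  have h1 : ∀ x, ({x, a, b} : Finset (Fin q)).card ≤ ({a, b} : Finset (Fin q)).card + 1 :=
    fun x => Finset.card_insert_le _ _
  have h2 : ∀ x, ({a, b} : Finset (Fin q)).card ≤ ({x, a, b} : Finset (Fin q)).card := fun x =>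
    Finset.card_le_card (Finset.subset_insert _ _)
  have k1 := h1 u
  have k2 := h2 u
  have k3 := h1 u'
  have k4 := h2 u'
  have k5 := h3 u
  have k6 := h3 u'
  rw [cornerBase, cornerBase] at *
  by_cases hab : u = a ∨ u = b
  · norm_cast
    simp only [hab, and_true]
    omega
  · left
    norm_cast
    have : ({u, a, b} : Finset (Fin q)).card = ({a, b} : Finset (Fin q)).card + 1 :=
      Finset.card_insert_of_notMem (by simpa using hab)
    omega

theorem influence_siteWt_nextNearest_le (hq : 7 ≤ q) :
    influence (q := q) (fun t s => (siteWt t s : ℝ)) 2 ≤ ENNReal.ofReal (9 / 100) := by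
  refine influence_le fun t t' ht A => ?_
  wlog hle : cornerBase (t 0) (t' 2) (t 3) ≤ cornerBase (t 0) (t 2) (t 3) generalizing t t'
  · rw [abs_sub_comm]
    refine this t' t (fun i hi => (ht i hi).symm) ?_
    rw [← ht 0 (by decide), ← ht 3 (by decide)]
    omega
  -- Everything except the plaquette with the changed corner, including both link constraints, is
  -- put into `g`; at least five spins are left in its support.
  set g : Fin q → ℝ := fun s => if s = t 0 ∨ s = t 1 then 0 else corner (t 1) (t 4) (t 5) s
  have h1 : (fun s => (siteWt t s : ℝ)) = fun s =>
      (cornerBase (t 0) (t 2) (t 3) + if s = t 2 ∨ s = t 3 then 1 else 0 : ℝ) * g s := by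
    funext s
    simp only [siteWt, g]
    by_cases hs : s = t 0 ∨ s = t 1
    · rw [if_pos hs, if_neg (by tauto)]
      simp
    · rw [if_neg hs, if_pos (by tauto), Nat.cast_mul, corner_eq (u := t 0) (by omega) (by tauto)]
  have h2 : (fun s => (siteWt t' s : ℝ)) = fun s =>
      (cornerBase (t 0) (t' 2) (t 3) + if s = t' 2 ∨ s = t 3 then 1 else 0 : ℝ) * g s := by
    funext s
    simp only [siteWt, g]
    rw [← ht 0 (by decide), ← ht 1 (by decide), ← ht 3 (by decide), ← ht 4 (by decide),
      ← ht 5 (by decide)]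
    by_cases hs : s = t 0 ∨ s = t 1
    · rw [if_pos hs, if_neg (by tauto)]
      simp
    · rw [if_neg hs, if_pos (by tauto), Nat.cast_mul, corner_eq (u := t 0) (by omega) (by tauto)]
  have hβ := three_le_cornerBase hq (t 1) (t 4) (t 5)
  rw [h1, h2]
  refine nextNearest_bound_of_le (β := cornerBase (t 1) (t 4) (t 5)) (E := {t 0, t 1}ᶜ) ?_
    (three_le_cornerBase hq _ _ _) hβ ?_ ?_ ?_ ?_ (cornerBase_replace_corner (by omega) hle) A
  · intro s
    simp only [g]
    split_ifs <;> positivity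
  · intro s hs
    simp only [Finset.mem_compl, Finset.mem_insert, Finset.mem_singleton] at hs
    simp only [g, if_neg hs]
    rw [corner_eq (by omega) (by tauto)]
    split_ifs <;> simp
  · intro s hs
    simp only [Finset.mem_compl, Finset.mem_insert, Finset.mem_singleton, not_not] at hs
    simp only [g, if_pos hs]
  · intro s
    simp only [g]
    split_ifs with hs
    · positivity
    · rw [corner_eq (by omega) (by tauto)]
      split_ifs <;> simp
  · rw [Finset.card_compl, Fintype.card_fin]
    have := Finset.card_le_two (a := t 0) (b := t 1)
    omega

theorem influence_siteWt_nearest_le (hq : 7 ≤ q) :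
    influence (q := q) (fun t s => (siteWt t s : ℝ)) 0 ≤ ENNReal.ofReal (4 / 13) := by
  refine influence_le fun t t' ht A => ?_
  by_cases hu : t 0 = t' 0
  · have : t = t' := funext fun i => by
      by_cases hi : i = 0
      · rw [hi, hu]
      · exact ht i hi
    rw [this, sub_self, abs_zero]
    norm_num
  wlog hle : cornerBase (t' 0) (t 2) (t 3) ≤ cornerBase (t 0) (t 2) (t 3) generalizing t t'
  · rw [abs_sub_comm]
    refine this t' t (fun i hi => (ht i hi).symm) (fun h => hu h.symm) ?_
    rw [← ht 2 (by decide), ← ht 3 (by decide)]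
    omega
  -- Here the constraint from `t 0` changes and stays outside `g`, so at least six spins are left in
  -- the support of `g`.
  set g : Fin q → ℝ := fun s => if s = t 1 then 0 else corner (t 1) (t 4) (t 5) s
  have h1 : (fun s => (siteWt t s : ℝ)) = fun s => if s = t 0 then 0 else
      (cornerBase (t 0) (t 2) (t 3) + if s = t 2 ∨ s = t 3 then 1 else 0 : ℝ) * g s := by
    funext s
    simp only [siteWt, g]
    by_cases hs : s = t 0
    · rw [if_pos hs, if_neg (by tauto), Nat.cast_zero]
    · rw [if_neg hs]
      by_cases hs' : s = t 1
      · rw [if_pos hs', if_neg (by tauto), Nat.cast_zero, mul_zero]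
      · rw [if_neg hs', if_pos (by tauto), Nat.cast_mul, corner_eq (u := t 0) (by omega) hs]
  have h2 : (fun s => (siteWt t' s : ℝ)) = fun s => if s = t' 0 then 0 else
      (cornerBase (t' 0) (t 2) (t 3) + if s = t 2 ∨ s = t 3 then 1 else 0 : ℝ) * g s := by
    funext s
    simp only [siteWt, g]
    rw [← ht 1 (by decide), ← ht 2 (by decide), ← ht 3 (by decide), ← ht 4 (by decide),
      ← ht 5 (by decide)]
    by_cases hs : s = t' 0
    · rw [if_pos hs, if_neg (by tauto), Nat.cast_zero]
    · rw [if_neg hs]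
      by_cases hs' : s = t 1
      · rw [if_pos hs', if_neg (by tauto), Nat.cast_zero, mul_zero]
      · rw [if_neg hs', if_pos (by tauto), Nat.cast_mul, corner_eq (u := t' 0) (by omega) hs]
  have hβ := three_le_cornerBase hq (t 1) (t 4) (t 5)
  rw [h1, h2]
  refine nearest_bound_of_le (β := cornerBase (t 1) (t 4) (t 5)) (E := {t 1}ᶜ) ?_
    (three_le_cornerBase hq _ _ _) hβ ?_ ?_ ?_ ?_ hu (cornerBase_replace_side (by omega) hle) A
  · intro s
    simp only [g]
    split_ifs <;> positivity
  · intro s hs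
    simp only [Finset.mem_compl, Finset.mem_singleton] at hs
    simp only [g, if_neg hs]
    rw [corner_eq (by omega) hs]
    split_ifs <;> simp
  · intro s hs
    simp only [Finset.mem_compl, Finset.mem_singleton, not_not] at hs
    simp only [g, if_pos hs]
  · intro s
    simp only [g]
    split_ifs with hs
    · positivity
    · rw [corner_eq (by omega) hs]
      split_ifs <;> simp
  · rw [Finset.card_compl, Fintype.card_fin, Finset.card_singleton]
    omega

theorem dobrushin_topVertex_lt_one (hq : 7 ≤ q) :
    (decimated kagome topVertex q).dobrushin < 1 := by
  have : NeZero q := ⟨by omega⟩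
  rw [dobrushin_topVertex]
  calc _ ≤ 2 * ENNReal.ofReal (4 / 13) + 4 * ENNReal.ofReal (9 / 100) := by
        gcongr
        exacts [influence_siteWt_nearest_le hq, influence_siteWt_nextNearest_le hq]
    _ = ENNReal.ofReal (2 * (4 / 13) + 4 * (9 / 100)) := by
        rw [ENNReal.ofReal_add (by norm_num) (by norm_num), ENNReal.ofReal_mul (by norm_num),
          ENNReal.ofReal_mul (p := 4) (by norm_num)]
        norm_num
    _ < 1 := by
        rw [ENNReal.ofReal_lt_one]
        norm_num

theorem normProb_natCast {q : ℕ} (w : Fin q → ℕ) (A : Finset (Fin q)) :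
    normProb (fun s => (w s : ℝ)) A = (∑ s ∈ A, w s : ℕ) / (∑ s, w s : ℕ) := by
  rw [normProb]
  push_cast
  rfl

/-- With these neighbours the spin 0 has weight 4 out of 6, because it repeats a corner of both
plaquettes. Giving the value 0 to a linked neighbour forbids it, so twice the first influence is
already at least 4/3. -/
theorem one_le_dobrushin_topVertex_five : 1 ≤ (decimated kagome topVertex 5).dobrushin := by
  have h : ENNReal.ofReal (2 / 3) ≤ influence (q := 5) (fun t s => (siteWt t s : ℝ)) 0 := by
    refine le_trans (ENNReal.ofReal_le_ofReal ?_) (le_influence (q := 5)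
      (fun t s => (siteWt t s : ℝ)) (j := 0) (t := ![2, 1, 0, 1, 0, 2])
      (t' := ![0, 1, 0, 1, 0, 2]) (by decide) {0})
    rw [normProb_natCast, normProb_natCast,
      show ∑ s ∈ {0}, siteWt (q := 5) ![2, 1, 0, 1, 0, 2] s = 4 by decide,
      show ∑ s, siteWt (q := 5) ![2, 1, 0, 1, 0, 2] s = 6 by decide,
      show ∑ s ∈ {0}, siteWt (q := 5) ![0, 1, 0, 1, 0, 2] s = 0 by decide]
    norm_num
  rw [dobrushin_topVertex]
  calc (1 : ℝ≥0∞) ≤ 2 * ENNReal.ofReal (2 / 3) := by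
        rw [← ENNReal.ofReal_ofNat 2, ← ENNReal.ofReal_mul (by norm_num), ENNReal.one_le_ofReal]
        norm_num
    _ ≤ _ := le_add_right (by gcongr)

/-- The first influence alone gives only 6/7. An unlinked corner changing from 2 to 3 changes the
weight of the spin 2 from 9 to 6 out of 23, and four such influences bring the sum above 1. -/
theorem one_le_dobrushin_topVertex_six : 1 ≤ (decimated kagome topVertex 6).dobrushin := by
  have h : ENNReal.ofReal (3 / 7) ≤ influence (q := 6) (fun t s => (siteWt t s : ℝ)) 0 := by
    refine le_trans (ENNReal.ofReal_le_ofReal ?_) (le_influence (q := 6)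
      (fun t s => (siteWt t s : ℝ)) (j := 0) (t := ![2, 1, 0, 1, 0, 2])
      (t' := ![0, 1, 0, 1, 0, 2]) (by decide) {0})
    rw [normProb_natCast, normProb_natCast,
      show ∑ s ∈ {0}, siteWt (q := 6) ![2, 1, 0, 1, 0, 2] s = 9 by decide,
      show ∑ s, siteWt (q := 6) ![2, 1, 0, 1, 0, 2] s = 21 by decide,
      show ∑ s ∈ {0}, siteWt (q := 6) ![0, 1, 0, 1, 0, 2] s = 0 by decide]
    norm_num
  have h' : ENNReal.ofReal (3 / 23) ≤ influence (q := 6) (fun t s => (siteWt t s : ℝ)) 2 := by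
    refine le_trans (ENNReal.ofReal_le_ofReal ?_) (le_influence (q := 6)
      (fun t s => (siteWt t s : ℝ)) (j := 2) (t := ![0, 1, 2, 1, 2, 3])
      (t' := ![0, 1, 3, 1, 2, 3]) (by decide) {2})
    rw [normProb_natCast, normProb_natCast,
      show ∑ s ∈ {2}, siteWt (q := 6) ![0, 1, 2, 1, 2, 3] s = 9 by decide,
      show ∑ s, siteWt (q := 6) ![0, 1, 2, 1, 2, 3] s = 23 by decide,
      show ∑ s ∈ {2}, siteWt (q := 6) ![0, 1, 3, 1, 2, 3] s = 6 by decide,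
      show ∑ s, siteWt (q := 6) ![0, 1, 3, 1, 2, 3] s = 23 by decide]
    norm_num
  rw [dobrushin_topVertex]
  calc (1 : ℝ≥0∞) ≤ 2 * ENNReal.ofReal (3 / 7) + 4 * ENNReal.ofReal (3 / 23) := by
        rw [← ENNReal.ofReal_ofNat 2, ← ENNReal.ofReal_ofNat 4,
          ← ENNReal.ofReal_mul (by norm_num), ← ENNReal.ofReal_mul (by norm_num),
          ← ENNReal.ofReal_add (by norm_num) (by norm_num), ENNReal.one_le_ofReal]
        norm_num
    _ ≤ _ := by gcongr

theorem dobrushin_topVertex_lt_one_iff (hq : 5 ≤ q) :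
    (decimated kagome topVertex q).dobrushin < 1 ↔ 7 ≤ q := by
  refine ⟨fun h => ?_, dobrushin_topVertex_lt_one⟩
  by_contra hlt
  obtain rfl | rfl : q = 5 ∨ q = 6 := by omega
  · exact h.not_ge one_le_dobrushin_topVertex_five
  · exact h.not_ge one_le_dobrushin_topVertex_six

end SiteInfluence

/-! ### Results on the single-site decimation, and the Potts model for `q ≥ 7`. -/

section SiteModel

variable {q : ℕ}

theorem partition_topVertex_pos (hq : 5 ≤ q) (x : Remaining topVertex)
    (σ : Remaining topVertex → Fin q) :
    0 < (decimated kagome topVertex q).partition {x} σ := by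
  obtain ⟨i₁, i₂, nb, h⟩ := exists_siteChart x
  rw [(h.localChart q).partition_eq]
  exact sum_siteWt_pos hq _

theorem interdep_topVertex (q : ℕ) [NeZero q] :
    (∀ x y, SiteNN x y → (decimated kagome topVertex q).interdep x y =
      influence (q := q) (fun t s => (siteWt t s : ℝ)) 0) ∧
    (∀ x y, SiteNNN x y → (decimated kagome topVertex q).interdep x y =
      influence (q := q) (fun t s => (siteWt t s : ℝ)) 2) ∧
    (∀ x y, x ≠ y → ¬ SiteNN x y → ¬ SiteNNN x y →
      (decimated kagome topVertex q).interdep x y = 0) := by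
  obtain ⟨h1, h2⟩ := influence_siteWt q
  refine ⟨fun x y hxy => ?_, fun x y hxy => ?_, fun x y hne hn hnn => ?_⟩
  · obtain ⟨i₁, i₂, nb, h⟩ := exists_siteChart x
    rcases (h.nn y).1 hxy with rfl | rfl
    · exact (h.localChart q).interdep_eq 0
    · rw [(h.localChart q).interdep_eq 1, h1]
  · obtain ⟨i₁, i₂, nb, h⟩ := exists_siteChart x
    rcases (h.nnn y).1 hxy with rfl | rfl | rfl | rfl <;>
      rw [(h.localChart q).interdep_eq, h2 _ (by decide)]
  · obtain ⟨i₁, i₂, nb, h⟩ := exists_siteChart x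
    refine (h.localChart q).interdep_eq_zero fun j hj => ?_
    have e1 := h.nn y
    have e2 := h.nnn y
    fin_cases j <;> simp_all

theorem uniqueWithDecay_topVertex (hq : 7 ≤ q) :
    UniqueWithDecay (remDist topVertex) (decimated kagome topVertex q) := by
  have : NeZero q := ⟨by omega⟩
  exact decimable_topVertex.uniqueWithDecay_decimated isClique_topVertex
    (partition_topVertex_pos (by omega)) (dobrushin_topVertex_lt_one hq)

theorem uniqueWithDecay_kagome_of_seven_le (hq : 7 ≤ q) :
    UniqueWithDecay kagome.dist (potts kagome q) := by
  have : NeZero q := ⟨by omega⟩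
  refine decimable_topVertex.uniqueWithDecay_potts isClique_topVertex
    (partition_potts_kagome_pos (by omega)) (partition_topVertex_pos (by omega))
    (dobrushin_topVertex_lt_one hq) (fun i => ?_) (n := 7) (fun x => ?_)
  · obtain ⟨a, b, h⟩ := squareEquiv_borders i
    exact ⟨squareEquiv.symm (a, b), (h _).2 (by simp)⟩
  · obtain ⟨i₁, i₂, nb, h⟩ := exists_siteChart x
    refine ncard_closureOf_decimated_le (nb := nb) (fun y hy => ?_) (fun i hi y hy => ?_)
    · rcases (h.nn y).1 hy with rfl | rfl <;> exact ⟨_, rfl⟩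
    · rcases (h.borders i).1 hi with rfl | rfl
      · rcases (h.plaquette₁ y).1 hy with h | h | h | h
        · exact Or.inl h
        all_goals exact Or.inr ⟨_, h.symm⟩
      · rcases (h.plaquette₂ y).1 hy with h | h | h | h
        · exact Or.inl h
        all_goals exact Or.inr ⟨_, h.symm⟩

end SiteModel

end

end KagomePotts

namespace KagomePotts

noncomputable section

open Filter Topology LocalWeights

/-! ### Geometry of the triangle decimation. -/

section ClusterGeometry

/-- The vertices of the triangular faces that are summed out. -/
def trianglePt : (ℤ × ℤ) ⊕ (ℤ × ℤ) → Fin 3 → ℤ × ℤ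
  | .inl (i, j) => ![(4 * i + 2, 4 * j + 2), (4 * i + 3, 4 * j + 2), (4 * i + 2, 4 * j + 3)]
  | .inr (i, j) => ![(4 * i, 4 * j), (4 * i - 1, 4 * j), (4 * i, 4 * j - 1)]

theorem not_odd_trianglePt (i : (ℤ × ℤ) ⊕ (ℤ × ℤ)) (m : Fin 3) :
    ¬ (Odd (trianglePt i m).1 ∧ Odd (trianglePt i m).2) := by
  rcases i with ⟨i, j⟩ | ⟨i, j⟩ <;> fin_cases m <;> simp [trianglePt, Int.odd_iff] <;> omega

theorem mem_triangleCluster {i : (ℤ × ℤ) ⊕ (ℤ × ℤ)} {v : KagomeSite} :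
    v ∈ triangleCluster i ↔ ∃ m, trianglePt i m = v.1 := by
  rcases i with ⟨i, j⟩ | ⟨i, j⟩ <;>
    simp only [triangleCluster, trianglePt, Set.mem_ofPred_eq, Fin.exists_fin_succ,
      Matrix.cons_val_zero, Matrix.cons_val_succ, IsEmpty.exists_iff, or_false, eq_comm]

/-- The sites of a triangular face. -/
def triangleSite (i : (ℤ × ℤ) ⊕ (ℤ × ℤ)) (m : Fin 3) : triangleCluster i :=
  ⟨⟨trianglePt i m, not_odd_trianglePt i m⟩, mem_triangleCluster.2 ⟨m, rfl⟩⟩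

theorem trianglePt_injective (i : (ℤ × ℤ) ⊕ (ℤ × ℤ)) : Function.Injective (trianglePt i) := by
  intro m m' h
  rcases i with ⟨i, j⟩ | ⟨i, j⟩ <;> fin_cases m <;> fin_cases m' <;>
    simp [trianglePt] at h ⊢ <;> omega

/-- The enumeration of the sites of a triangular face. -/
def triangleSiteEquiv (i : (ℤ × ℤ) ⊕ (ℤ × ℤ)) : Fin 3 ≃ triangleCluster i :=
  Equiv.ofBijective (triangleSite i)
    ⟨fun _ _ h => trianglePt_injective i
      (congrArg (fun u : triangleCluster i => u.1.1) h), fun u => by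
      obtain ⟨m, hm⟩ := mem_triangleCluster.1 u.2
      exact ⟨m, Subtype.ext (Subtype.ext hm)⟩⟩

theorem ncard_triangleCluster (i : (ℤ × ℤ) ⊕ (ℤ × ℤ)) : (triangleCluster i).ncard = 3 := by
  rw [← Nat.card_coe_set_eq, ← Nat.card_congr (triangleSiteEquiv i), Nat.card_fin]

theorem isClique_triangleCluster (i : (ℤ × ℤ) ⊕ (ℤ × ℤ)) :
    kagome.IsClique (triangleCluster i) := by
  rintro ⟨⟨a, b⟩, h⟩ hu ⟨⟨c, d⟩, h'⟩ hv huv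
  rw [kagome_adj]
  rw [ne_eq, Subtype.mk.injEq, Prod.mk.injEq] at huv
  rcases i with ⟨i, j⟩ | ⟨i, j⟩ <;>
    simp only [triangleCluster, Set.mem_ofPred_eq, Prod.mk.injEq] at hu hv <;>
    rcases hu with ⟨rfl, rfl⟩ | ⟨rfl, rfl⟩ | ⟨rfl, rfl⟩ <;>
    rcases hv with ⟨rfl, rfl⟩ | ⟨rfl, rfl⟩ | ⟨rfl, rfl⟩ <;> omega

theorem separated_triangleCluster : SeparatedClusters kagome triangleCluster := by
  intro i i' hne
  suffices h : ∀ u ∈ triangleCluster i, ∀ v ∈ triangleCluster i', u ≠ v ∧ ¬ kagome.Adj u v from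
    ⟨Set.disjoint_left.2 fun u hu hu' => (h u hu u hu').1 rfl, fun u hu v hv => (h u hu v hv).2⟩
  rintro ⟨⟨a, b⟩, h⟩ hu ⟨⟨c, d⟩, h'⟩ hv
  rw [kagome_adj, ne_eq, Subtype.mk.injEq, Prod.mk.injEq]
  rcases i with ⟨i, j⟩ | ⟨i, j⟩ <;> rcases i' with ⟨i', j'⟩ | ⟨i', j'⟩ <;>
    simp only [triangleCluster, Set.mem_ofPred_eq, Prod.mk.injEq, ne_eq, Sum.inl.injEq,
      Sum.inr.injEq] at hu hv hne <;>
    rcases hu with ⟨rfl, rfl⟩ | ⟨rfl, rfl⟩ | ⟨rfl, rfl⟩ <;>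
    rcases hv with ⟨rfl, rfl⟩ | ⟨rfl, rfl⟩ | ⟨rfl, rfl⟩ <;> omega

theorem decimable_triangleCluster : Decimable kagome triangleCluster where
  finite_adj := finite_adj_kagome
  finite_cluster i := Set.finite_of_ncard_ne_zero (by rw [ncard_triangleCluster]; norm_num)
  separated := separated_triangleCluster

/-- The points that remain when the triangular faces are summed out. -/
def IsClusterRem (p : ℤ × ℤ) : Prop := p.1 % 4 ≠ 3 ∧ p.2 % 4 ≠ 3 ∧ p.1 % 4 ≠ p.2 % 4

theorem isClusterRem (x : Remaining triangleCluster) : IsClusterRem x.1.1 := by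
  obtain ⟨⟨⟨a, b⟩, h⟩, hx⟩ := x
  simp only [Int.odd_iff] at h
  simp only [IsClusterRem]
  by_contra hc
  have key : ∃ i m, trianglePt i m = (a, b) := by
    have ha := Int.emod_add_mul_ediv a 4
    have hb := Int.emod_add_mul_ediv b 4
    have h' : (a % 4 = 2 ∧ b % 4 = 2) ∨ (a % 4 = 3 ∧ b % 4 = 2) ∨ (a % 4 = 2 ∧ b % 4 = 3) ∨
        (a % 4 = 0 ∧ b % 4 = 0) ∨ (a % 4 = 3 ∧ b % 4 = 0) ∨ (a % 4 = 0 ∧ b % 4 = 3) := by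
      omega
    rcases h' with h' | h' | h' | h' | h' | h'
    · exact ⟨.inl (a / 4, b / 4), 0, Prod.ext (by simp [trianglePt]; omega)
        (by simp [trianglePt]; omega)⟩
    · exact ⟨.inl (a / 4, b / 4), 1, Prod.ext (by simp [trianglePt]; omega)
        (by simp [trianglePt]; omega)⟩
    · exact ⟨.inl (a / 4, b / 4), 2, Prod.ext (by simp [trianglePt]; omega)
        (by simp [trianglePt]; omega)⟩
    · exact ⟨.inr (a / 4, b / 4), 0, Prod.ext (by simp [trianglePt]; omega)
        (by simp [trianglePt]; omega)⟩
    · exact ⟨.inr (a / 4 + 1, b / 4), 1, Prod.ext (by simp [trianglePt]; omega)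
        (by simp [trianglePt]; omega)⟩
    · exact ⟨.inr (a / 4, b / 4 + 1), 2, Prod.ext (by simp [trianglePt]; omega)
        (by simp [trianglePt]; omega)⟩
  obtain ⟨i, m, him⟩ := key
  exact hx i (mem_triangleCluster.2 ⟨m, him⟩)

/-- The remaining site with given coordinates. -/
def clusterRem (p : ℤ × ℤ) (h : IsClusterRem p) : Remaining triangleCluster :=
  ⟨⟨p, by
    obtain ⟨h1, h2, h3⟩ := h
    simp only [Int.odd_iff]
    omega⟩, fun i hi => by
    obtain ⟨a, b⟩ := p
    obtain ⟨h1, h2, h3⟩ := h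
    rcases i with ⟨i, j⟩ | ⟨i, j⟩ <;>
      simp only [triangleCluster, Set.mem_ofPred_eq, Prod.mk.injEq] at hi h1 h2 h3 <;> omega⟩

theorem exists_clusterRem (x : Remaining triangleCluster) : ∃ p h, x = clusterRem p h :=
  ⟨x.1.1, isClusterRem x, rfl⟩

theorem clusterRem_inj {p p' : ℤ × ℤ} {h h'} : clusterRem p h = clusterRem p' h' ↔ p = p' :=
  ⟨fun e => congrArg (fun x : Remaining triangleCluster => x.1.1) e, fun e => by subst e; rfl⟩

/-- Coordinates in which the remaining sites form a hexagonal lattice. -/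
def hexEquiv : Remaining triangleCluster ≃ HexSite where
  -- Remaining coordinates have residues 0, 1, 2 modulo 4. Subtracting the quotient by 4 relabels
  -- these as residues modulo 3, and the condition of unequal residues becomes that 3 does not
  -- divide the difference.
  toFun x := ⟨(x.1.1.1 - x.1.1.1 / 4, x.1.1.2 - x.1.1.2 / 4), by
    obtain ⟨h1, h2, h3⟩ := isClusterRem x
    simp only
    omega⟩
  invFun p := clusterRem (p.1.1 + p.1.1 / 3, p.1.2 + p.1.2 / 3) (by
    have := p.2
    simp only [IsClusterRem]
    omega)
  left_inv x := by
    obtain ⟨h1, h2, h3⟩ := isClusterRem x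
    refine Subtype.ext (Subtype.ext (Prod.ext ?_ ?_)) <;> simp only [clusterRem] <;> omega
  right_inv p := by
    refine Subtype.ext (Prod.ext ?_ ?_) <;> simp only [clusterRem] <;> omega

/-- The point of the hexagonal lattice in which a remaining site is placed. -/
def hexPt (p : ℤ × ℤ) : ℤ × ℤ := (p.1 - p.1 / 4, p.2 - p.2 / 4)

theorem hexagonal_adj_hexEquiv {p p' : ℤ × ℤ} {h h'} :
    hexagonal.Adj (hexEquiv (clusterRem p h)) (hexEquiv (clusterRem p' h')) ↔
      triangular.Adj (hexPt p) (hexPt p') := Iff.rfl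

theorem borders_triangleCluster {i : (ℤ × ℤ) ⊕ (ℤ × ℤ)} {x : Remaining triangleCluster} :
    Borders kagome triangleCluster i x ↔ ∃ m, triangular.Adj (trianglePt i m) x.1.1 := by
  constructor
  · rintro ⟨u, hu, hadj⟩
    obtain ⟨m, hm⟩ := mem_triangleCluster.1 hu
    exact ⟨m, hm ▸ hadj⟩
  · rintro ⟨m, hm⟩
    exact ⟨triangleSite i m, (triangleSite i m).2, hm⟩

theorem borders_inl {i j : ℤ} {p : ℤ × ℤ} {h} :
    Borders kagome triangleCluster (.inl (i, j)) (clusterRem p h) ↔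
      p ∈ ({(4 * i + 1, 4 * j + 2), (4 * i + 2, 4 * j + 1), (4 * i + 4, 4 * j + 2),
        (4 * i + 4, 4 * j + 1), (4 * i + 2, 4 * j + 4), (4 * i + 1, 4 * j + 4)} :
          Set (ℤ × ℤ)) := by
  rw [borders_triangleCluster]
  obtain ⟨c, d⟩ := p
  obtain ⟨h1, h2, h3⟩ := h
  simp only [clusterRem, trianglePt, triangular, Fin.exists_fin_succ, Matrix.cons_val_zero,
    Matrix.cons_val_succ, IsEmpty.exists_iff, or_false, Set.mem_insert_iff,
    Set.mem_singleton_iff, Prod.mk.injEq] at *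
  constructor
  · rintro ((h | h | h | h | h | h) | (h | h | h | h | h | h) | (h | h | h | h | h | h)) <;> omega
  · clear h1 h2 h3
    rintro (⟨rfl, rfl⟩ | ⟨rfl, rfl⟩ | ⟨rfl, rfl⟩ | ⟨rfl, rfl⟩ | ⟨rfl, rfl⟩ | ⟨rfl, rfl⟩) <;>
      ring_nf <;> simp

theorem borders_inr {i j : ℤ} {p : ℤ × ℤ} {h} :
    Borders kagome triangleCluster (.inr (i, j)) (clusterRem p h) ↔
      p ∈ ({(4 * i + 1, 4 * j), (4 * i, 4 * j + 1), (4 * i - 2, 4 * j),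
        (4 * i - 2, 4 * j + 1), (4 * i, 4 * j - 2), (4 * i + 1, 4 * j - 2)} :
          Set (ℤ × ℤ)) := by
  rw [borders_triangleCluster]
  obtain ⟨c, d⟩ := p
  obtain ⟨h1, h2, h3⟩ := h
  simp only [clusterRem, trianglePt, triangular, Fin.exists_fin_succ, Matrix.cons_val_zero,
    Matrix.cons_val_succ, IsEmpty.exists_iff, or_false, Set.mem_insert_iff,
    Set.mem_singleton_iff, Prod.mk.injEq] at *
  constructor
  · rintro ((h | h | h | h | h | h) | (h | h | h | h | h | h) | (h | h | h | h | h | h)) <;> omega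
  · clear h1 h2 h3
    rintro (⟨rfl, rfl⟩ | ⟨rfl, rfl⟩ | ⟨rfl, rfl⟩ | ⟨rfl, rfl⟩ | ⟨rfl, rfl⟩ | ⟨rfl, rfl⟩) <;>
      ring_nf <;> simp

theorem hexEquiv_borders (i : (ℤ × ℤ) ⊕ (ℤ × ℤ)) : ∃ p : ℤ × ℤ, (3 : ℤ) ∣ p.1 - p.2 ∧
    ∀ x, Borders kagome triangleCluster i x ↔ triangular.Adj p (hexEquiv x) := by
  rcases i with ⟨i, j⟩ | ⟨i, j⟩
  · refine ⟨(3 * i + 2, 3 * j + 2), by simp only; omega, fun x => ?_⟩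
    obtain ⟨⟨c, d⟩, h, rfl⟩ := exists_clusterRem x
    rw [borders_inl]
    obtain ⟨h1, h2, h3⟩ := h
    simp only [clusterRem, hexEquiv, Equiv.coe_fn_mk, triangular, Set.mem_insert_iff,
      Set.mem_singleton_iff, Prod.mk.injEq] at *
    constructor
    · rintro (h | h | h | h | h | h) <;> omega
    · rintro (h | h | h | h | h | h) <;> omega
  · refine ⟨(3 * i, 3 * j), by simp only; omega, fun x => ?_⟩
    obtain ⟨⟨c, d⟩, h, rfl⟩ := exists_clusterRem x
    rw [borders_inr]
    obtain ⟨h1, h2, h3⟩ := h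
    simp only [clusterRem, hexEquiv, Equiv.coe_fn_mk, triangular, Set.mem_insert_iff,
      Set.mem_singleton_iff, Prod.mk.injEq] at *
    constructor
    · rintro (h | h | h | h | h | h) <;> omega
    · rintro (h | h | h | h | h | h) <;> omega

end ClusterGeometry

end

end KagomePotts

namespace KagomePotts

noncomputable section

open Filter Topology LocalWeights

/-! ### Neighbourhood charts for the triangle decimation. -/

section ClusterCharts

/-- The neighbourhood of a site in the lattice from which triangular faces were removed. Its
neighbours are numbered as follows: the first neighbours on the two plaquettes, the second
neighbour, the fourth neighbours on the two plaquettes, and the third neighbours, two on each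
plaquette. -/
structure ClusterChart (x : Remaining triangleCluster) (i₁ i₂ : (ℤ × ℤ) ⊕ (ℤ × ℤ))
    (nb : Fin 9 → Remaining triangleCluster) : Prop where
  injective : Function.Injective nb
  ne : ∀ j, nb j ≠ x
  index_ne : i₁ ≠ i₂
  link : ∀ y, Cluster1 x y ↔ y = nb 0 ∨ y = nb 1
  link₂ : ∀ y, Cluster1 (nb 2) y ↔ y = nb 3 ∨ y = nb 4
  borders : ∀ i, Borders kagome triangleCluster i x ↔ i = i₁ ∨ i = i₂
  triangle₁ : ∃ k : Fin 3 ≃ triangleCluster i₁, ∀ y : Remaining triangleCluster,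
    (kagome.Adj (k 0) y ↔ y = x ∨ y = nb 0) ∧ (kagome.Adj (k 1) y ↔ y = nb 2 ∨ y = nb 3) ∧
      (kagome.Adj (k 2) y ↔ y = nb 5 ∨ y = nb 6)
  triangle₂ : ∃ k : Fin 3 ≃ triangleCluster i₂, ∀ y : Remaining triangleCluster,
    (kagome.Adj (k 0) y ↔ y = x ∨ y = nb 1) ∧ (kagome.Adj (k 1) y ↔ y = nb 2 ∨ y = nb 4) ∧
      (kagome.Adj (k 2) y ↔ y = nb 7 ∨ y = nb 8)
  hex : ∀ y, hexagonal.Adj (hexEquiv x) (hexEquiv y) ↔ y = nb 0 ∨ y = nb 1 ∨ y = nb 2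

/-- Every remaining site borders exactly one up-pointing and one down-pointing removed triangle,
hence the indices `.inl i` and `.inr j`. What is left to check are statements about integers. -/
theorem clusterChart_of_coordinates {p i j : ℤ × ℤ} {f : Fin 9 → ℤ × ℤ}
    {π₁ π₂ : Equiv.Perm (Fin 3)} (hp : IsClusterRem p) (hf : ∀ a, IsClusterRem (f a))
    (hinj : ∀ a b, f a = f b → a = b) (hne : ∀ a, f a ≠ p)
    (hl : ∀ r, IsClusterRem r → (triangular.Adj p r ↔ r = f 0 ∨ r = f 1))
    (hl₂ : ∀ r, IsClusterRem r → (triangular.Adj (f 2) r ↔ r = f 3 ∨ r = f 4))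
    (hb₁ : ∀ k, (∃ m, triangular.Adj (trianglePt (.inl k) m) p) ↔ k = i)
    (hb₂ : ∀ k, (∃ m, triangular.Adj (trianglePt (.inr k) m) p) ↔ k = j)
    (h₁₀ : ∀ r, IsClusterRem r →
      (triangular.Adj (trianglePt (.inl i) (π₁ 0)) r ↔ r = p ∨ r = f 0))
    (h₁₁ : ∀ r, IsClusterRem r →
      (triangular.Adj (trianglePt (.inl i) (π₁ 1)) r ↔ r = f 2 ∨ r = f 3))
    (h₁₂ : ∀ r, IsClusterRem r →
      (triangular.Adj (trianglePt (.inl i) (π₁ 2)) r ↔ r = f 5 ∨ r = f 6))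
    (h₂₀ : ∀ r, IsClusterRem r →
      (triangular.Adj (trianglePt (.inr j) (π₂ 0)) r ↔ r = p ∨ r = f 1))
    (h₂₁ : ∀ r, IsClusterRem r →
      (triangular.Adj (trianglePt (.inr j) (π₂ 1)) r ↔ r = f 2 ∨ r = f 4))
    (h₂₂ : ∀ r, IsClusterRem r →
      (triangular.Adj (trianglePt (.inr j) (π₂ 2)) r ↔ r = f 7 ∨ r = f 8))
    (hhex : ∀ r, IsClusterRem r →
      (triangular.Adj (hexPt p) (hexPt r) ↔ r = f 0 ∨ r = f 1 ∨ r = f 2)) :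
    ClusterChart (clusterRem p hp) (.inl i) (.inr j) fun a => clusterRem (f a) (hf a) where
  injective a b hab := hinj a b (clusterRem_inj.1 hab)
  ne a h := hne a (clusterRem_inj.1 h)
  index_ne := Sum.inl_ne_inr
  link y := by
    obtain ⟨r, h, rfl⟩ := exists_clusterRem y
    rw [clusterRem_inj, clusterRem_inj]
    exact hl r h
  link₂ y := by
    obtain ⟨r, h, rfl⟩ := exists_clusterRem y
    rw [clusterRem_inj, clusterRem_inj]
    exact hl₂ r h
  borders k := by
    rw [borders_triangleCluster]
    rcases k with k | k
    · rw [Sum.inl.injEq, or_iff_left Sum.inl_ne_inr]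
      exact hb₁ k
    · rw [Sum.inr.injEq, or_iff_right Sum.inr_ne_inl]
      exact hb₂ k
  triangle₁ := ⟨π₁.trans (triangleSiteEquiv (.inl i)), fun y => by
    obtain ⟨r, h, rfl⟩ := exists_clusterRem y
    simp only [clusterRem_inj]
    exact ⟨h₁₀ r h, h₁₁ r h, h₁₂ r h⟩⟩
  triangle₂ := ⟨π₂.trans (triangleSiteEquiv (.inr j)), fun y => by
    obtain ⟨r, h, rfl⟩ := exists_clusterRem y
    simp only [clusterRem_inj]
    exact ⟨h₂₀ r h, h₂₁ r h, h₂₂ r h⟩⟩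
  hex y := by
    obtain ⟨r, h, rfl⟩ := exists_clusterRem y
    rw [hexagonal_adj_hexEquiv, hhex r h]
    simp only [clusterRem_inj]

/-- This is the first of six residue classes modulo 4 of remaining sites. Each has its own list of
neighbours, in the numbering of `ClusterChart`. -/
theorem exists_clusterChart_zero_one (i j : ℤ) (h : IsClusterRem (4 * i, 4 * j + 1)) :
    ∃ i₁ i₂ nb, ClusterChart (clusterRem (4 * i, 4 * j + 1) h) i₁ i₂ nb := by
  refine ⟨_, _, _, clusterChart_of_coordinates
    (i := (i - 1, j)) (j := (i, j))
    (f := ![(4 * i, 4 * j + 2), (4 * i + 1, 4 * j), (4 * i - 2, 4 * j + 1),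
      (4 * i - 3, 4 * j + 2), (4 * i - 2, 4 * j), (4 * i - 3, 4 * j + 4),
      (4 * i - 2, 4 * j + 4), (4 * i, 4 * j - 2), (4 * i + 1, 4 * j - 2)])
    -- The permutations reorder the triangle: vertex 0 is the one next to the site and its first
    -- neighbour, vertex 1 the one next to the second and fourth neighbours, vertex 2 the one next
    -- to the third neighbours.
    (π₁ := ⟨![1, 0, 2], ![1, 0, 2], by decide, by decide⟩)
    (π₂ := ⟨![0, 1, 2], ![0, 1, 2], by decide, by decide⟩)
    h ?_ ?_ ?_ ?_ ?_ ?_ ?_ ?_ ?_ ?_ ?_ ?_ ?_ ?_⟩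
  · intro a
    fin_cases a <;> simp [IsClusterRem]
  · intro a b
    fin_cases a <;> fin_cases b <;> simp <;> omega
  · intro a
    fin_cases a <;> simp <;> omega
  iterate 2
    rintro ⟨c, d⟩ ⟨k1, k2, k3⟩
    simp [triangular] at k1 k2 k3 ⊢
    constructor
    · rintro (h | h | h | h | h | h) <;> omega
    · clear k1 k2 k3
      rintro (⟨rfl, rfl⟩ | ⟨rfl, rfl⟩) <;> ring_nf <;> simp
  iterate 2
    rintro ⟨k, l⟩
    simp [triangular, trianglePt, Fin.exists_fin_succ]
    constructor
    · rintro ((h | h | h | h | h | h) | (h | h | h | h | h | h) | (h | h | h | h | h | h)) <;>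
        omega
    · rintro ⟨rfl, rfl⟩
      ring_nf
      simp
  iterate 6
    rintro ⟨c, d⟩ ⟨k1, k2, k3⟩
    simp [triangular, trianglePt] at k1 k2 k3 ⊢
    constructor
    · rintro (h | h | h | h | h | h) <;> omega
    · clear k1 k2 k3
      rintro (⟨rfl, rfl⟩ | ⟨rfl, rfl⟩) <;> ring_nf <;> simp
  · rintro ⟨c, d⟩ ⟨k1, k2, k3⟩
    simp [triangular, hexPt] at k1 k2 k3 ⊢
    constructor
    · rintro (h | h | h | h | h | h) <;> omega
    · rintro (h | h | h) <;> omega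

theorem exists_clusterChart_zero_two (i j : ℤ) (h : IsClusterRem (4 * i, 4 * j + 2)) :
    ∃ i₁ i₂ nb, ClusterChart (clusterRem (4 * i, 4 * j + 2) h) i₁ i₂ nb := by
  refine ⟨_, _, _, clusterChart_of_coordinates
    (i := (i - 1, j)) (j := (i, j + 1))
    (f := ![(4 * i, 4 * j + 1), (4 * i + 1, 4 * j + 2), (4 * i - 2, 4 * j + 4),
      (4 * i - 3, 4 * j + 4), (4 * i - 2, 4 * j + 5), (4 * i - 3, 4 * j + 2),
      (4 * i - 2, 4 * j + 1), (4 * i, 4 * j + 5), (4 * i + 1, 4 * j + 4)])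
    (π₁ := ⟨![1, 2, 0], ![2, 0, 1], by decide, by decide⟩)
    (π₂ := ⟨![2, 1, 0], ![2, 1, 0], by decide, by decide⟩)
    h ?_ ?_ ?_ ?_ ?_ ?_ ?_ ?_ ?_ ?_ ?_ ?_ ?_ ?_⟩
  · intro a
    fin_cases a <;> simp [IsClusterRem]
  · intro a b
    fin_cases a <;> fin_cases b <;> simp <;> omega
  · intro a
    fin_cases a <;> simp
  iterate 2
    rintro ⟨c, d⟩ ⟨k1, k2, k3⟩
    simp [triangular] at k1 k2 k3 ⊢
    constructor
    · rintro (h | h | h | h | h | h) <;> omega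
    · clear k1 k2 k3
      rintro (⟨rfl, rfl⟩ | ⟨rfl, rfl⟩) <;> ring_nf <;> simp
  iterate 2
    rintro ⟨k, l⟩
    simp [triangular, trianglePt, Fin.exists_fin_succ]
    constructor
    · rintro ((h | h | h | h | h | h) | (h | h | h | h | h | h) | (h | h | h | h | h | h)) <;>
        omega
    · rintro ⟨rfl, rfl⟩
      ring_nf
      simp
  iterate 6
    rintro ⟨c, d⟩ ⟨k1, k2, k3⟩
    simp [triangular, trianglePt] at k1 k2 k3 ⊢
    constructor
    · rintro (h | h | h | h | h | h) <;> omega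
    · clear k1 k2 k3
      rintro (⟨rfl, rfl⟩ | ⟨rfl, rfl⟩) <;> ring_nf <;> simp
  · rintro ⟨c, d⟩ ⟨k1, k2, k3⟩
    simp [triangular, hexPt] at k1 k2 k3 ⊢
    constructor
    · rintro (h | h | h | h | h | h) <;> omega
    · rintro (h | h | h) <;> omega

theorem exists_clusterChart_one_zero (i j : ℤ) (h : IsClusterRem (4 * i + 1, 4 * j)) :
    ∃ i₁ i₂ nb, ClusterChart (clusterRem (4 * i + 1, 4 * j) h) i₁ i₂ nb := by
  refine ⟨_, _, _, clusterChart_of_coordinates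
    (i := (i, j - 1)) (j := (i, j))
    (f := ![(4 * i + 2, 4 * j), (4 * i, 4 * j + 1), (4 * i + 1, 4 * j - 2),
      (4 * i + 2, 4 * j - 3), (4 * i, 4 * j - 2), (4 * i + 4, 4 * j - 3),
      (4 * i + 4, 4 * j - 2), (4 * i - 2, 4 * j), (4 * i - 2, 4 * j + 1)])
    (π₁ := ⟨![2, 0, 1], ![1, 2, 0], by decide, by decide⟩)
    (π₂ := ⟨![0, 2, 1], ![0, 2, 1], by decide, by decide⟩)
    h ?_ ?_ ?_ ?_ ?_ ?_ ?_ ?_ ?_ ?_ ?_ ?_ ?_ ?_⟩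
  · intro a
    fin_cases a <;> simp [IsClusterRem]
  · intro a b
    fin_cases a <;> fin_cases b <;> simp <;> omega
  · intro a
    fin_cases a <;> simp <;> omega
  iterate 2
    rintro ⟨c, d⟩ ⟨k1, k2, k3⟩
    simp [triangular] at k1 k2 k3 ⊢
    constructor
    · rintro (h | h | h | h | h | h) <;> omega
    · clear k1 k2 k3
      rintro (⟨rfl, rfl⟩ | ⟨rfl, rfl⟩) <;> ring_nf <;> simp
  iterate 2
    rintro ⟨k, l⟩
    simp [triangular, trianglePt, Fin.exists_fin_succ]
    constructor
    · rintro ((h | h | h | h | h | h) | (h | h | h | h | h | h) | (h | h | h | h | h | h)) <;>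
        omega
    · rintro ⟨rfl, rfl⟩
      ring_nf
      simp
  iterate 6
    rintro ⟨c, d⟩ ⟨k1, k2, k3⟩
    simp [triangular, trianglePt] at k1 k2 k3 ⊢
    constructor
    · rintro (h | h | h | h | h | h) <;> omega
    · clear k1 k2 k3
      rintro (⟨rfl, rfl⟩ | ⟨rfl, rfl⟩) <;> ring_nf <;> simp
  · rintro ⟨c, d⟩ ⟨k1, k2, k3⟩
    simp [triangular, hexPt] at k1 k2 k3 ⊢
    constructor
    · rintro (h | h | h | h | h | h) <;> omega
    · rintro (h | h | h) <;> omega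

theorem exists_clusterChart_one_two (i j : ℤ) (h : IsClusterRem (4 * i + 1, 4 * j + 2)) :
    ∃ i₁ i₂ nb, ClusterChart (clusterRem (4 * i + 1, 4 * j + 2) h) i₁ i₂ nb := by
  refine ⟨_, _, _, clusterChart_of_coordinates
    (i := (i, j)) (j := (i, j + 1))
    (f := ![(4 * i + 2, 4 * j + 1), (4 * i, 4 * j + 2), (4 * i + 1, 4 * j + 4),
      (4 * i + 2, 4 * j + 4), (4 * i, 4 * j + 5), (4 * i + 4, 4 * j + 2),
      (4 * i + 4, 4 * j + 1), (4 * i - 2, 4 * j + 5), (4 * i - 2, 4 * j + 4)])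
    (π₁ := ⟨![0, 2, 1], ![0, 2, 1], by decide, by decide⟩)
    (π₂ := ⟨![2, 0, 1], ![1, 2, 0], by decide, by decide⟩)
    h ?_ ?_ ?_ ?_ ?_ ?_ ?_ ?_ ?_ ?_ ?_ ?_ ?_ ?_⟩
  · intro a
    fin_cases a <;> simp [IsClusterRem]
  · intro a b
    fin_cases a <;> fin_cases b <;> simp <;> omega
  · intro a
    fin_cases a <;> simp
  iterate 2
    rintro ⟨c, d⟩ ⟨k1, k2, k3⟩
    simp [triangular] at k1 k2 k3 ⊢
    constructor
    · rintro (h | h | h | h | h | h) <;> omega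
    · clear k1 k2 k3
      rintro (⟨rfl, rfl⟩ | ⟨rfl, rfl⟩) <;> ring_nf <;> simp
  iterate 2
    rintro ⟨k, l⟩
    simp [triangular, trianglePt, Fin.exists_fin_succ]
    constructor
    · rintro ((h | h | h | h | h | h) | (h | h | h | h | h | h) | (h | h | h | h | h | h)) <;>
        omega
    · rintro ⟨rfl, rfl⟩
      ring_nf
      simp
  iterate 6
    rintro ⟨c, d⟩ ⟨k1, k2, k3⟩
    simp [triangular, trianglePt] at k1 k2 k3 ⊢
    constructor
    · rintro (h | h | h | h | h | h) <;> omega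
    · clear k1 k2 k3
      rintro (⟨rfl, rfl⟩ | ⟨rfl, rfl⟩) <;> ring_nf <;> simp
  · rintro ⟨c, d⟩ ⟨k1, k2, k3⟩
    simp [triangular, hexPt] at k1 k2 k3 ⊢
    constructor
    · rintro (h | h | h | h | h | h) <;> omega
    · rintro (h | h | h) <;> omega

theorem exists_clusterChart_two_zero (i j : ℤ) (h : IsClusterRem (4 * i + 2, 4 * j)) :
    ∃ i₁ i₂ nb, ClusterChart (clusterRem (4 * i + 2, 4 * j) h) i₁ i₂ nb := by
  refine ⟨_, _, _, clusterChart_of_coordinates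
    (i := (i, j - 1)) (j := (i + 1, j))
    (f := ![(4 * i + 1, 4 * j), (4 * i + 2, 4 * j + 1), (4 * i + 4, 4 * j - 2),
      (4 * i + 4, 4 * j - 3), (4 * i + 5, 4 * j - 2), (4 * i + 2, 4 * j - 3),
      (4 * i + 1, 4 * j - 2), (4 * i + 5, 4 * j), (4 * i + 4, 4 * j + 1)])
    (π₁ := ⟨![2, 1, 0], ![2, 1, 0], by decide, by decide⟩)
    (π₂ := ⟨![1, 2, 0], ![2, 0, 1], by decide, by decide⟩)
    h ?_ ?_ ?_ ?_ ?_ ?_ ?_ ?_ ?_ ?_ ?_ ?_ ?_ ?_⟩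
  · intro a
    fin_cases a <;> simp [IsClusterRem]
  · intro a b
    fin_cases a <;> fin_cases b <;> simp <;> omega
  · intro a
    fin_cases a <;> simp
  iterate 2
    rintro ⟨c, d⟩ ⟨k1, k2, k3⟩
    simp [triangular] at k1 k2 k3 ⊢
    constructor
    · rintro (h | h | h | h | h | h) <;> omega
    · clear k1 k2 k3
      rintro (⟨rfl, rfl⟩ | ⟨rfl, rfl⟩) <;> ring_nf <;> simp
  iterate 2
    rintro ⟨k, l⟩
    simp [triangular, trianglePt, Fin.exists_fin_succ]
    constructor
    · rintro ((h | h | h | h | h | h) | (h | h | h | h | h | h) | (h | h | h | h | h | h)) <;>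
        omega
    · rintro ⟨rfl, rfl⟩
      ring_nf
      simp
  iterate 6
    rintro ⟨c, d⟩ ⟨k1, k2, k3⟩
    simp [triangular, trianglePt] at k1 k2 k3 ⊢
    constructor
    · rintro (h | h | h | h | h | h) <;> omega
    · clear k1 k2 k3
      rintro (⟨rfl, rfl⟩ | ⟨rfl, rfl⟩) <;> ring_nf <;> simp
  · rintro ⟨c, d⟩ ⟨k1, k2, k3⟩
    simp [triangular, hexPt] at k1 k2 k3 ⊢
    constructor
    · rintro (h | h | h | h | h | h) <;> omega
    · rintro (h | h | h) <;> omega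

theorem exists_clusterChart_two_one (i j : ℤ) (h : IsClusterRem (4 * i + 2, 4 * j + 1)) :
    ∃ i₁ i₂ nb, ClusterChart (clusterRem (4 * i + 2, 4 * j + 1) h) i₁ i₂ nb := by
  refine ⟨_, _, _, clusterChart_of_coordinates
    (i := (i, j)) (j := (i + 1, j))
    (f := ![(4 * i + 1, 4 * j + 2), (4 * i + 2, 4 * j), (4 * i + 4, 4 * j + 1),
      (4 * i + 4, 4 * j + 2), (4 * i + 5, 4 * j), (4 * i + 2, 4 * j + 4),
      (4 * i + 1, 4 * j + 4), (4 * i + 5, 4 * j - 2), (4 * i + 4, 4 * j - 2)])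
    (π₁ := ⟨![0, 1, 2], ![0, 1, 2], by decide, by decide⟩)
    (π₂ := ⟨![1, 0, 2], ![1, 0, 2], by decide, by decide⟩)
    h ?_ ?_ ?_ ?_ ?_ ?_ ?_ ?_ ?_ ?_ ?_ ?_ ?_ ?_⟩
  · intro a
    fin_cases a <;> simp [IsClusterRem]
  · intro a b
    fin_cases a <;> fin_cases b <;> simp <;> omega
  · intro a
    fin_cases a <;> simp
  iterate 2
    rintro ⟨c, d⟩ ⟨k1, k2, k3⟩
    simp [triangular] at k1 k2 k3 ⊢
    constructor
    · rintro (h | h | h | h | h | h) <;> omega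
    · clear k1 k2 k3
      rintro (⟨rfl, rfl⟩ | ⟨rfl, rfl⟩) <;> ring_nf <;> simp
  iterate 2
    rintro ⟨k, l⟩
    simp [triangular, trianglePt, Fin.exists_fin_succ]
    constructor
    · rintro ((h | h | h | h | h | h) | (h | h | h | h | h | h) | (h | h | h | h | h | h)) <;>
        omega
    · rintro ⟨rfl, rfl⟩
      ring_nf
      simp
  iterate 6
    rintro ⟨c, d⟩ ⟨k1, k2, k3⟩
    simp [triangular, trianglePt] at k1 k2 k3 ⊢
    constructor
    · rintro (h | h | h | h | h | h) <;> omega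
    · clear k1 k2 k3
      rintro (⟨rfl, rfl⟩ | ⟨rfl, rfl⟩) <;> ring_nf <;> simp
  · rintro ⟨c, d⟩ ⟨k1, k2, k3⟩
    simp [triangular, hexPt] at k1 k2 k3 ⊢
    constructor
    · rintro (h | h | h | h | h | h) <;> omega
    · rintro (h | h | h) <;> omega

theorem exists_clusterChart (x : Remaining triangleCluster) :
    ∃ i₁ i₂ nb, ClusterChart x i₁ i₂ nb := by
  obtain ⟨⟨c, d⟩, h, rfl⟩ := exists_clusterRem x
  obtain ⟨h1, h2, h3⟩ := id h
  simp only at h1 h2 h3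
  obtain ⟨i, j, hij⟩ : ∃ i j, (c, d) = (4 * i, 4 * j + 1)
      ∨ (c, d) = (4 * i, 4 * j + 2)
      ∨ (c, d) = (4 * i + 1, 4 * j)
      ∨ (c, d) = (4 * i + 1, 4 * j + 2)
      ∨ (c, d) = (4 * i + 2, 4 * j)
      ∨ (c, d) = (4 * i + 2, 4 * j + 1) := by
    refine ⟨c / 4, d / 4, ?_⟩
    simp only [Prod.mk.injEq]
    omega
  simp only [Prod.mk.injEq] at hij
  rcases hij with ⟨rfl, rfl⟩ | ⟨rfl, rfl⟩ | ⟨rfl, rfl⟩ | ⟨rfl, rfl⟩ | ⟨rfl, rfl⟩ | ⟨rfl, rfl⟩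
  · exact exists_clusterChart_zero_one i j h
  · exact exists_clusterChart_zero_two i j h
  · exact exists_clusterChart_one_zero i j h
  · exact exists_clusterChart_one_two i j h
  · exact exists_clusterChart_two_zero i j h
  · exact exists_clusterChart_two_one i j h

end ClusterCharts

end

end KagomePotts

namespace KagomePotts

noncomputable section

open Filter Topology LocalWeights

/-! ### Colourings of a triangle with forbidden colours. -/

section TripleWeights

variable {q : ℕ}

/-- The number of triples of distinct elements of three given sets. -/
def distinctTriples (L₁ L₂ L₃ : Finset (Fin q)) : ℕ :=
  ((L₁ ×ˢ L₂ ×ˢ L₃).filter fun η => η.1 ≠ η.2.1 ∧ η.1 ≠ η.2.2 ∧ η.2.1 ≠ η.2.2).card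

/-- This is inclusion–exclusion: pairwise coincidences are subtracted, and a triple coincidence,
subtracted three times, is added back twice. -/
theorem distinctTriples_eq (L₁ L₂ L₃ : Finset (Fin q)) :
    (distinctTriples L₁ L₂ L₃ : ℤ) = L₁.card * L₂.card * L₃.card + 2 * (L₁ ∩ L₂ ∩ L₃).card -
      (L₁ ∩ L₂).card * L₃.card - (L₁ ∩ L₃).card * L₂.card - (L₂ ∩ L₃).card * L₁.card := by
  have h2 : ∀ (M N : Finset (Fin q)), ((M ∩ N).card : ℤ) =
      ∑ x ∈ M, ∑ y ∈ N, if x = y then 1 else 0 := fun M N => by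
    rw [Finset.card_eq_sum_ones, ← Finset.filter_mem_eq_inter, Finset.sum_filter]
    push_cast
    exact Finset.sum_congr rfl fun x _ => by rw [Finset.sum_ite_eq]
  have h3 : ((L₁ ∩ L₂ ∩ L₃).card : ℤ) = ∑ x ∈ L₁, ∑ y ∈ L₂, ∑ z ∈ L₃,
      (if x = y then 1 else 0) * if y = z then 1 else 0 := by
    rw [Finset.inter_assoc, h2]
    refine Finset.sum_congr rfl fun x _ => ?_
    rw [← Finset.filter_mem_eq_inter, Finset.sum_filter]
    refine Finset.sum_congr rfl fun y _ => ?_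
    rw [← Finset.mul_sum, Finset.sum_ite_eq]
    split_ifs <;> simp
  have e : (distinctTriples L₁ L₂ L₃ : ℤ) = ∑ x ∈ L₁, ∑ y ∈ L₂, ∑ z ∈ L₃,
      (1 + 2 * ((if x = y then 1 else 0) * if y = z then 1 else 0) - (if x = y then 1 else 0) -
        (if x = z then 1 else 0) - if y = z then 1 else 0) := by
    rw [distinctTriples, Finset.card_eq_sum_ones, Finset.sum_filter, Finset.sum_product]
    push_cast
    refine Finset.sum_congr rfl fun x _ => ?_
    rw [Finset.sum_product]
    refine Finset.sum_congr rfl fun y _ => Finset.sum_congr rfl fun z _ => ?_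
    by_cases h1 : x = y
    · subst h1
      by_cases h2 : x = z <;> simp [h2]
    · by_cases h2 : y = z
      · subst h2
        simp [h1]
      · by_cases h3 : x = z <;> simp [h1, h2, h3, eq_comm]
  rw [e, h3, h2 L₁ L₂, h2 L₁ L₃, h2 L₂ L₃]
  simp only [Finset.sum_sub_distrib, Finset.sum_add_distrib, Finset.sum_const, nsmul_eq_mul,
    ← Finset.mul_sum, mul_one]
  simp only [Finset.mul_sum, mul_comm]
  ring

theorem distinctTriples_comm (L₁ L₂ L₃ : Finset (Fin q)) :
    distinctTriples L₁ L₂ L₃ = distinctTriples L₁ L₃ L₂ := by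
  zify
  rw [distinctTriples_eq, distinctTriples_eq, Finset.inter_comm L₂ L₃, Finset.inter_right_comm]
  ring

/-- By Hall's theorem a system of distinct representatives exists. With at least two elements in
each set, Hall's condition can fail only for all three sets together, which forces them to be one
and the same pair. -/
theorem distinctTriples_pos {L₁ L₂ L₃ : Finset (Fin q)} (h₁ : 2 ≤ L₁.card) (h₂ : 2 ≤ L₂.card)
    (h₃ : 2 ≤ L₃.card) (h : ¬ (L₁ = L₂ ∧ L₁ = L₃)) : 0 < distinctTriples L₁ L₂ L₃ := by
  have key : ∃ f : Fin 3 → Fin q, Function.Injective f ∧ ∀ m, f m ∈ ![L₁, L₂, L₃] m := by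
    rw [← Finset.all_card_le_biUnion_card_iff_exists_injective]
    intro s
    have hL : ∀ m, 2 ≤ (![L₁, L₂, L₃] m).card := by
      intro m
      fin_cases m
      exacts [h₁, h₂, h₃]
    by_contra! hlt
    have hs : ∀ m ∈ s, ![L₁, L₂, L₃] m ⊆ s.biUnion ![L₁, L₂, L₃] := fun m hm =>
      Finset.subset_biUnion_of_mem _ hm
    have hne : s.Nonempty := by
      rw [Finset.nonempty_iff_ne_empty]
      rintro rfl
      simp at hlt
    obtain ⟨m, hm⟩ := hne
    have h2 := Finset.card_le_card (hs m hm)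
    have h3 : s.card ≤ 3 := s.card_le_univ
    have hs3 : s.card = 3 := by linarith [hL m]
    obtain rfl : s = Finset.univ := (Finset.card_eq_iff_eq_univ s).1 hs3
    have heq : ∀ m, ![L₁, L₂, L₃] m = Finset.univ.biUnion ![L₁, L₂, L₃] := fun m =>
      Finset.eq_of_subset_of_card_le (hs m (Finset.mem_univ _)) (by linarith [hL m])
    exact h ⟨(heq 0).trans (heq 1).symm, (heq 0).trans (heq 2).symm⟩
  obtain ⟨f, hf, hm⟩ := key
  refine Finset.card_pos.2 ⟨(f 0, f 1, f 2), ?_⟩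
  simp only [Finset.mem_filter, Finset.mem_product]
  exact ⟨⟨hm 0, hm 1, hm 2⟩, hf.ne (by decide), hf.ne (by decide), hf.ne (by decide)⟩

/-- The number of colourings of a triangle whose vertices avoid two given spins each. -/
def triangleWt (a a' b b' c c' : Fin q) : ℕ :=
  distinctTriples {a, a'}ᶜ {b, b'}ᶜ {c, c'}ᶜ

theorem triangleWt_swap₃ (a a' b b' c c' : Fin q) :
    triangleWt a a' b b' c c' = triangleWt a a' b b' c' c := by
  rw [triangleWt, triangleWt, Finset.pair_comm c c']

theorem triangleWt_comm (a a' b b' c c' : Fin q) :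
    triangleWt a a' b b' c c' = triangleWt a a' c c' b b' :=
  distinctTriples_comm _ _ _

theorem triangleWt_pos (hq : 4 ≤ q) {a a' b b' c c' : Fin q}
    (h : ({a, a'} : Finset (Fin q)) ≠ {b, b'}) : 0 < triangleWt a a' b b' c c' := by
  have hc : ∀ a b : Fin q, 2 ≤ ({a, b}ᶜ : Finset (Fin q)).card := fun a b => by
    have := Finset.card_le_two (a := a) (b := b)
    rw [Finset.card_compl, Fintype.card_fin]
    omega
  exact distinctTriples_pos (hc _ _) (hc _ _) (hc _ _) fun e => h (compl_injective e.1)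

/-- The Boltzmann weights of a site in the model with triangular faces summed out. -/
def clusterWt (t : Fin 9 → Fin q) (s : Fin q) : ℕ :=
  if s ≠ t 0 ∧ s ≠ t 1 then triangleWt s (t 0) (t 2) (t 3) (t 5) (t 6) *
    triangleWt s (t 1) (t 2) (t 4) (t 7) (t 8) else 0

/-- It suffices that on each triangle two vertices have different forbidden pairs. Each triangle
excludes at most one `s`, namely the one completing `{s, t 0} = {t 2, t 3}` or `{s, t 1} = {t 2, t
4}`. If `t 0 = t 1`, three values of `s` are available. Otherwise two are, say `a` and `b`; both can
be excluded only if `t 2` lies in the disjoint sets `{a, t 0}` and `{b, t 1}`, or the same with `a`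
and `b` exchanged. -/
theorem sum_clusterWt_pos (hq : 4 ≤ q) (t : Fin 9 → Fin q) : 0 < ∑ s, (clusterWt t s : ℝ) := by
  suffices h : ∃ s, s ≠ t 0 ∧ s ≠ t 1 ∧ ({s, t 0} : Finset (Fin q)) ≠ {t 2, t 3} ∧
      ({s, t 1} : Finset (Fin q)) ≠ {t 2, t 4} by
    obtain ⟨s, h0, h1, h2, h3⟩ := h
    refine Finset.sum_pos' (fun _ _ => Nat.cast_nonneg _) ⟨s, Finset.mem_univ _, ?_⟩
    rw [clusterWt, if_pos ⟨h0, h1⟩]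
    exact_mod_cast Nat.mul_pos (triangleWt_pos hq h2) (triangleWt_pos hq h3)
  by_contra! hbad
  have bad : ∀ s, s ≠ t 0 → s ≠ t 1 → (s = t 2 ∨ s = t 3) ∧ (t 2 = s ∨ t 2 = t 0) ∧
      (t 0 = t 2 ∨ t 0 = t 3) ∨
      (s = t 2 ∨ s = t 4) ∧ (t 2 = s ∨ t 2 = t 1) ∧ (t 1 = t 2 ∨ t 1 = t 4) := by
    intro s h0 h1
    by_cases h2 : ({s, t 0} : Finset (Fin q)) = {t 2, t 3}
    · left
      have k1 : s ∈ ({t 2, t 3} : Finset (Fin q)) := h2 ▸ by simp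
      have k2 : t 2 ∈ ({s, t 0} : Finset (Fin q)) := h2 ▸ by simp
      have k3 : t 0 ∈ ({t 2, t 3} : Finset (Fin q)) := h2 ▸ by simp
      simp only [Finset.mem_insert, Finset.mem_singleton] at k1 k2 k3
      exact ⟨k1, k2, k3⟩
    · right
      have h3 := hbad s h0 h1 h2
      have k1 : s ∈ ({t 2, t 4} : Finset (Fin q)) := h3 ▸ by simp
      have k2 : t 2 ∈ ({s, t 1} : Finset (Fin q)) := h3 ▸ by simp
      have k3 : t 1 ∈ ({t 2, t 4} : Finset (Fin q)) := h3 ▸ by simp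
      simp only [Finset.mem_insert, Finset.mem_singleton] at k1 k2 k3
      exact ⟨k1, k2, k3⟩
  by_cases h01 : t 0 = t 1
  · have hcard : 2 < ({t 0}ᶜ : Finset (Fin q)).card := by
      rw [Finset.card_compl, Fintype.card_fin, Finset.card_singleton]
      omega
    obtain ⟨a, b, c, ha, hb, hc, hab, hac, hbc⟩ := Finset.two_lt_card_iff.1 hcard
    simp only [Finset.mem_compl, Finset.mem_singleton] at ha hb hc
    have := bad a ha (h01 ▸ ha)
    have := bad b hb (h01 ▸ hb)
    have := bad c hc (h01 ▸ hc)
    grind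
  · have hcard : 1 < ({t 0, t 1}ᶜ : Finset (Fin q)).card := by
      have := Finset.card_le_two (a := t 0) (b := t 1)
      rw [Finset.card_compl, Fintype.card_fin]
      omega
    obtain ⟨a, ha, b, hb, hab⟩ := Finset.one_lt_card.1 hcard
    simp only [Finset.mem_compl, Finset.mem_insert, Finset.mem_singleton, not_or] at ha hb
    have := bad a ha.1 ha.2
    have := bad b hb.1 hb.2
    grind

/-- The symmetries are the exchange of the two third neighbours on the first plaquette and the
reflection `π` that exchanges the plaquettes and fixes the second neighbour. -/
theorem influence_clusterWt (q : ℕ) :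
    influence (q := q) (fun t s => (clusterWt t s : ℝ)) 1 =
        influence (q := q) (fun t s => (clusterWt t s : ℝ)) 0 ∧
      influence (q := q) (fun t s => (clusterWt t s : ℝ)) 4 =
        influence (q := q) (fun t s => (clusterWt t s : ℝ)) 3 ∧
      ∀ j : Fin 9, 5 ≤ j → influence (q := q) (fun t s => (clusterWt t s : ℝ)) j =
        influence (q := q) (fun t s => (clusterWt t s : ℝ)) 5 := by
  have s1 := influence_symm (q := q) (wt := fun t s => (clusterWt t s : ℝ))
      (Equiv.swap 5 6) fun t => by
    funext s
    simp only [clusterWt, Function.comp_apply, Equiv.swap_apply_left, Equiv.swap_apply_right]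
    have e : ∀ j : Fin 9, j ≠ 5 → j ≠ 6 → Equiv.swap 5 6 j = j := fun j h h' =>
      Equiv.swap_apply_of_ne_of_ne h h'
    rw [e 0 (by decide) (by decide), e 1 (by decide) (by decide), e 2 (by decide) (by decide),
      e 3 (by decide) (by decide), e 4 (by decide) (by decide), e 7 (by decide) (by decide),
      e 8 (by decide) (by decide), triangleWt_swap₃ s (t 0)]
  let π : Equiv.Perm (Fin 9) :=
    ⟨![1, 0, 2, 4, 3, 7, 8, 5, 6], ![1, 0, 2, 4, 3, 7, 8, 5, 6], by decide, by decide⟩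
  have s2 := influence_symm (q := q) (wt := fun t s => (clusterWt t s : ℝ)) π fun t => by
    funext s
    have e' : clusterWt (t ∘ π) s = if s ≠ t 1 ∧ s ≠ t 0 then
        triangleWt s (t 1) (t 2) (t 4) (t 7) (t 8) * triangleWt s (t 0) (t 2) (t 3) (t 5) (t 6)
        else 0 := rfl
    rw [e', mul_comm, clusterWt]
    simp only [and_comm]
  have e6 : influence (q := q) (fun t s => (clusterWt t s : ℝ)) 6 =
      influence (q := q) (fun t s => (clusterWt t s : ℝ)) 5 := s1 5
  refine ⟨s2 0, s2 3, fun j hj => ?_⟩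
  fin_cases j
  iterate 5 exact absurd hj (by decide)
  · rfl
  · exact e6
  · exact s2 5
  · exact (s2 6).trans e6

theorem clusterWeight_triangle {i : (ℤ × ℤ) ⊕ (ℤ × ℤ)} (k : Fin 3 ≃ triangleCluster i)
    {y₀ y₀' y₁ y₁' y₂ y₂' : Remaining triangleCluster}
    (hk : ∀ y : Remaining triangleCluster,
      (kagome.Adj (k 0) y ↔ y = y₀ ∨ y = y₀') ∧ (kagome.Adj (k 1) y ↔ y = y₁ ∨ y = y₁') ∧
        (kagome.Adj (k 2) y ↔ y = y₂ ∨ y = y₂')) (ρ : Remaining triangleCluster → Fin q) :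
    clusterWeight kagome triangleCluster i ρ =
      triangleWt (ρ y₀) (ρ y₀') (ρ y₁) (ρ y₁') (ρ y₂) (ρ y₂') := by
  have hadj : ∀ m m', kagome.Adj (k m) (k m') ↔ m ≠ m' := fun m m' => by
    refine ⟨fun h e => h.ne (by rw [e]), fun h => ?_⟩
    exact isClique_triangleCluster i (k m).2 (k m').2
      fun e => h (k.injective (Subtype.ext e))
  rw [clusterWeight, triangleWt, distinctTriples, ← Fintype.card_coe, ← Nat.card_eq_fintype_card]
  refine Nat.card_congr ⟨fun η => ⟨(η.1 (k 0), η.1 (k 1), η.1 (k 2)), ?_⟩,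
    fun η => ⟨fun u => ![η.1.1, η.1.2.1, η.1.2.2] (k.symm u), ?_, ?_⟩, ?_, ?_⟩
  · have h1 := fun m m' h => η.2.1 (k m) (k m') ((hadj m m').2 h)
    have h20 := fun y => η.2.2 (k 0) y
    have h21 := fun y => η.2.2 (k 1) y
    have h22 := fun y => η.2.2 (k 2) y
    simp only [fun y => (hk y).1] at h20
    simp only [fun y => (hk y).2.1] at h21
    simp only [fun y => (hk y).2.2] at h22
    simp only [Finset.mem_filter, Finset.mem_product, Finset.mem_compl, Finset.mem_insert,
      Finset.mem_singleton, not_or]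
    exact ⟨⟨⟨h20 _ (Or.inl rfl), h20 _ (Or.inr rfl)⟩, ⟨h21 _ (Or.inl rfl), h21 _ (Or.inr rfl)⟩,
      h22 _ (Or.inl rfl), h22 _ (Or.inr rfl)⟩, h1 _ _ (by decide), h1 _ _ (by decide),
      h1 _ _ (by decide)⟩
  · have hη := η.2
    simp only [Finset.mem_filter] at hη
    intro u v huv
    obtain ⟨m, rfl⟩ := k.surjective u
    obtain ⟨m', rfl⟩ := k.surjective v
    rw [hadj] at huv
    simp only [Equiv.symm_apply_apply]
    obtain ⟨-, h1, h2, h3⟩ := hη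
    fin_cases m <;> fin_cases m' <;> first | exact absurd rfl huv | skip
    exacts [h1, h2, h1.symm, h3, h2.symm, h3.symm]
  · have hη := η.2
    simp only [Finset.mem_filter, Finset.mem_product, Finset.mem_compl, Finset.mem_insert,
      Finset.mem_singleton, not_or] at hη
    obtain ⟨⟨h0, h1, h2⟩, -⟩ := hη
    intro u y huy
    obtain ⟨m, rfl⟩ := k.surjective u
    simp only [Equiv.symm_apply_apply]
    fin_cases m
    · rcases (hk y).1.1 huy with rfl | rfl
      exacts [h0.1, h0.2]
    · rcases (hk y).2.1.1 huy with rfl | rfl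
      exacts [h1.1, h1.2]
    · rcases (hk y).2.2.1 huy with rfl | rfl
      exacts [h2.1, h2.2]
  · intro η
    refine Subtype.ext (funext fun u => ?_)
    obtain ⟨m, rfl⟩ := k.surjective u
    simp only [Equiv.symm_apply_apply]
    fin_cases m <;> rfl
  · intro η
    refine Subtype.ext ?_
    simp only [Equiv.symm_apply_apply]
    rfl

end TripleWeights

/-! ### Neighbour types read off from a chart. -/

namespace ClusterChart

variable {x : Remaining triangleCluster} {i₁ i₂ : (ℤ × ℤ) ⊕ (ℤ × ℤ)}
  {nb : Fin 9 → Remaining triangleCluster}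

theorem localChart (h : ClusterChart x i₁ i₂ nb) (q : ℕ) :
    LocalChart (decimated kagome triangleCluster q) (fun t s => (clusterWt t s : ℝ)) x nb where
  injective := h.injective
  ne := h.ne
  eq ρ s := by
    obtain ⟨k₁, hk₁⟩ := h.triangle₁
    obtain ⟨k₂, hk₂⟩ := h.triangle₂
    rw [decimable_triangleCluster.boltzmann_singleton h.index_ne h.borders (fun y' => h.link y'),
      clusterWeight_triangle k₁ hk₁, clusterWeight_triangle k₂ hk₂]
    simp only [Function.update_self, Function.update_of_ne (h.ne _), clusterWt,
      Function.comp_apply]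
    split_ifs <;> simp

theorem borders_iff_of_triangle {i : (ℤ × ℤ) ⊕ (ℤ × ℤ)} (k : Fin 3 ≃ triangleCluster i)
    (y : Remaining triangleCluster) : Borders kagome triangleCluster i y ↔
      kagome.Adj (k 0) y ∨ kagome.Adj (k 1) y ∨ kagome.Adj (k 2) y := by
  constructor
  · rintro ⟨u, hu, hadj⟩
    obtain ⟨m, hm⟩ := k.surjective ⟨u, hu⟩
    have e : u = (k m).1 := by rw [hm]
    rw [e] at hadj
    fin_cases m
    exacts [Or.inl hadj, Or.inr (Or.inl hadj), Or.inr (Or.inr hadj)]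
  · rintro (h | h | h)
    exacts [⟨_, (k 0).2, h⟩, ⟨_, (k 1).2, h⟩, ⟨_, (k 2).2, h⟩]

theorem plaquette₁ (h : ClusterChart x i₁ i₂ nb) (y : Remaining triangleCluster) :
    Borders kagome triangleCluster i₁ y ↔
      y = x ∨ y = nb 0 ∨ y = nb 2 ∨ y = nb 3 ∨ y = nb 5 ∨ y = nb 6 := by
  obtain ⟨k, hk⟩ := h.triangle₁
  rw [borders_iff_of_triangle k, (hk y).1, (hk y).2.1, (hk y).2.2]
  tauto

theorem plaquette₂ (h : ClusterChart x i₁ i₂ nb) (y : Remaining triangleCluster) :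
    Borders kagome triangleCluster i₂ y ↔
      y = x ∨ y = nb 1 ∨ y = nb 2 ∨ y = nb 4 ∨ y = nb 7 ∨ y = nb 8 := by
  obtain ⟨k, hk⟩ := h.triangle₂
  rw [borders_iff_of_triangle k, (hk y).1, (hk y).2.1, (hk y).2.2]
  tauto

open Classical in
theorem sharedPlaquettes_eq (h : ClusterChart x i₁ i₂ nb) (y : Remaining triangleCluster) :
    sharedPlaquettes kagome triangleCluster x y =
      (if Borders kagome triangleCluster i₁ y then 1 else 0) +
        if Borders kagome triangleCluster i₂ y then 1 else 0 := by
  have e : {i | Borders kagome triangleCluster i x ∧ Borders kagome triangleCluster i y} =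
      (({i₁, i₂} : Finset _).filter fun i => Borders kagome triangleCluster i y : Set _) := by
    ext i
    simp [h.borders]
  rw [sharedPlaquettes, e, Set.ncard_coe_finset, Finset.card_filter, Finset.sum_pair h.index_ne]

/-- For a neighbour `nb j` injectivity turns the claim into a decidable statement about the index
`j`; other sites share no plaquette with `x`, unless they are `x` itself. -/
theorem cluster2_iff (h : ClusterChart x i₁ i₂ nb) (y : Remaining triangleCluster) :
    Cluster2 x y ↔ y = nb 2 := by
  have hinj : ∀ a b, nb a = nb b ↔ a = b := fun a b => h.injective.eq_iff
  rw [Cluster2, h.sharedPlaquettes_eq, h.plaquette₁, h.plaquette₂]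
  by_cases hy : ∃ j, y = nb j
  · obtain ⟨j, rfl⟩ := hy
    simp only [hinj, h.ne j, false_or, (h.ne j).symm, ne_eq, not_false_eq_true, true_and]
    clear * -
    revert j
    decide
  · have hy' : ∀ j, y ≠ nb j := fun j e => hy ⟨j, e⟩
    by_cases hx : x = y
    · simp [hx, hy']
    · simp [Ne.symm hx, hy']

theorem sharedPlaquettes_eq_one_iff (h : ClusterChart x i₁ i₂ nb) (y : Remaining triangleCluster) :
    sharedPlaquettes kagome triangleCluster x y = 1 ∧ ¬ Cluster1 x y ↔
      ∃ j, 3 ≤ j ∧ y = nb j := by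
  have hinj : ∀ a b, nb a = nb b ↔ a = b := fun a b => h.injective.eq_iff
  rw [h.sharedPlaquettes_eq, h.plaquette₁, h.plaquette₂, h.link]
  by_cases hy : ∃ j, y = nb j
  · obtain ⟨j, rfl⟩ := hy
    simp only [hinj, h.ne j, false_or]
    clear * -
    revert j
    decide
  · have hy' : ∀ j, y ≠ nb j := fun j e => hy ⟨j, e⟩
    by_cases hx : x = y
    · simp [hx, hy']
    · simp [Ne.symm hx, hy']

theorem exists_cluster2_cluster1_iff (h : ClusterChart x i₁ i₂ nb)
    (y : Remaining triangleCluster) :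
    (∃ z, Cluster2 x z ∧ Cluster1 z y) ↔ y = nb 3 ∨ y = nb 4 := by
  simp only [h.cluster2_iff, exists_eq_left, h.link₂]

theorem cluster3_iff (h : ClusterChart x i₁ i₂ nb) (y : Remaining triangleCluster) :
    Cluster3 x y ↔ ∃ j, 5 ≤ j ∧ y = nb j := by
  have hinj : ∀ a b, nb a = nb b ↔ a = b := fun a b => h.injective.eq_iff
  rw [Cluster3, ← and_assoc, h.sharedPlaquettes_eq_one_iff, h.exists_cluster2_cluster1_iff]
  by_cases hy : ∃ j, y = nb j
  · obtain ⟨j, rfl⟩ := hy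
    simp only [hinj, exists_eq_right']
    revert j
    decide
  · have hy' : ∀ j, y ≠ nb j := fun j e => hy ⟨j, e⟩
    simp [hy']

theorem cluster4_iff (h : ClusterChart x i₁ i₂ nb) (y : Remaining triangleCluster) :
    Cluster4 x y ↔ y = nb 3 ∨ y = nb 4 := by
  rw [Cluster4, ← and_assoc, h.sharedPlaquettes_eq_one_iff, h.exists_cluster2_cluster1_iff]
  refine and_iff_right_of_imp ?_
  rintro (rfl | rfl)
  exacts [⟨3, le_rfl, rfl⟩, ⟨4, by decide, rfl⟩]

theorem ncard_cluster (h : ClusterChart x i₁ i₂ nb) :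
    {y | Cluster1 x y}.ncard = 2 ∧ {y | Cluster2 x y}.ncard = 1 ∧
      {y | Cluster3 x y}.ncard = 4 ∧ {y | Cluster4 x y}.ncard = 2 := by
  classical
  refine ⟨?_, ?_, ?_, ?_⟩
  · rw [show {y | Cluster1 x y} = {nb 0, nb 1} by ext y; simp [h.link],
      Set.ncard_pair (h.injective.ne (by decide))]
  · rw [show {y | Cluster2 x y} = {nb 2} by ext y; simp [h.cluster2_iff], Set.ncard_singleton]
  · rw [show {y | Cluster3 x y} = (((Finset.Ici 5 : Finset (Fin 9)).map ⟨nb, h.injective⟩ :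
      Finset _) : Set _) by ext y; simp [h.cluster3_iff, eq_comm], Set.ncard_coe_finset,
      Finset.card_map]
    rfl
  · rw [show {y | Cluster4 x y} = {nb 3, nb 4} by ext y; simp [h.cluster4_iff],
      Set.ncard_pair (h.injective.ne (by decide))]

end ClusterChart

end

end KagomePotts

namespace KagomePotts

noncomputable section

open Filter Topology LocalWeights

/-! ### Colour lists up to permutation of the colours. -/

section CanonicalLists

/-- The lists of length `n` over the first `q` numbers in which every value that occurs is
preceded, reading from the end, by all smaller values, together with the number of values. -/
def canonicalLists (q : ℕ) : ℕ → List (List ℕ × ℕ)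
  | 0 => [([], 0)]
  | n + 1 => (canonicalLists q n).flatMap fun p =>
      (List.range (min (p.2 + 1) q)).map fun v => (v :: p.1, max p.2 (v + 1))

/-- Entries are added at the head. If the image of the new one exceeds the number `k` of values used
so far, it is exchanged with `k`; both values are unused, so the images of the earlier entries are
unaffected. -/
theorem exists_perm_mem_canonicalLists {q : ℕ} (l : List (Fin q)) :
    ∃ (σ : Equiv.Perm (Fin q)) (k : ℕ),
      (l.map (fun x => (σ x).val), k) ∈ canonicalLists q l.length ∧ ∀ x ∈ l, (σ x).val < k := by
  induction l with
  | nil => exact ⟨1, 0, by simp [canonicalLists]⟩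
  | cons x l ih =>
    obtain ⟨σ, k, hmem, hlt⟩ := ih
    obtain ⟨σ', hx, hl⟩ : ∃ σ' : Equiv.Perm (Fin q), (σ' x).val ≤ k ∧ ∀ y ∈ l, σ' y = σ y := by
      by_cases h : (σ x).val ≤ k
      · exact ⟨σ, h, fun _ _ => rfl⟩
      · have hk : k < q := by have := (σ x).2; omega
        refine ⟨σ.trans (Equiv.swap (σ x) ⟨k, hk⟩), by simp, fun y hy => ?_⟩
        have := hlt y hy
        rw [Equiv.trans_apply, Equiv.swap_apply_of_ne_of_ne]
        · rintro e
          rw [e] at this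
          omega
        · rintro e
          rw [e] at this
          exact lt_irrefl _ this
    refine ⟨σ', max k ((σ' x).val + 1), ?_, ?_⟩
    · rw [List.length_cons, canonicalLists, List.mem_flatMap]
      refine ⟨_, hmem, ?_⟩
      rw [List.mem_map]
      refine ⟨(σ' x).val, List.mem_range.2 (lt_min (by simpa [Nat.lt_succ_iff] using hx)
        (σ' x).2), ?_⟩
      simp only [List.map_cons, Prod.mk.injEq, List.cons.injEq, true_and, and_true]
      exact List.map_congr_left fun y hy => by rw [hl y hy]
    · intro y hy
      rcases List.mem_cons.1 hy with rfl | hy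
      · simp
      · rw [hl y hy]
        exact lt_max_of_lt_left (hlt y hy)

/-- A property of lists of spins that is invariant under permutations of the spins holds in
general if it holds for the canonical lists. -/
theorem forall_list_of_canonical {q n : ℕ} {P : List (Fin q) → Prop}
    (hP : ∀ (σ : Equiv.Perm (Fin q)) l, P (l.map σ) → P l) {c : List ℕ → Bool}
    (hc : (canonicalLists q n).all (fun p => c p.1) = true)
    (h : ∀ l : List (Fin q), l.length = n → c (l.map Fin.val) = true → P l)
    (l : List (Fin q)) (hl : l.length = n) : P l := by
  obtain ⟨σ, k, hmem, -⟩ := exists_perm_mem_canonicalLists l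
  refine hP σ l (h _ (by rw [List.length_map, hl]) ?_)
  rw [hl] at hmem
  have := List.all_eq_true.1 hc _ hmem
  rwa [List.map_map]

end CanonicalLists

/-! ### Evaluation of triangle weights by counting distinct colours. -/

section ComputableWeights

/-- The number of distinct entries of a list. -/
def distinctCount : List ℕ → ℕ
  | [] => 0
  | a :: l => bif l.elem a then distinctCount l else distinctCount l + 1

theorem distinctCount_map_val {q : ℕ} (l : List (Fin q)) :
    distinctCount (l.map Fin.val) = l.toFinset.card := by
  induction l with
  | nil => rfl
  | cons a l ih =>
    have hmem : (l.map Fin.val).elem a.val = true ↔ a ∈ l := by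
      rw [List.elem_iff, List.mem_map]
      exact ⟨fun ⟨b, hb, e⟩ => Fin.ext e ▸ hb, fun h => ⟨a, h, rfl⟩⟩
    rw [List.map_cons, distinctCount, ih, List.toFinset_cons]
    by_cases h : a ∈ l
    · rw [hmem.2 h, cond_true, Finset.insert_eq_of_mem (List.mem_toFinset.2 h)]
    · rw [Bool.eq_false_iff.2 (mt hmem.1 h), cond_false,
        Finset.card_insert_of_notMem (mt List.mem_toFinset.1 h)]

/-- Inclusion–exclusion is written without negative terms and in cardinalities of sets of forbidden
colours only. This yields both the invariance under colour permutations and a fast evaluation. -/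
theorem triangleWt_add_eq {q : ℕ} (a a' b b' c c' : Fin q) :
    triangleWt a a' b b' c c' + ((q - ({a, a', b, b'} : Finset (Fin q)).card) *
        (q - ({c, c'} : Finset (Fin q)).card) + (q - ({a, a', c, c'} : Finset (Fin q)).card) *
        (q - ({b, b'} : Finset (Fin q)).card) + (q - ({b, b', c, c'} : Finset (Fin q)).card) *
        (q - ({a, a'} : Finset (Fin q)).card)) =
      (q - ({a, a'} : Finset (Fin q)).card) * (q - ({b, b'} : Finset (Fin q)).card) *
        (q - ({c, c'} : Finset (Fin q)).card) +
        2 * (q - ({a, a', b, b', c, c'} : Finset (Fin q)).card) := by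
  have e : ∀ F : Finset (Fin q), q - F.card = Fᶜ.card := fun F => by
    rw [Finset.card_compl, Fintype.card_fin]
  have u : ∀ (x x' : Fin q) (F : Finset (Fin q)),
      (insert x (insert x' F))ᶜ = {x, x'}ᶜ ∩ Fᶜ := fun x x' F => by
    rw [← Finset.compl_union, Finset.insert_union, Finset.singleton_union]
  have h := distinctTriples_eq ({a, a'}ᶜ : Finset (Fin q)) {b, b'}ᶜ {c, c'}ᶜ
  rw [e, e, e, e, e, e, e, u a a' {b, b'}, u a a' {c, c'}, u b b' {c, c'},
    u a a' {b, b', c, c'}, u b b' {c, c'}, triangleWt, ← Finset.inter_assoc]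
  zify
  rw [h]
  ring

theorem triangleWt_map {q : ℕ} (σ : Equiv.Perm (Fin q)) (a a' b b' c c' : Fin q) :
    triangleWt (σ a) (σ a') (σ b) (σ b') (σ c) (σ c') = triangleWt a a' b b' c c' := by
  have h := triangleWt_add_eq a a' b b' c c'
  have h' := triangleWt_add_eq (σ a) (σ a') (σ b) (σ b') (σ c) (σ c')
  have e : ∀ F : Finset (Fin q), (F.image σ).card = F.card := fun F =>
    Finset.card_image_of_injective _ σ.injective
  have e2 : ∀ x x', ({σ x, σ x'} : Finset (Fin q)).card = ({x, x'} : Finset (Fin q)).card :=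
    fun x x' => by
      have := e {x, x'}
      rwa [Finset.image_insert, Finset.image_singleton] at this
  have e4 : ∀ x x' y y', ({σ x, σ x', σ y, σ y'} : Finset (Fin q)).card =
      ({x, x', y, y'} : Finset (Fin q)).card :=
    fun x x' y y' => by
      have := e {x, x', y, y'}
      simpa only [Finset.image_insert, Finset.image_singleton] using this
  have e6 : ({σ a, σ a', σ b, σ b', σ c, σ c'} : Finset (Fin q)).card =
      ({a, a', b, b', c, c'} : Finset (Fin q)).card := by
    have := e {a, a', b, b', c, c'}
    simpa only [Finset.image_insert, Finset.image_singleton] using this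
  rw [e2, e2, e2, e4, e4, e4, e6, ← h] at h'
  exact Nat.add_right_cancel h'

/-- An evaluation of `triangleWt` for six spin values. -/
def triangleWtNat (a a' b b' c c' : ℕ) : ℕ :=
  (6 - distinctCount [a, a']) * (6 - distinctCount [b, b']) * (6 - distinctCount [c, c']) +
      2 * (6 - distinctCount [a, a', b, b', c, c']) -
    ((6 - distinctCount [a, a', b, b']) * (6 - distinctCount [c, c']) +
      (6 - distinctCount [a, a', c, c']) * (6 - distinctCount [b, b']) +
      (6 - distinctCount [b, b', c, c']) * (6 - distinctCount [a, a']))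

theorem triangleWtNat_eq (a a' b b' c c' : Fin 6) :
    triangleWtNat a a' b b' c c' = triangleWt a a' b b' c c' := by
  have d2 : ∀ x x' : Fin 6, distinctCount [x, x'] = ({x, x'} : Finset (Fin 6)).card :=
    fun x x' => (distinctCount_map_val [x, x']).trans (by simp)
  have d4 : ∀ x x' y y' : Fin 6,
      distinctCount [x, x', y, y'] = ({x, x', y, y'} : Finset (Fin 6)).card :=
    fun x x' y y' => (distinctCount_map_val [x, x', y, y']).trans (by simp)
  have d6 : distinctCount [a, a', b, b', c, c'] = ({a, a', b, b', c, c'} : Finset (Fin 6)).card :=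
    (distinctCount_map_val [a, a', b, b', c, c']).trans (by simp)
  rw [triangleWtNat, d2, d2, d2, d4, d4, d4, d6, ← triangleWt_add_eq, Nat.add_sub_cancel]

end ComputableWeights

/-! ### A computable test for total variation bounds. -/

section Certificates

/-- The spin values at which `certify` compares weights. -/
def spins : List ℕ := [0, 1, 2, 3, 4, 5]

/-- One half of the test in `certify`. -/
def certifyHalf (U V : ℕ → ℕ) (z N D p r : ℕ) : Bool :=
  Nat.ble
    (5 * (spins.map fun s => bif Nat.beq s z then 0 else
      D * (p * U s - r * V s) - N * (p * U s)).sum)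
    (4 * (spins.map fun s => bif Nat.beq s z then 0 else
      N * (p * U s) - D * (p * U s - r * V s)).sum)

/-- A test for the normalized weights `U g` and `V g` to have a total variation distance of at most
`N / D` whenever `g` vanishes at `z` and varies otherwise by a factor of at most `5 / 4`. -/
def certify (U V : ℕ → ℕ) (z N D : ℕ) : Bool :=
  spins.any fun s => !Nat.beq s z && (!Nat.beq (U s) 0 && (!Nat.beq (V s) 0 &&
    (certifyHalf U V z N D (V s) (U s) && certifyHalf V U z N D (U s) (V s))))

theorem sum_map_spins (F : ℕ → ℕ) : (spins.map F).sum = ∑ s : Fin 6, F s := by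
  simp [spins, Fin.sum_univ_succ]

/-- After multiplication by `D` the claim says that a linear form in `g` is at most 0. Its positive
coefficients are estimated with `g ≤ 5/4 * m` and the negative ones with `g ≥ m`, which gives the
factors 5 and 4 in the test. -/
theorem certifyHalf_sound {U V : ℕ → ℕ} {z : Fin 6} {N D p r : ℕ} (hD : 0 < D)
    (h : certifyHalf U V z N D p r = true) {g : Fin 6 → ℝ} {m : ℝ} (hm : 0 < m) (hz : g z = 0)
    (hg : ∀ s, s ≠ z → m ≤ g s ∧ g s ≤ 5 / 4 * m) :
    ∑ s : Fin 6, max (p * (U s * g s) - r * (V s * g s)) 0 ≤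
      (N / D : ℝ) * (p * ∑ s : Fin 6, U s * g s) := by
  have h' := Nat.ble_eq.mp h
  rw [sum_map_spins, sum_map_spins] at h'
  have h'' : (5 : ℝ) * ∑ s : Fin 6, ((bif Nat.beq s z then 0 else
      D * (p * U s - r * V s) - N * (p * U s) : ℕ) : ℝ) ≤
      4 * ∑ s : Fin 6, ((bif Nat.beq s z then 0 else
        N * (p * U s) - D * (p * U s - r * V s) : ℕ) : ℝ) := by
    exact_mod_cast h'
  have key : ∀ s : Fin 6, D * max (p * (U s * g s) - r * (V s * g s)) 0 -
      N * (p * (U s * g s)) ≤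
      ((bif Nat.beq s z then 0 else D * (p * U s - r * V s) - N * (p * U s) : ℕ) : ℝ) *
        (5 / 4 * m) -
      ((bif Nat.beq s z then 0 else N * (p * U s) - D * (p * U s - r * V s) : ℕ) : ℝ) * m := by
    intro s
    by_cases hs : s = z
    · subst hs
      simp [hz]
    · have hs' : Nat.beq s z = false := Bool.eq_false_iff.2 fun e =>
        hs (Fin.ext (Nat.eq_of_beq_eq_true e))
      obtain ⟨h1, h2⟩ := hg s hs
      rw [hs', cond_false, cond_false]
      have hsub : ∀ x y : ℕ, ((x - y : ℕ) : ℝ) = max ((x : ℝ) - y) 0 := fun x y => by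
        rcases le_total x y with hxy | hxy
        · rw [Nat.sub_eq_zero_of_le hxy, Nat.cast_zero, max_eq_right]
          have : (x : ℝ) ≤ y := by exact_mod_cast hxy
          linarith
        · rw [Nat.cast_sub hxy, max_eq_left]
          have : (y : ℝ) ≤ x := by exact_mod_cast hxy
          linarith
      have e1 : max (p * (U s * g s) - r * (V s * g s)) 0 =
          ((p * U s - r * V s : ℕ) : ℝ) * g s := by
        rw [hsub, max_mul_of_nonneg _ _ (by linarith), zero_mul]
        push_cast
        ring_nf
      rw [e1]
      set x : ℕ := D * (p * U s - r * V s) with hx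
      have ex : (D : ℝ) * (((p * U s - r * V s : ℕ) : ℝ) * g s) = (x : ℝ) * g s := by
        rw [hx, Nat.cast_mul, mul_assoc]
      set y : ℕ := N * (p * U s) with hy
      have ey : (N : ℝ) * (p * (U s * g s)) = (y : ℝ) * g s := by
        rw [hy, Nat.cast_mul, Nat.cast_mul]
        ring
      rw [ex, ey]
      rcases le_total x y with hxy | hxy
      · rw [Nat.sub_eq_zero_of_le hxy, Nat.cast_zero, zero_mul, Nat.cast_sub hxy]
        have : (x : ℝ) ≤ y := by exact_mod_cast hxy
        nlinarith
      · rw [Nat.sub_eq_zero_of_le hxy, Nat.cast_zero, zero_mul, Nat.cast_sub hxy]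
        have : (y : ℝ) ≤ x := by exact_mod_cast hxy
        nlinarith
  have hsum := Finset.sum_le_sum fun s (_ : s ∈ Finset.univ) => key s
  rw [Finset.sum_sub_distrib, Finset.sum_sub_distrib, ← Finset.sum_mul, ← Finset.sum_mul,
    ← Finset.mul_sum, ← Finset.mul_sum, ← Finset.mul_sum] at hsum
  have hD' : (0 : ℝ) < D := by exact_mod_cast hD
  rw [div_mul_eq_mul_div, le_div_iff₀ hD']
  have hm' := mul_le_mul_of_nonneg_right h'' hm.le
  linarith

theorem certify_sound {U V : ℕ → ℕ} {z : Fin 6} {N D : ℕ} (hD : 0 < D)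
    (h : certify U V z N D = true) {g : Fin 6 → ℝ} {m : ℝ} (hm : 0 < m) (hz : g z = 0)
    (hg : ∀ s, s ≠ z → m ≤ g s ∧ g s ≤ 5 / 4 * m) (A : Finset (Fin 6)) :
    |normProb (fun s => U s * g s) A - normProb (fun s => V s * g s) A| ≤ (N / D : ℝ) := by
  obtain ⟨s, hs, h⟩ := List.any_eq_true.1 h
  simp only [Bool.and_eq_true, Bool.not_eq_true'] at h
  obtain ⟨h1, h2, h3, h4, h5⟩ := h
  have hs6 : s < 6 := by
    simp only [spins, List.mem_cons, List.not_mem_nil, or_false] at hs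
    omega
  have hsz : (⟨s, hs6⟩ : Fin 6) ≠ z := fun e => by
    have : s = z := congrArg Fin.val e
    rw [this, Nat.beq_refl] at h1
    exact Bool.noConfusion h1
  have hU : 0 < U s := Nat.pos_of_ne_zero fun e => by rw [e] at h2; exact Bool.noConfusion h2
  have hV : 0 < V s := Nat.pos_of_ne_zero fun e => by rw [e] at h3; exact Bool.noConfusion h3
  have hg0 : ∀ s, 0 ≤ g s := fun s => by
    by_cases e : s = z
    · rw [e, hz]
    · linarith [(hg s e).1]
  have hgs : 0 < g ⟨s, hs6⟩ := by linarith [(hg _ hsz).1]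
  -- The relative normalization is the one that makes the two weights equal at the spin `s` found by
  -- the test.
  refine abs_normProb_sub_le_of_mul (w := fun s : Fin 6 => U s * g s)
    (w' := fun s : Fin 6 => V s * g s) (p := V s) (r := U s)
    (fun s => mul_nonneg (Nat.cast_nonneg _) (hg0 s))
    (fun s => mul_nonneg (Nat.cast_nonneg _) (hg0 s))
    (Finset.sum_pos' (fun s _ => mul_nonneg (Nat.cast_nonneg _) (hg0 s))
      ⟨⟨s, hs6⟩, Finset.mem_univ _, mul_pos (Nat.cast_pos.2 hU) hgs⟩)
    (Finset.sum_pos' (fun s _ => mul_nonneg (Nat.cast_nonneg _) (hg0 s))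
      ⟨⟨s, hs6⟩, Finset.mem_univ _, mul_pos (Nat.cast_pos.2 hV) hgs⟩)
    (Nat.cast_pos.2 hV) (Nat.cast_pos.2 hU)
    (certifyHalf_sound hD h4 hm hz hg) (certifyHalf_sound hD h5 hm hz hg) A

end Certificates

end

end KagomePotts

namespace KagomePotts

noncomputable section

open Filter Topology LocalWeights

/-! ### Bounds on the influences for `q = 6`. -/

section ClusterBounds

theorem normProb_comp_perm {q : ℕ} (σ : Equiv.Perm (Fin q)) (w : Fin q → ℝ)
    (A : Finset (Fin q)) : normProb (fun s => w (σ s)) A = normProb w (A.map σ.toEmbedding) := by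
  rw [normProb, normProb, Finset.sum_map, Equiv.sum_comp σ w]
  rfl

/-- A permutation of the colours can be applied to the seven spins, to `g` and to `A` at once. The
test quantifies over all `g`, so only the pattern of equalities among the seven spins matters. -/
theorem abs_normProb_sub_le_of_canonical {U V : (Fin 7 → Fin 6) → Fin 6 → ℕ}
    (hU : ∀ (σ : Equiv.Perm (Fin 6)) x s, U (σ ∘ x) (σ s) = U x s)
    (hV : ∀ (σ : Equiv.Perm (Fin 6)) x s, V (σ ∘ x) (σ s) = V x s)
    {N D : ℕ} (hD : 0 < D) {U' V' : List ℕ → ℕ → ℕ}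
    (hU' : ∀ x (s : Fin 6), U' ((List.ofFn x).map Fin.val) s = U x s)
    (hV' : ∀ x (s : Fin 6), V' ((List.ofFn x).map Fin.val) s = V x s)
    (hc : (canonicalLists 6 7).all (fun p => certify (U' p.1) (V' p.1) (p.1.headD 0) N D) = true)
    (x : Fin 7 → Fin 6) {g : Fin 6 → ℝ} {m : ℝ} (hm : 0 < m) (hz : g (x 0) = 0)
    (hg : ∀ s, s ≠ x 0 → m ≤ g s ∧ g s ≤ 5 / 4 * m) (A : Finset (Fin 6)) :
    |normProb (fun s => U x s * g s) A - normProb (fun s => V x s * g s) A| ≤ (N / D : ℝ) := by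
  refine forall_list_of_canonical (q := 6) (n := 7)
    (P := fun l => ∀ (x : Fin 7 → Fin 6), l = List.ofFn x → ∀ (g : Fin 6 → ℝ), g (x 0) = 0 →
      (∀ s, s ≠ x 0 → m ≤ g s ∧ g s ≤ 5 / 4 * m) → ∀ A,
      |normProb (fun s => U x s * g s) A - normProb (fun s => V x s * g s) A| ≤ (N / D : ℝ))
    (c := fun l => certify (U' l) (V' l) (l.headD 0) N D)
    (fun σ l hl x hx g hz hg A => ?_) hc (fun l _ hcl x hx g hz hg A => ?_)
    (List.ofFn x) List.length_ofFn x rfl g hz hg A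
  · have h := hl (σ ∘ x) (by rw [hx, List.map_ofFn]) (g ∘ σ.symm) (by simpa using hz)
      (fun s hs => hg (σ.symm s) fun e => hs (by simp [← e])) (A.map σ.toEmbedding)
    rw [← normProb_comp_perm, ← normProb_comp_perm] at h
    simpa only [hU, hV, Function.comp_apply, Equiv.symm_apply_apply] using h
  · subst hx
    have hhead : ((List.ofFn x).map Fin.val).headD 0 = (x 0).val := by
      rw [List.ofFn_succ]
      rfl
    rw [hhead] at hcl
    have h := certify_sound hD hcl hm hz hg A
    simpa only [hU', hV'] using h

/-- The weights before and after a spin that is not linked to the site is changed; the arguments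
are listed as `z, y, e, f, b, a, a'`. -/
def farNat (i : ℕ) (l : List ℕ) (s : ℕ) : ℕ :=
  bif Nat.beq s (l.getD 1 0) then 0 else
    triangleWtNat s (l.getD 1 0) (l.getD 2 0) (l.getD 3 0) (l.getD i 0) (l.getD 4 0)

/-- The weights before and after a spin linked to the site is changed; the arguments are listed
as `z, y, y', e, f, a, b`. -/
def nearNat (i : ℕ) (l : List ℕ) (s : ℕ) : ℕ :=
  bif Nat.beq s (l.getD i 0) then 0 else
    triangleWtNat s (l.getD i 0) (l.getD 3 0) (l.getD 4 0) (l.getD 5 0) (l.getD 6 0)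

/-- There are 876 canonical lists: the partitions of seven positions into at most six classes. The
entry `z`, where `g` vanishes, is the head of the list. -/
theorem certify_far : (canonicalLists 6 7).all
    (fun p => certify (farNat 5 p.1) (farNat 6 p.1) (p.1.headD 0) 42 1000) = true := by
  decide +kernel

theorem certify_near : (canonicalLists 6 7).all
    (fun p => certify (nearNat 1 p.1) (nearNat 2 p.1) (p.1.headD 0) 33 100) = true := by
  decide +kernel

theorem cond_beq_val (s y : Fin 6) (n : ℕ) :
    (bif Nat.beq s y then 0 else n) = if s = y then 0 else n := by
  by_cases h : s = y
  · rw [if_pos h, h, Nat.beq_refl, cond_true]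
  · rw [if_neg h, Bool.eq_false_iff.2 fun e => h (Fin.ext (Nat.eq_of_beq_eq_true e)), cond_false]

theorem getD_map_ofFn (x : Fin 7 → Fin 6) (i : Fin 7) :
    ((List.ofFn x).map Fin.val).getD i 0 = (x i).val := by
  fin_cases i <;> simp

theorem abs_normProb_far_le (y e f b a a' z : Fin 6) {g : Fin 6 → ℝ} {m : ℝ} (hm : 0 < m)
    (hz : g z = 0) (hg : ∀ s, s ≠ z → m ≤ g s ∧ g s ≤ 5 / 4 * m) (A : Finset (Fin 6)) :
    |normProb (fun s => ((if s = y then 0 else triangleWt s y e f a b : ℕ) : ℝ) * g s) A -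
      normProb (fun s => ((if s = y then 0 else triangleWt s y e f a' b : ℕ) : ℝ) * g s) A| ≤
      42 / 1000 := by
  have key : ∀ (i : Fin 7) (x : Fin 7 → Fin 6) (s : Fin 6),
      farNat i ((List.ofFn x).map Fin.val) s =
        if s = x 1 then 0 else triangleWt s (x 1) (x 2) (x 3) (x i) (x 4) := fun i x s => by
    have e := getD_map_ofFn x
    rw [farNat, e i, show ((List.ofFn x).map Fin.val).getD 1 0 = x 1 from e 1,
      show ((List.ofFn x).map Fin.val).getD 2 0 = x 2 from e 2,
      show ((List.ofFn x).map Fin.val).getD 3 0 = x 3 from e 3,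
      show ((List.ofFn x).map Fin.val).getD 4 0 = x 4 from e 4, cond_beq_val, triangleWtNat_eq]
  have hσ : ∀ (i : Fin 7) (σ : Equiv.Perm (Fin 6)) (x : Fin 7 → Fin 6) (s : Fin 6),
      (if σ s = (σ ∘ x) 1 then 0 else triangleWt (σ s) ((σ ∘ x) 1) ((σ ∘ x) 2) ((σ ∘ x) 3)
        ((σ ∘ x) i) ((σ ∘ x) 4)) =
        if s = x 1 then 0 else triangleWt s (x 1) (x 2) (x 3) (x i) (x 4) := fun i σ x s => by
    simp only [Function.comp_apply, triangleWt_map, σ.injective.eq_iff]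
  have h := abs_normProb_sub_le_of_canonical (hσ 5) (hσ 6) (by norm_num) (key 5) (key 6)
    certify_far ![z, y, e, f, b, a, a'] hm hz hg A
  exact_mod_cast h

theorem abs_normProb_near_le (y y' e f a b z : Fin 6) {g : Fin 6 → ℝ} {m : ℝ} (hm : 0 < m)
    (hz : g z = 0) (hg : ∀ s, s ≠ z → m ≤ g s ∧ g s ≤ 5 / 4 * m) (A : Finset (Fin 6)) :
    |normProb (fun s => ((if s = y then 0 else triangleWt s y e f a b : ℕ) : ℝ) * g s) A -
      normProb (fun s => ((if s = y' then 0 else triangleWt s y' e f a b : ℕ) : ℝ) * g s) A| ≤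
      33 / 100 := by
  have key : ∀ (i : Fin 7) (x : Fin 7 → Fin 6) (s : Fin 6),
      nearNat i ((List.ofFn x).map Fin.val) s =
        if s = x i then 0 else triangleWt s (x i) (x 3) (x 4) (x 5) (x 6) := fun i x s => by
    have e := getD_map_ofFn x
    rw [nearNat, e i, show ((List.ofFn x).map Fin.val).getD 3 0 = x 3 from e 3,
      show ((List.ofFn x).map Fin.val).getD 4 0 = x 4 from e 4,
      show ((List.ofFn x).map Fin.val).getD 5 0 = x 5 from e 5,
      show ((List.ofFn x).map Fin.val).getD 6 0 = x 6 from e 6, cond_beq_val, triangleWtNat_eq]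
  have hσ : ∀ (i : Fin 7) (σ : Equiv.Perm (Fin 6)) (x : Fin 7 → Fin 6) (s : Fin 6),
      (if σ s = (σ ∘ x) i then 0 else triangleWt (σ s) ((σ ∘ x) i) ((σ ∘ x) 3) ((σ ∘ x) 4)
        ((σ ∘ x) 5) ((σ ∘ x) 6)) =
        if s = x i then 0 else triangleWt s (x i) (x 3) (x 4) (x 5) (x 6) := fun i σ x s => by
    simp only [Function.comp_apply, triangleWt_map, σ.injective.eq_iff]
  have h := abs_normProb_sub_le_of_canonical (hσ 1) (hσ 2) (by norm_num) (key 1) (key 2)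
    certify_near ![z, y, y', e, f, a, b] hm hz hg A
  exact_mod_cast h

/-- A test for the weights of a triangle to vary by a factor of at most `5 / 4`; the arguments are
listed as `z, e, f, c, d`. -/
def ratioNat (l : List ℕ) : Bool :=
  let T := fun s => triangleWtNat s (l.getD 0 0) (l.getD 1 0) (l.getD 2 0) (l.getD 3 0)
    (l.getD 4 0)
  spins.any fun s₀ => !Nat.beq (T s₀) 0 && spins.all fun s =>
    Nat.beq s (l.getD 0 0) || (Nat.ble (T s₀) (T s) && Nat.ble (4 * T s) (5 * T s₀))

theorem ratioNat_canonical : (canonicalLists 6 5).all (fun p => ratioNat p.1) = true := by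
  decide +kernel

theorem mem_spins (s : Fin 6) : s.val ∈ spins := by
  revert s
  decide

/-- This supplies the ratio 5/4 assumed of the unchanged factor. The constant `m` is the least value
over `s ≠ z`, found by inspecting the canonical lists of length 5. -/
theorem exists_triangleWt_mem_Icc (z e f c d : Fin 6) : ∃ m : ℝ, 0 < m ∧ ∀ s, s ≠ z →
    m ≤ triangleWt s z e f c d ∧ (triangleWt s z e f c d : ℝ) ≤ 5 / 4 * m := by
  refine forall_list_of_canonical (q := 6) (n := 5)
    (P := fun l => ∀ z e f c d, l = [z, e, f, c, d] → ∃ m : ℝ, 0 < m ∧ ∀ s, s ≠ z →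
      m ≤ triangleWt s z e f c d ∧ (triangleWt s z e f c d : ℝ) ≤ 5 / 4 * m)
    (c := ratioNat) (fun σ l hl z e f c d h => ?_) ratioNat_canonical
    (fun l _ hl z e f c d h => ?_) [z, e, f, c, d] rfl z e f c d rfl
  · obtain ⟨m, hm, hs⟩ := hl (σ z) (σ e) (σ f) (σ c) (σ d) (by rw [h]; rfl)
    refine ⟨m, hm, fun s hsz => ?_⟩
    have := hs (σ s) (σ.injective.ne hsz)
    rwa [triangleWt_map] at this
  · subst h
    obtain ⟨s₀, -, h⟩ := List.any_eq_true.1 hl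
    simp only [Bool.and_eq_true, Bool.not_eq_true', List.all_eq_true, Bool.or_eq_true] at h
    obtain ⟨h0, h⟩ := h
    refine ⟨(triangleWtNat s₀ z e f c d : ℕ), Nat.cast_pos.2 (Nat.pos_of_ne_zero fun h0' => ?_),
      fun s hs => ?_⟩
    · have hT : Nat.beq (triangleWtNat s₀ z e f c d) 0 = false := h0
      rw [h0'] at hT
      exact Bool.noConfusion hT
    · rcases h s (mem_spins s) with h | ⟨h1, h2⟩
      · exact absurd (Fin.ext (Nat.eq_of_beq_eq_true h)) hs
      · have k1 : triangleWtNat s₀ z e f c d ≤ triangleWtNat s z e f c d := Nat.ble_eq.mp h1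
        have k2 : 4 * triangleWtNat s z e f c d ≤ 5 * triangleWtNat s₀ z e f c d :=
          Nat.ble_eq.mp h2
        rw [triangleWtNat_eq] at k1 k2
        have k1' : ((triangleWtNat s₀ z e f c d : ℕ) : ℝ) ≤ triangleWt s z e f c d := by
          exact_mod_cast k1
        have k2' : (4 : ℝ) * triangleWt s z e f c d ≤ 5 * (triangleWtNat s₀ z e f c d : ℕ) := by
          exact_mod_cast k2
        exact ⟨k1', by linarith⟩

theorem exists_factor_mem_Icc (z e f c d : Fin 6) : ∃ m : ℝ, 0 < m ∧ ∀ s, s ≠ z →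
    m ≤ ((if s = z then 0 else triangleWt s z e f c d : ℕ) : ℝ) ∧
      ((if s = z then 0 else triangleWt s z e f c d : ℕ) : ℝ) ≤ 5 / 4 * m := by
  obtain ⟨m, hm, h⟩ := exists_triangleWt_mem_Icc z e f c d
  exact ⟨m, hm, fun s hs => by rw [if_neg hs]; exact h s hs⟩

theorem clusterWt_eq {q : ℕ} (t : Fin 9 → Fin q) : (fun s => (clusterWt t s : ℝ)) = fun s =>
    ((if s = t 0 then 0 else triangleWt s (t 0) (t 2) (t 3) (t 5) (t 6) : ℕ) : ℝ) *
      ((if s = t 1 then 0 else triangleWt s (t 1) (t 2) (t 4) (t 7) (t 8) : ℕ) : ℝ) := by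
  funext s
  rw [clusterWt]
  by_cases h0 : s = t 0
  · rw [if_pos h0, if_neg (by tauto), Nat.cast_zero, zero_mul]
  · by_cases h1 : s = t 1
    · rw [if_pos h1, if_neg (by tauto), Nat.cast_zero, mul_zero]
    · rw [if_neg h0, if_neg h1, if_pos ⟨h0, h1⟩, Nat.cast_mul]

theorem influence_clusterWt_zero_le :
    influence (q := 6) (fun t s => (clusterWt t s : ℝ)) 0 ≤ ENNReal.ofReal (33 / 100) := by
  refine influence_le fun t t' ht A => ?_
  obtain ⟨m, hm, hg⟩ := exists_factor_mem_Icc (t 1) (t 2) (t 4) (t 7) (t 8)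
  rw [clusterWt_eq, clusterWt_eq]
  simp only [← ht 1 (by decide), ← ht 2 (by decide), ← ht 3 (by decide), ← ht 4 (by decide),
    ← ht 5 (by decide), ← ht 6 (by decide), ← ht 7 (by decide), ← ht 8 (by decide)]
  exact abs_normProb_near_le _ _ _ _ _ _ (t 1) hm (by rw [if_pos rfl, Nat.cast_zero]) hg A

theorem influence_clusterWt_five_le :
    influence (q := 6) (fun t s => (clusterWt t s : ℝ)) 5 ≤ ENNReal.ofReal (42 / 1000) := by
  refine influence_le fun t t' ht A => ?_
  obtain ⟨m, hm, hg⟩ := exists_factor_mem_Icc (t 1) (t 2) (t 4) (t 7) (t 8)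
  rw [clusterWt_eq, clusterWt_eq]
  simp only [← ht 0 (by decide), ← ht 1 (by decide), ← ht 2 (by decide), ← ht 3 (by decide),
    ← ht 4 (by decide), ← ht 6 (by decide), ← ht 7 (by decide), ← ht 8 (by decide)]
  exact abs_normProb_far_le _ _ _ _ _ _ (t 1) hm (by rw [if_pos rfl, Nat.cast_zero]) hg A

/-- The two vertices of the triangle away from the site play the same role in `triangleWt`, so a
fourth neighbour is covered by the estimate used for third neighbours. -/
theorem influence_clusterWt_three_le :
    influence (q := 6) (fun t s => (clusterWt t s : ℝ)) 3 ≤ ENNReal.ofReal (42 / 1000) := by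
  refine influence_le fun t t' ht A => ?_
  obtain ⟨m, hm, hg⟩ := exists_factor_mem_Icc (t 1) (t 2) (t 4) (t 7) (t 8)
  rw [clusterWt_eq, clusterWt_eq]
  simp only [← ht 0 (by decide), ← ht 1 (by decide), ← ht 2 (by decide), ← ht 4 (by decide),
    ← ht 5 (by decide), ← ht 6 (by decide), ← ht 7 (by decide), ← ht 8 (by decide)]
  simp only [fun s => triangleWt_comm s (t 0) (t 2) (t 3) (t 5) (t 6),
    fun s => triangleWt_comm s (t 0) (t 2) (t' 3) (t 5) (t 6),
    fun s => triangleWt_swap₃ s (t 0) (t 5) (t 6) (t 2)]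
  exact abs_normProb_far_le _ _ _ _ _ _ (t 1) hm (by rw [if_pos rfl, Nat.cast_zero]) hg A

/-- The second neighbour occurs in both factors. They are changed one after the other, each time
with the other factor as `g`, and the two bounds of 42/1000 add up. -/
theorem influence_clusterWt_two_le :
    influence (q := 6) (fun t s => (clusterWt t s : ℝ)) 2 ≤ ENNReal.ofReal (84 / 1000) := by
  refine influence_le fun t t' ht A => ?_
  obtain ⟨m, hm, hg⟩ := exists_factor_mem_Icc (t 1) (t 7) (t 8) (t 2) (t 4)
  obtain ⟨m', hm', hg'⟩ := exists_factor_mem_Icc (t 0) (t 5) (t 6) (t' 2) (t 3)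
  rw [clusterWt_eq, clusterWt_eq]
  simp only [← ht 0 (by decide), ← ht 1 (by decide), ← ht 3 (by decide), ← ht 4 (by decide),
    ← ht 5 (by decide), ← ht 6 (by decide), ← ht 7 (by decide), ← ht 8 (by decide)]
  simp only [fun s x => triangleWt_comm s (t 0) x (t 3) (t 5) (t 6),
    fun s x => triangleWt_comm s (t 1) x (t 4) (t 7) (t 8)]
  have h1 := abs_normProb_far_le (t 0) (t 5) (t 6) (t 3) (t 2) (t' 2) (t 1) hm
    (by rw [if_pos rfl, Nat.cast_zero]) hg A
  have h2 := abs_normProb_far_le (t 1) (t 7) (t 8) (t 4) (t 2) (t' 2) (t 0) hm'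
    (by rw [if_pos rfl, Nat.cast_zero]) hg' A
  simp only [mul_comm] at h1 h2 ⊢
  refine (abs_sub_le _ _ _).trans ((add_le_add h1 h2).trans ?_)
  norm_num

end ClusterBounds

/-! ### Results on the triangle decimation, and the Potts model for `q = 6`. -/

section ClusterModel

variable {q : ℕ}

theorem dobrushin_triangleCluster (q : ℕ) [NeZero q] :
    (decimated kagome triangleCluster q).dobrushin =
      2 * influence (q := q) (fun t s => (clusterWt t s : ℝ)) 0 +
        influence (q := q) (fun t s => (clusterWt t s : ℝ)) 2 +
        4 * influence (q := q) (fun t s => (clusterWt t s : ℝ)) 5 +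
        2 * influence (q := q) (fun t s => (clusterWt t s : ℝ)) 3 := by
  have : Nonempty (Remaining triangleCluster) := ⟨clusterRem (0, 1) (by simp [IsClusterRem])⟩
  obtain ⟨h1, h2, h3⟩ := influence_clusterWt q
  rw [dobrushin_eq fun x => by
    obtain ⟨i₁, i₂, nb, h⟩ := exists_clusterChart x
    exact ⟨nb, h.localChart q⟩]
  simp only [Fin.sum_univ_succ, Fin.sum_univ_zero]
  change _ + (influence (q := q) (fun t s => (clusterWt t s : ℝ)) 1 +
    (influence (q := q) (fun t s => (clusterWt t s : ℝ)) 2 +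
    (influence (q := q) (fun t s => (clusterWt t s : ℝ)) 3 +
    (influence (q := q) (fun t s => (clusterWt t s : ℝ)) 4 +
    (influence (q := q) (fun t s => (clusterWt t s : ℝ)) 5 +
    (influence (q := q) (fun t s => (clusterWt t s : ℝ)) 6 +
    (influence (q := q) (fun t s => (clusterWt t s : ℝ)) 7 +
    (influence (q := q) (fun t s => (clusterWt t s : ℝ)) 8 + 0)))))))) = _
  rw [h1, h2, h3 6 (by decide), h3 7 (by decide), h3 8 (by decide)]
  ring

theorem dobrushin_triangleCluster_six_lt_one :
    (decimated kagome triangleCluster 6).dobrushin < 1 := by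
  rw [dobrushin_triangleCluster]
  calc _ ≤ 2 * ENNReal.ofReal (33 / 100) + ENNReal.ofReal (84 / 1000) +
        4 * ENNReal.ofReal (42 / 1000) + 2 * ENNReal.ofReal (42 / 1000) := by
        gcongr
        exacts [influence_clusterWt_zero_le, influence_clusterWt_two_le,
          influence_clusterWt_five_le, influence_clusterWt_three_le]
    _ = ENNReal.ofReal (2 * (33 / 100) + 84 / 1000 + 4 * (42 / 1000) + 2 * (42 / 1000)) := by
        rw [ENNReal.ofReal_add (by norm_num) (by norm_num),
          ENNReal.ofReal_add (by norm_num) (by norm_num),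
          ENNReal.ofReal_add (by norm_num) (by norm_num), ENNReal.ofReal_mul (by norm_num),
          ENNReal.ofReal_mul (p := 4) (by norm_num), ENNReal.ofReal_mul (p := 2) (by norm_num)]
        norm_num
    _ < 1 := by
        rw [ENNReal.ofReal_lt_one]
        norm_num

theorem partition_triangleCluster_pos (hq : 4 ≤ q) (x : Remaining triangleCluster)
    (σ : Remaining triangleCluster → Fin q) :
    0 < (decimated kagome triangleCluster q).partition {x} σ := by
  obtain ⟨i₁, i₂, nb, h⟩ := exists_clusterChart x
  rw [(h.localChart q).partition_eq]
  exact sum_clusterWt_pos hq _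

theorem interdep_triangleCluster (q : ℕ) [NeZero q] :
    (∀ x y, Cluster1 x y → (decimated kagome triangleCluster q).interdep x y =
      influence (q := q) (fun t s => (clusterWt t s : ℝ)) 0) ∧
    (∀ x y, Cluster2 x y → (decimated kagome triangleCluster q).interdep x y =
      influence (q := q) (fun t s => (clusterWt t s : ℝ)) 2) ∧
    (∀ x y, Cluster3 x y → (decimated kagome triangleCluster q).interdep x y =
      influence (q := q) (fun t s => (clusterWt t s : ℝ)) 5) ∧
    (∀ x y, Cluster4 x y → (decimated kagome triangleCluster q).interdep x y =
      influence (q := q) (fun t s => (clusterWt t s : ℝ)) 3) ∧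
    (∀ x y, x ≠ y → ¬ Cluster1 x y → ¬ Cluster2 x y → ¬ Cluster3 x y → ¬ Cluster4 x y →
      (decimated kagome triangleCluster q).interdep x y = 0) := by
  obtain ⟨h1, h4, h3⟩ := influence_clusterWt q
  refine ⟨fun x y hxy => ?_, fun x y hxy => ?_, fun x y hxy => ?_, fun x y hxy => ?_,
    fun x y hne n1 n2 n3 n4 => ?_⟩ <;> obtain ⟨i₁, i₂, nb, h⟩ := exists_clusterChart x
  · rcases (h.link y).1 hxy with rfl | rfl
    · exact (h.localChart q).interdep_eq 0
    · rw [(h.localChart q).interdep_eq 1, h1]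
  · rw [(h.cluster2_iff y).1 hxy]
    exact (h.localChart q).interdep_eq 2
  · obtain ⟨j, hj, rfl⟩ := (h.cluster3_iff y).1 hxy
    rw [(h.localChart q).interdep_eq j, h3 j hj]
  · rcases (h.cluster4_iff y).1 hxy with rfl | rfl
    · exact (h.localChart q).interdep_eq 3
    · rw [(h.localChart q).interdep_eq 4, h4]
  · refine (h.localChart q).interdep_eq_zero fun j hj => ?_
    rw [h.link] at n1
    rw [h.cluster2_iff] at n2
    rw [h.cluster3_iff] at n3
    rw [h.cluster4_iff] at n4
    rcases lt_or_ge j 5 with hlt | hge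
    · have : j = 0 ∨ j = 1 ∨ j = 2 ∨ j = 3 ∨ j = 4 := by
        clear * - hlt
        revert j
        decide
      rcases this with rfl | rfl | rfl | rfl | rfl
      exacts [n1 (Or.inl hj.symm), n1 (Or.inr hj.symm), n2 hj.symm, n4 (Or.inl hj.symm),
        n4 (Or.inr hj.symm)]
    · exact n3 ⟨j, hge, hj.symm⟩

theorem uniqueWithDecay_triangleCluster_six :
    UniqueWithDecay (remDist triangleCluster) (decimated kagome triangleCluster 6) :=
  decimable_triangleCluster.uniqueWithDecay_decimated isClique_triangleCluster
    (partition_triangleCluster_pos (by norm_num)) dobrushin_triangleCluster_six_lt_one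

theorem exists_borders_triangleCluster (i : (ℤ × ℤ) ⊕ (ℤ × ℤ)) :
    ∃ x, Borders kagome triangleCluster i x := by
  rcases i with ⟨i, j⟩ | ⟨i, j⟩
  · exact ⟨clusterRem (4 * i + 1, 4 * j + 2) (by simp only [IsClusterRem]; omega),
      borders_inl.2 (by simp)⟩
  · exact ⟨clusterRem (4 * i + 1, 4 * j) (by simp only [IsClusterRem]; omega),
      borders_inr.2 (by simp)⟩

theorem uniqueWithDecay_kagome_six : UniqueWithDecay kagome.dist (potts kagome 6) := by
  refine decimable_triangleCluster.uniqueWithDecay_potts isClique_triangleCluster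
    (partition_potts_kagome_pos (by norm_num)) (partition_triangleCluster_pos (by norm_num))
    dobrushin_triangleCluster_six_lt_one exists_borders_triangleCluster (n := 10) (fun x => ?_)
  obtain ⟨i₁, i₂, nb, h⟩ := exists_clusterChart x
  refine ncard_closureOf_decimated_le (nb := nb) (fun y hy => ?_) (fun i hi y hy => ?_)
  · rcases (h.link y).1 hy with rfl | rfl <;> exact ⟨_, rfl⟩
  · rcases (h.borders i).1 hi with rfl | rfl
    · rcases (h.plaquette₁ y).1 hy with h | h | h | h | h | h
      · exact Or.inl h
      all_goals exact Or.inr ⟨_, h.symm⟩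
    · rcases (h.plaquette₂ y).1 hy with h | h | h | h | h | h
      · exact Or.inl h
      all_goals exact Or.inr ⟨_, h.symm⟩

end ClusterModel

end

end KagomePotts

theorem mainTheorem5 :
    -- uniqueness and exponential decay on the Kagomé lattice
    (∀ q : ℕ, 6 ≤ q → UniqueWithDecay kagome.dist (potts kagome q)) ∧
    -- cluster decimation: geometry
    ((∀ i, (triangleCluster i).ncard = 3 ∧ kagome.IsClique (triangleCluster i)) ∧
      SeparatedClusters kagome triangleCluster ∧
      (∃ e : Remaining triangleCluster ≃ HexSite,
        (∀ x y, hexagonal.Adj (e x) (e y) ↔ (Cluster1 x y ∨ Cluster2 x y)) ∧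
        (∀ i, ∃ p : ℤ × ℤ, (3 : ℤ) ∣ p.1 - p.2 ∧
          ∀ x, Borders kagome triangleCluster i x ↔ triangular.Adj p (e x))) ∧
      (∀ x, {y | Cluster1 x y}.ncard = 2 ∧ {y | Cluster2 x y}.ncard = 1 ∧
        {y | Cluster3 x y}.ncard = 4 ∧ {y | Cluster4 x y}.ncard = 2)) ∧
    -- cluster decimation: the decimated model and its Dobrushin constant
    (∀ q : ℕ, 4 ≤ q →
      DecimationMapsGibbs kagome triangleCluster q ∧
      (∀ x σ, 0 < (decimated kagome triangleCluster q).partition {x} σ) ∧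
      ∃ c₁ c₂ c₃ c₄ : ENNReal,
        (∀ x y, Cluster1 x y → (decimated kagome triangleCluster q).interdep x y = c₁) ∧
        (∀ x y, Cluster2 x y → (decimated kagome triangleCluster q).interdep x y = c₂) ∧
        (∀ x y, Cluster3 x y → (decimated kagome triangleCluster q).interdep x y = c₃) ∧
        (∀ x y, Cluster4 x y → (decimated kagome triangleCluster q).interdep x y = c₄) ∧
        (∀ x y, x ≠ y → ¬ Cluster1 x y → ¬ Cluster2 x y → ¬ Cluster3 x y → ¬ Cluster4 x y →
          (decimated kagome triangleCluster q).interdep x y = 0) ∧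
        (decimated kagome triangleCluster q).dobrushin = 2 * c₁ + c₂ + 4 * c₃ + 2 * c₄) ∧
    (decimated kagome triangleCluster 6).dobrushin < 1 ∧
    UniqueWithDecay (remDist triangleCluster) (decimated kagome triangleCluster 6) ∧
    -- single-site decimation: geometry
    ((∀ i, (topVertex i).ncard = 1) ∧
      SeparatedClusters kagome topVertex ∧
      (∃ e : Remaining topVertex ≃ ℤ × ℤ,
        (∀ x y, SiteNN x y ↔ (e x).2 = (e y).2 ∧ |(e x).1 - (e y).1| = 1) ∧
        (∀ i, ∃ a b : ℤ, ∀ x, Borders kagome topVertex i x ↔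
          e x ∈ ({(a, b), (a + 1, b), (a, b + 1), (a + 1, b + 1)} : Set (ℤ × ℤ)))) ∧
      (∀ x, {y | SiteNN x y}.ncard = 2 ∧ {y | SiteNNN x y}.ncard = 4)) ∧
    -- single-site decimation: the decimated model and its Dobrushin constant
    (∀ q : ℕ, 5 ≤ q →
      DecimationMapsGibbs kagome topVertex q ∧
      (∀ x σ, 0 < (decimated kagome topVertex q).partition {x} σ) ∧
      (∃ c c' : ENNReal,
        (∀ x y, SiteNN x y → (decimated kagome topVertex q).interdep x y = c) ∧
        (∀ x y, SiteNNN x y → (decimated kagome topVertex q).interdep x y = c') ∧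
        (∀ x y, x ≠ y → ¬ SiteNN x y → ¬ SiteNNN x y →
          (decimated kagome topVertex q).interdep x y = 0) ∧
        (decimated kagome topVertex q).dobrushin = 2 * c + 4 * c') ∧
      ((decimated kagome topVertex q).dobrushin < 1 ↔ 7 ≤ q)) ∧
    (∀ q : ℕ, 7 ≤ q →
      UniqueWithDecay (remDist topVertex) (decimated kagome topVertex q)) := by
  refine ⟨fun q hq => ?_, ⟨fun i => ⟨ncard_triangleCluster i, isClique_triangleCluster i⟩,
    separated_triangleCluster, ⟨hexEquiv, fun x y => ?_, hexEquiv_borders⟩, fun x => ?_⟩,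
    fun q hq => ?_, dobrushin_triangleCluster_six_lt_one, uniqueWithDecay_triangleCluster_six,
    ⟨ncard_topVertex, separated_topVertex, ⟨squareEquiv, squareEquiv_siteNN, squareEquiv_borders⟩,
      fun x => ?_⟩, fun q hq => ?_, fun q hq => uniqueWithDecay_topVertex hq⟩
  -- For `q = 6` the single-site decimation violates the Dobrushin condition, so this case relies on
  -- the triangles.
  · rcases hq.eq_or_lt with rfl | hq
    · exact uniqueWithDecay_kagome_six
    · exact uniqueWithDecay_kagome_of_seven_le hq
  · obtain ⟨i₁, i₂, nb, h⟩ := exists_clusterChart x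
    rw [h.hex, h.link, h.cluster2_iff, or_assoc]
  · obtain ⟨i₁, i₂, nb, h⟩ := exists_clusterChart x
    exact h.ncard_cluster
  · have : NeZero q := ⟨by omega⟩
    obtain ⟨h1, h2, h3, h4, h0⟩ := interdep_triangleCluster q
    exact ⟨decimable_triangleCluster.decimationMapsGibbs q, partition_triangleCluster_pos hq,
      _, _, _, _, h1, h2, h3, h4, h0, dobrushin_triangleCluster q⟩
  · obtain ⟨i₁, i₂, nb, h⟩ := exists_siteChart x
    exact ⟨h.ncard_nn, h.ncard_nnn⟩
  · have : NeZero q := ⟨by omega⟩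
    obtain ⟨h1, h2, h0⟩ := interdep_topVertex q
    exact ⟨decimable_topVertex.decimationMapsGibbs q, partition_topVertex_pos hq,
      ⟨_, _, h1, h2, h0, dobrushin_topVertex q⟩, dobrushin_topVertex_lt_one_iff hq⟩
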